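/- **Setting.** For each $n\in\mathbb N$ consider a group matrix network autoregression with $N_1$ row subjects, $N_2$ column subjects, $T$ time points, $G$ row groups, $H$ column groups and covariate dimensions $p_1,p_2$; all of these, the networks, parameters, memberships and the probability space may depend on $n$ (the index is suppressed). Let $m=p_1+p_2+3$. Let $A_1,A_2$ be adjacency matrices (nonnegative entries, zero diagonal), $w_{1ik}=a_{1ik}/\sum_l a_{1il}$ and $w_{2kj}=a_{2kj}/\sum_l a_{2lj}$. With true memberships $g_i^0\in[G]$, $h_j^0\in[H]$ and true parameters $\theta^0=(\lambda_g^0,\zeta_g^0,\gamma_h^0,\delta_h^0,\alpha_{gh}^0)$, for $t\in\mathbb Z$ $$Y_{ijt}=\lambda^0_{g^0_i}\sum_k w_{1ik}Y_{kj(t-1)}+\gamma^0_{h^0_j}\sum_k Y_{ik(t-1)}w_{2kj}+\alpha^0_{g^0_ih^0_j}Y_{ij(t-1)}+x_{it}^\top\zeta^0_{g^0_i}+z_{jt}^\top\delta^0_{h^0_j}+\varepsilon_{ijt},$$ where the covariates $x_{it}\in\mathbb R^{p_1}$, $z_{jt}\in\mathbb R^{p_2}$ are exogenous: $(x,z)$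 is independent of $\varepsilon$. Let $\mathcal X_{ijt}\in\mathbb R^m$ be the regressor vector $(\sum_k w_{1ik}Y_{kj(t-1)},x_{it},\sum_kY_{ik(t-1)}w_{2kj},z_{jt},Y_{ij(t-1)})$. **Assumptions**, with constants $R,\tau,\sigma,c,K,\bar c>0$, $\kappa<1$ and $C$ not depending on $n$: 1. All entries of $\theta^0$ are smaller than $R$ in absolute value. 2. $\lambda_{\min}(E\,\mathcal X_{ijt}\mathcal X_{ijt}^\top)\ge\tau$ for all $i,j,t$. 3. The $\varepsilon_{ijt}$ are i.i.d. over $i,j,t$, $E\varepsilon_{ijt}=0$, $E\exp(u\varepsilon_{ijt})\le\exp(\sigma^2u^2/2)$ for all $u\in\mathbb R$, and $\varepsilon_{ijt}$ is independent of $(Y_s)_{s\le t-1},(x_{\cdot s})_{s\le t},(z_{\cdot s})_{s\le t}$. 4. $Ex_{it}=0$, $Ez_{jt}=0$, and for all deterministic vectors $\eta_{1i},\eta_{1i}'\in\mathbb R^{p_1}$, $\eta_{2j},\eta_{2j}'\in\mathbb R^{p_2}$ of norm at most $c$, the random vector with coordinates $x_{it}^\top\eta_{1i},\ x_{it}^\top\eta'_{1i},\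 z_{jt}^\top\eta_{2j},\ z_{jt}^\top\eta'_{2j}$ ($0\le t\le T$, all $i,j$), call it $V$, has the $K$-convex concentration property: for every convex $1$-Lipschitz $\varphi$, $E|\varphi(V)|<\infty$ and $P(|\varphi(V)-E\varphi(V)|\ge s)\le 2e^{-s^2/K^2}$ for all $s>0$. 5. $\max_{g,h}|\lambda_g^0+\gamma_h^0+\alpha_{gh}^0|\le\kappa$; the autoregression is stable uniformly in $n$, that is, the $k$-step map of $y\mapsto\big(\lambda^0_{g^0_i}\sum_l w_{1il}y_{lj}+\gamma^0_{h^0_j}\sum_l y_{il}w_{2lj}+\alpha^0_{g^0_ih^0_j}y_{ij}\big)_{ij}$ has operator norm at most $C\kappa^k$ in the entrywise maximum norm, for all $k\ge0$; and $(Y_t,x_{\cdot t},z_{\cdot t})_{t\in\mathbb Z}$ is strictly stationary with $EY_{ijt}^2<\infty$. 6. For some $0<c_{\rm gap}=c_{{\rm gap},n}\le\bar c$ (possibly $c_{\rm gap}\to0$): $(\lambda^0_{g}-\lambda^0_{g'})^2+\|\zeta^0_{g}-\zeta^0_{g'}\|^2+\max_h|\alpha^0_{gh}-\alpha^0_{g'h}|^2\ge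 c_{\rm gap}$ for all $g\ne g'$, and $(\gamma^0_{h}-\gamma^0_{h'})^2+\|\delta^0_{h}-\delta^0_{h'}\|^2+\max_g|\alpha^0_{gh}-\alpha^0_{gh'}|^2\ge c_{\rm gap}$ for all $h\ne h'$. 7. For some $c_\pi=c_{\pi,n}>0$ (possibly $c_\pi\to0$), every true row group has at least $c_\pi N_1$ members and every true column group at least $c_\pi N_2$ members. **Estimators.** Let $Q(\theta,\mathcal G,\mathcal H)$ be the sum over $i\in[N_1]$, $j\in[N_2]$, $t\in[T]$ of the squared residuals of $Y_{ijt}$ under parameter $\theta$ and memberships $\mathcal G=(g_i)\in[G]^{N_1}$, $\mathcal H=(h_j)\in[H]^{N_2}$. Let $(\hat\theta,\hat{\mathcal G},\hat{\mathcal H})$ be any joint minimizer of $Q$, with the true numbers $G,H$ of groups, and let the oracle estimator $\hat\theta^{\rm or}$ be any minimizer of $\theta\mapsto Q(\theta,\mathcal G^0,\mathcal H^0)$ at the true memberships. In both cases $\theta$ ranges over the same set, which is either the parameter space of all $\theta$ with entries in $[-R,R]$, or the set of all $\theta$ (unconstrained least squares). **Claim.** Suppose $N_1,N_2,T\to\infty$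 (in any manner) and $$\frac{T^{1/2}c_{\rm gap}c_\pi^2}{\log(N_1N_2H)+m}\to\infty .$$ Then, with probability tending to one, there are permutations $s$ of $[G]$ and $r$ of $[H]$ with $\hat g_i=s(g_i^0)$ for all $i$ and $\hat h_j=r(h_j^0)$ for all $j$. Moreover, with probability tending to one, there are such permutations for which, in addition, $\hat\theta$ relabelled by $(s,r)$ equals the oracle: $\hat\lambda_{s(g)}=\hat\lambda_g^{\rm or}$, $\hat\zeta_{s(g)}=\hat\zeta_g^{\rm or}$, $\hat\gamma_{r(h)}=\hat\gamma_h^{\rm or}$, $\hat\delta_{r(h)}=\hat\delta_h^{\rm or}$, $\hat\alpha_{s(g)r(h)}=\hat\alpha_{gh}^{\rm or}$ for all $g,h$. -/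

import Mathlib

open MeasureTheory ProbabilityTheory Filter Topology
open scoped NNReal

/-- Group-wise parameters with `G` row groups and `H` column groups: row network effects `lam`,
row covariate effects `zeta`, column network effects `gam`, column covariate effects `delta`,
and self-driven effects `alpha`. -/
@[ext]
structure GroupParams (p₁ p₂ G H : ℕ) where
  lam : Fin G → ℝ
  zeta : Fin G → Fin p₁ → ℝ
  gam : Fin H → ℝ
  delta : Fin H → Fin p₂ → ℝ
  alpha : Fin G → Fin H → ℝ

namespace GroupParams

variable {p₁ p₂ G H : ℕ}

/-- All coordinates of the parameter lie in `D`. -/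
def CoordsIn (θ : GroupParams p₁ p₂ G H) (D : Set ℝ) : Prop :=
  (∀ g, θ.lam g ∈ D) ∧ (∀ g k, θ.zeta g k ∈ D) ∧ (∀ h, θ.gam h ∈ D) ∧
    (∀ h k, θ.delta h k ∈ D) ∧ (∀ g h, θ.alpha g h ∈ D)

/-- The parameter in which row label `g` is read as `s g` and column label `h` as `r h`. -/
def relabel (θ : GroupParams p₁ p₂ G H) (s : Equiv.Perm (Fin G)) (r : Equiv.Perm (Fin H)) :
    GroupParams p₁ p₂ G H where
  lam g := θ.lam (s g)
  zeta g := θ.zeta (s g)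
  gam h := θ.gam (r h)
  delta h := θ.delta (r h)
  alpha g h := θ.alpha (s g) (r h)

/-- `‖θ_g^r - θ_g'^r‖² + max_h |α_gh - α_g'h|²`. -/
noncomputable def rowGap (θ : GroupParams p₁ p₂ G H) (g g' : Fin G) : ℝ :=
  (θ.lam g - θ.lam g') ^ 2 + (∑ k, (θ.zeta g k - θ.zeta g' k) ^ 2) +
    ⨆ h, |θ.alpha g h - θ.alpha g' h| ^ 2

/-- `‖θ_h^c - θ_h'^c‖² + max_g |α_gh - α_gh'|²`. -/
noncomputable def colGap (θ : GroupParams p₁ p₂ G H) (h h' : Fin H) : ℝ :=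
  (θ.gam h - θ.gam h') ^ 2 + (∑ k, (θ.delta h k - θ.delta h' k) ^ 2) +
    ⨆ g, |θ.alpha g h - θ.alpha g h'| ^ 2

end GroupParams

/-- The `K`-convex concentration property of a random vector `V`. -/
def ConvexConcentration {Ω ι : Type*} [MeasurableSpace Ω] [Fintype ι] (μ : Measure Ω)
    (V : Ω → EuclideanSpace ℝ ι) (K : ℝ) : Prop :=
  ∀ φ : EuclideanSpace ℝ ι → ℝ, ConvexOn ℝ Set.univ φ → LipschitzWith 1 φ →
    Integrable (fun ω => φ (V ω)) μ ∧
    ∀ s : ℝ, 0 < s →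
      μ.real {ω | s ≤ |φ (V ω) - ∫ ω', φ (V ω') ∂μ|} ≤ 2 * Real.exp (-(s ^ 2 / K ^ 2))

/-- Row-normalized adjacency matrix, `a_ik / ∑_l a_il`. -/
noncomputable def rowNormalize {N : ℕ} (A : Matrix (Fin N) (Fin N) ℝ) :
    Matrix (Fin N) (Fin N) ℝ :=
  fun i k => A i k / ∑ l, A i l

/-- Column-normalized adjacency matrix, `a_kj / ∑_l a_lj`. -/
noncomputable def colNormalize {N : ℕ} (A : Matrix (Fin N) (Fin N) ℝ) :
    Matrix (Fin N) (Fin N) ℝ :=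
  fun k j => A k j / ∑ l, A l j

/-- The objects of one group matrix network autoregression, without any property: dimensions,
number `T` of time points used for estimation, numbers of groups, networks, true parameters and
memberships, a probability space, and on it the matrix-valued series `Y`, the row covariates `X`,
the column covariates `Z` and the noise `E`, all indexed by time in `ℤ`. -/
structure GMNAR where
  N₁ : ℕ
  N₂ : ℕ
  T : ℕ
  p₁ : ℕ
  p₂ : ℕ
  G : ℕ
  H : ℕ
  A₁ : Matrix (Fin N₁) (Fin N₁) ℝ
  A₂ : Matrix (Fin N₂) (Fin N₂) ℝ
  θ₀ : GroupParams p₁ p₂ G H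
  g₀ : Fin N₁ → Fin G
  h₀ : Fin N₂ → Fin H
  Ω : Type*
  [mΩ : MeasurableSpace Ω]
  μ : Measure Ω
  Y : ℤ → Ω → Fin N₁ → Fin N₂ → ℝ
  X : ℤ → Ω → Fin N₁ → Fin p₁ → ℝ
  Z : ℤ → Ω → Fin N₂ → Fin p₂ → ℝ
  E : ℤ → Ω → Fin N₁ → Fin N₂ → ℝ

attribute [instance] GMNAR.mΩ

namespace GMNAR

variable (M : GMNAR)

/-- The parameters of `M`. -/
abbrev Params : Type := GroupParams M.p₁ M.p₂ M.G M.H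

/-- The row network regressor `∑_k w_{1ik} y_kj`. -/
noncomputable def rowNet (y : Fin M.N₁ → Fin M.N₂ → ℝ) (i : Fin M.N₁) (j : Fin M.N₂) : ℝ :=
  ∑ k, rowNormalize M.A₁ i k * y k j

/-- The column network regressor `∑_k y_ik w_{2kj}`. -/
noncomputable def colNet (y : Fin M.N₁ → Fin M.N₂ → ℝ) (i : Fin M.N₁) (j : Fin M.N₂) : ℝ :=
  ∑ k, y i k * colNormalize M.A₂ k j

/-- The conditional mean of `Y_ijt` when row `i` has label `g`, column `j` has label `h` and the
parameter is `θ`. -/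
noncomputable def fitted (θ : M.Params) (g : Fin M.G) (h : Fin M.H) (i : Fin M.N₁) (j : Fin M.N₂)
    (t : ℤ) (ω : M.Ω) : ℝ :=
  θ.lam g * M.rowNet (M.Y (t - 1) ω) i j + θ.gam h * M.colNet (M.Y (t - 1) ω) i j
    + θ.alpha g h * M.Y (t - 1) ω i j
    + (∑ k, M.X t ω i k * θ.zeta g k) + ∑ k, M.Z t ω j k * θ.delta h k

/-- The standing model: a probability space, random variables, networks with nonnegative weights
and no self-loops, the autoregression with the true parameters and memberships, and covariates
that are exogenous (independent of the noise). -/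
def IsModel : Prop :=
  IsProbabilityMeasure M.μ ∧
  (∀ t, Measurable (M.Y t)) ∧ (∀ t, Measurable (M.X t)) ∧ (∀ t, Measurable (M.Z t)) ∧
  (∀ t, Measurable (M.E t)) ∧
  (∀ i k, 0 ≤ M.A₁ i k) ∧ (∀ i, M.A₁ i i = 0) ∧
  (∀ j k, 0 ≤ M.A₂ j k) ∧ (∀ j, M.A₂ j j = 0) ∧
  (∀ t i j, ∀ᵐ ω ∂M.μ,
    M.Y t ω i j = M.fitted M.θ₀ (M.g₀ i) (M.h₀ j) i j t ω + M.E t ω i j) ∧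
  IndepFun (fun ω t => M.E t ω) (fun ω t => (M.X t ω, M.Z t ω)) M.μ

/-- Parameter space: the true parameter has all entries smaller than `R` in absolute value. -/
def ParamSpace (R : ℝ) : Prop := M.θ₀.CoordsIn (Set.Ioo (-R) R)

/-- Index set of the `p₁ + p₂ + 3` coordinates of the regressor. -/
abbrev RegIdx : Type := Unit ⊕ Fin M.p₁ ⊕ Unit ⊕ Fin M.p₂ ⊕ Unit

/-- The regressor: row network effect, row covariates, column network effect,
column covariates, lagged response. -/
noncomputable def regressor (i : Fin M.N₁) (j : Fin M.N₂) (t : ℤ) (ω : M.Ω) : M.RegIdx → ℝ :=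
  Sum.elim (fun _ => M.rowNet (M.Y (t - 1) ω) i j) <|
  Sum.elim (M.X t ω i) <|
  Sum.elim (fun _ => M.colNet (M.Y (t - 1) ω) i j) <|
  Sum.elim (M.Z t ω j) (fun _ => M.Y (t - 1) ω i j)

/-- Second moment matrix of the regressor. -/
noncomputable def Sig (i : Fin M.N₁) (j : Fin M.N₂) (t : ℤ) : Matrix M.RegIdx M.RegIdx ℝ :=
  fun a b => ∫ ω, M.regressor i j t ω a * M.regressor i j t ω b ∂M.μ

/-- Convexity: all eigenvalues of all second moment matrices are at least `τ`. -/
def Convexity (τ : ℝ) : Prop := ∀ i j t, (M.Sig i j t - τ • 1).PosSemidef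

/-- Noise: i.i.d. over rows, columns and time, zero-mean, sub-Gaussian with scale factor `σ`,
and `ε_ijt` independent of `Y` before time `t` and of `X`, `Z` up to time `t`. -/
def NoiseAssumption (σ : ℝ≥0) : Prop :=
  iIndepFun (fun (q : Fin M.N₁ × Fin M.N₂ × ℤ) ω => M.E q.2.2 ω q.1 q.2.1) M.μ ∧
  (∀ i j t i' j' t',
    IdentDistrib (fun ω => M.E t ω i j) (fun ω => M.E t' ω i' j') M.μ M.μ) ∧
  (∀ i j t, ∫ ω, M.E t ω i j ∂M.μ = 0) ∧
  (∀ i j t, HasSubgaussianMGF (fun ω => M.E t ω i j) (σ ^ 2) M.μ) ∧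
  (∀ i j (t : ℤ), IndepFun (fun ω => M.E t ω i j)
    (fun ω => ((fun s : Set.Iio t => M.Y s ω), (fun s : Set.Iic t => M.X s ω),
      (fun s : Set.Iic t => M.Z s ω))) M.μ)

/-- The covariates over times `0, …, T`, each projected on two directions
`η₁ 0 i, η₁ 1 i` (row `i`) or `η₂ 0 j, η₂ 1 j` (column `j`), as one vector. -/
noncomputable def projCov (η₁ : Fin 2 → Fin M.N₁ → EuclideanSpace ℝ (Fin M.p₁))
    (η₂ : Fin 2 → Fin M.N₂ → EuclideanSpace ℝ (Fin M.p₂)) (ω : M.Ω) :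
    EuclideanSpace ℝ (Fin (M.T + 1) × Fin 2 × (Fin M.N₁ ⊕ Fin M.N₂)) :=
  WithLp.toLp 2 fun q =>
    Sum.elim (fun i => ∑ k, M.X ((q.1 : ℕ) : ℤ) ω i k * η₁ q.2.1 i k)
      (fun j => ∑ k, M.Z ((q.1 : ℕ) : ℤ) ω j k * η₂ q.2.1 j k) q.2.2

/-- Covariates: centered, and all projections on directions of length at most `c` satisfy the
`K`-convex concentration property. -/
def CovariateAssumption (c K : ℝ) : Prop :=
  (∀ t i k, ∫ ω, M.X t ω i k ∂M.μ = 0) ∧ (∀ t j k, ∫ ω, M.Z t ω j k ∂M.μ = 0) ∧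
  ∀ η₁ η₂, (∀ r i, ‖η₁ r i‖ ≤ c) → (∀ r j, ‖η₂ r j‖ ≤ c) →
    ConvexConcentration M.μ (M.projCov η₁ η₂) K

/-- One step of the autoregression without covariates and noise. -/
noncomputable def transition (y : Fin M.N₁ → Fin M.N₂ → ℝ) : Fin M.N₁ → Fin M.N₂ → ℝ :=
  fun i j => M.θ₀.lam (M.g₀ i) * M.rowNet y i j + M.θ₀.gam (M.h₀ j) * M.colNet y i j
    + M.θ₀.alpha (M.g₀ i) (M.h₀ j) * y i j

/-- Stationarity: `|λ_g + γ_h + α_gh| ≤ κ`; the autoregression is stable (its `k`-step transition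
map is at most `C κ ^ k` in the entrywise maximum norm); and the series, with its covariates, is
square integrable and strictly stationary. -/
def Stationarity (κ C : ℝ) : Prop :=
  (∀ g h, |M.θ₀.lam g + M.θ₀.gam h + M.θ₀.alpha g h| ≤ κ) ∧
  (∀ (k : ℕ) (y : Fin M.N₁ → Fin M.N₂ → ℝ), (∀ i j, |y i j| ≤ 1) →
    ∀ i j, |(M.transition^[k] y) i j| ≤ C * κ ^ k) ∧
  (∀ t i j, MemLp (fun ω => M.Y t ω i j) 2 M.μ) ∧
  ∀ s : ℤ, IdentDistrib (fun ω (t : ℤ) => (M.Y t ω, M.X t ω, M.Z t ω))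
    (fun ω (t : ℤ) => (M.Y (t + s) ω, M.X (t + s) ω, M.Z (t + s) ω)) M.μ M.μ

/-- Group difference: distinct groups are separated by at least `cgap`. -/
def GroupDifference (cgap : ℝ) : Prop :=
  (∀ g g', g ≠ g' → cgap ≤ M.θ₀.rowGap g g') ∧ (∀ h h', h ≠ h' → cgap ≤ M.θ₀.colGap h h')

/-- Group proportion: each group contains at least a share `cpi` of the subjects. -/
def GroupProportion (cpi : ℝ) : Prop :=
  (∀ g, cpi ≤ (Finset.univ.filter (fun i => M.g₀ i = g)).card / (M.N₁ : ℝ)) ∧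
  (∀ h, cpi ≤ (Finset.univ.filter (fun j => M.h₀ j = h)).card / (M.N₂ : ℝ))

/-- The least squares objective. -/
noncomputable def Q (ω : M.Ω) (θ : M.Params) (g : Fin M.N₁ → Fin M.G) (h : Fin M.N₂ → Fin M.H) :
    ℝ :=
  ∑ i, ∑ j, ∑ t ∈ Finset.Icc (1 : ℤ) M.T, (M.Y t ω i j - M.fitted θ (g i) (h j) i j t ω) ^ 2

/-- `(θ, g, h)` minimizes `Q` jointly over the parameters with coordinates in `D` and all
memberships. -/
def IsEstimate (D : Set ℝ) (ω : M.Ω) (θ : M.Params) (g : Fin M.N₁ → Fin M.G)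
    (h : Fin M.N₂ → Fin M.H) : Prop :=
  θ.CoordsIn D ∧ ∀ (θ' : M.Params) g' h', θ'.CoordsIn D → M.Q ω θ g h ≤ M.Q ω θ' g' h'

/-- `θ` minimizes `Q` at the true memberships over the parameters with coordinates in `D`. -/
def IsOracle (D : Set ℝ) (ω : M.Ω) (θ : M.Params) : Prop :=
  θ.CoordsIn D ∧ ∀ θ' : M.Params, θ'.CoordsIn D → M.Q ω θ M.g₀ M.h₀ ≤ M.Q ω θ' M.g₀ M.h₀

/-- `m = p₁ + p₂ + 3`. -/
def m : ℕ := M.p₁ + M.p₂ + 3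

end GMNAR

/-- The events `S n` hold with probability tending to one: `S n` contains measurable sets whose
probabilities tend to one (no measurability of `S n` itself is needed). -/
def WithProbToOne (M : ℕ → GMNAR) (S : ∀ n, Set (M n).Ω) : Prop :=
  ∃ A : ∀ n, Set (M n).Ω, (∀ n, MeasurableSet (A n)) ∧ (∀ n, A n ⊆ S n) ∧
    Tendsto (fun n => (M n).μ (A n)) atTop (𝓝 1)

/-! Relative to its value at the truth, the objective is a sum over entries (i, j) of losses `loss
v`, where v is the error of the coefficient vector assigned to the entry and `loss v` is `quad v`
minus twice `cross v`: the empirical energy of v · regressor against its empirical covariance with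
the noise (`Q_eq_add_loss`). All the probability goes into one event, `LossBounds`: for all entries
and all vectors v at once, the loss lies between α|v|² - b and β|v|² + b, with α of order T, β of
order mT and b of order L = log(N₁N₂H) + m. Because v is unrestricted, boundedness of the parameter
space plays no role, and the estimators may be arbitrary functions on the probability space.

On that event recovery is deterministic (`exists_perm_of_loss`). A joint minimizer has total loss at
most zero, so its coefficient error is small on average, and every true group, holding a share cpi
of the rows, contains a representative row with small error. Moving a row to the estimated label of
its group's representative cannot decrease the objective, and this bounds the error of every single
row. Rows of different true groups then cannot share an estimated label, since their true profiles,
averaged over the columns, are cpi * cgap apart. Hence the map from a group to its representative's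
label is injective, so a permutation. One factor cpi comes from the representatives, the other from
passing from a maximum over groups to an average over members. Columns are treated symmetrically.
The relabelled estimate minimizes the objective at the true memberships; as `quad` is positive
definite there, this minimizer is unique and is the oracle.

For the event, fix an entry. Whitening and a net of the sphere reduce the claim to one direction v
with E(v · regressor)² = 1, at a cost exponential in m. Unrolling the recursion down to time 0
writes v · regressor as a linear function of the covariates, plus noise of each lag, plus a
geometrically decaying trace of the initial response. The root mean square of the covariate part is
a convex Lipschitz function of the projected covariates, so it concentrates. The noise is then added
one lag at a time: for a fixed lag, the cross terms form a martingale transform and the squares are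
squares of independent sub-Gaussian variables (`LagNoise.le_lagSum_sq`). Only comparability of the
energy with T is needed, so the exceptional probability is of order T exp(-aT/m). The covariance
with the noise obeys a self-normalized martingale bound (`noise_tail`).

The rate hypothesis forces √T / L → ∞, so T/m dominates the logarithm of the number of entries and
net points, and it also yields the separation required by the deterministic argument. -/

/-! ### Exponential inequalities for adapted sub-Gaussian sequences. -/

section Generic

variable {Ω : Type*} [mΩ : MeasurableSpace Ω] {μ : Measure Ω}

/-- If `ξ t` is independent of the past `m t`, the product of past-dependent factors with
conditional expectation at most one has expectation at most one. -/
theorem lintegral_prod_le_one [IsProbabilityMeasure μ] {m : ℕ → MeasurableSpace Ω}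
    (hm : Monotone m) (hle : ∀ t, m t ≤ mΩ) {ξ a : ℕ → Ω → ℝ}
    (hξ : ∀ t, Measurable[m (t + 1)] (ξ t)) (ha : ∀ t, Measurable[m t] (a t))
    (hind : ∀ t, Indep (MeasurableSpace.comap (ξ t) inferInstance) (m t) μ)
    {ψ : ℕ → ℝ → ℝ → ENNReal} (hψ : ∀ t, Measurable (Function.uncurry (ψ t)))
    (h1 : ∀ t x, ∫⁻ ω, ψ t x (ξ t ω) ∂μ ≤ 1) (n : ℕ) :
    ∫⁻ ω, ∏ t ∈ Finset.range n, ψ t (a t ω) (ξ t ω) ∂μ ≤ 1 := by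
  induction n with
  | zero => simp
  | succ n ih =>
    simp_rw [Finset.prod_range_succ]
    set W : Ω → ENNReal := fun ω => ∏ t ∈ Finset.range n, ψ t (a t ω) (ξ t ω) with hW
    have hWm : Measurable[m n] W := by
      refine Finset.measurable_prod _ fun t ht => ?_
      have ht' := Finset.mem_range.1 ht
      have h1 : Measurable[m n] (a t) := (ha t).mono (hm ht'.le) le_rfl
      have h2 : Measurable[m n] (ξ t) := (hξ t).mono (hm ht') le_rfl
      exact (hψ t).comp (Measurable.prodMk h1 h2)
    have hξ' : Measurable (ξ n) := (hξ n).mono (hle _) le_rfl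
    have hp : Measurable[m n] (fun ω => (W ω, a n ω)) := Measurable.prodMk hWm (ha n)
    have hp' : Measurable (fun ω => (W ω, a n ω)) := hp.mono (hle _) le_rfl
    -- The new factor sees the past only through the pair (W, a n), which is independent of `ξ n`;
    -- Fubini then integrates out `ξ n` with the pair frozen.
    have hI : IndepFun (fun ω => (W ω, a n ω)) (ξ n) μ := by
      rw [IndepFun_iff_Indep]
      exact (indep_of_indep_of_le_right (hind n) hp.comap_le).symm
    have hmap := (indepFun_iff_map_prod_eq_prod_map_map hp'.aemeasurable hξ'.aemeasurable).1 hI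
    have hmeas : Measurable (fun z : (ENNReal × ℝ) × ℝ => z.1.1 * ψ n z.1.2 z.2) :=
      (measurable_fst.comp measurable_fst).mul
        ((hψ n).comp ((measurable_snd.comp measurable_fst).prodMk measurable_snd))
    calc ∫⁻ ω, W ω * ψ n (a n ω) (ξ n ω) ∂μ
        = ∫⁻ z, z.1.1 * ψ n z.1.2 z.2 ∂(μ.map fun ω => ((W ω, a n ω), ξ n ω)) := by
          rw [lintegral_map hmeas (hp'.prodMk hξ')]
      _ = ∫⁻ z, ∫⁻ y, z.1 * ψ n z.2 y ∂(μ.map (ξ n)) ∂(μ.map fun ω => (W ω, a n ω)) := by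
          rw [hmap]
          have := Measure.isProbabilityMeasure_map (μ := μ) hξ'.aemeasurable
          rw [lintegral_prod _ hmeas.aemeasurable]
      _ ≤ ∫⁻ z, z.1 ∂(μ.map fun ω => (W ω, a n ω)) := by
          refine lintegral_mono fun z => ?_
          have hz : Measurable (fun y => ψ n z.2 y) := (hψ n).comp (measurable_const.prodMk measurable_id)
          rw [lintegral_const_mul _ hz, lintegral_map hz hξ']
          exact mul_le_of_le_one_right' (h1 n z.2)
      _ = ∫⁻ ω, W ω ∂μ := by rw [lintegral_map measurable_fst hp']
      _ ≤ 1 := ih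

theorem measure_le_of_lintegral_exp_le {S : Ω → ℝ} (hS : AEMeasurable S μ)
    (h : ∫⁻ ω, ENNReal.ofReal (Real.exp (S ω)) ∂μ ≤ 1) (x : ℝ) :
    μ {ω | x ≤ S ω} ≤ ENNReal.ofReal (Real.exp (-x)) := by
  have h0 : ENNReal.ofReal (Real.exp x) ≠ 0 := by simp [Real.exp_pos]
  have h2 := meas_ge_le_lintegral_div (μ := μ) (f := fun ω => ENNReal.ofReal (Real.exp (S ω)))
    (Real.measurable_exp.comp_aemeasurable hS).ennreal_ofReal h0 ENNReal.ofReal_ne_top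
  calc μ {ω | x ≤ S ω} ≤ μ {ω | ENNReal.ofReal (Real.exp x) ≤ ENNReal.ofReal (Real.exp (S ω))} := by
        refine measure_mono fun ω hω => ?_
        exact ENNReal.ofReal_le_ofReal (Real.exp_le_exp.2 hω)
    _ ≤ (∫⁻ ω, ENNReal.ofReal (Real.exp (S ω)) ∂μ) / ENNReal.ofReal (Real.exp x) := h2
    _ ≤ 1 / ENNReal.ofReal (Real.exp x) := by gcongr
    _ = ENNReal.ofReal (Real.exp (-x)) := by
        rw [Real.exp_neg, ENNReal.ofReal_inv_of_pos (Real.exp_pos x), one_div]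

/-- Chernoff bound for sums of past-dependent terms. -/
theorem measure_sum_ge_le_exp [IsProbabilityMeasure μ] {m : ℕ → MeasurableSpace Ω}
    (hm : Monotone m) (hle : ∀ t, m t ≤ mΩ) {ξ a : ℕ → Ω → ℝ}
    (hξ : ∀ t, Measurable[m (t + 1)] (ξ t)) (ha : ∀ t, Measurable[m t] (a t))
    (hind : ∀ t, Indep (MeasurableSpace.comap (ξ t) inferInstance) (m t) μ)
    {φ : ℕ → ℝ → ℝ → ℝ} (hφ : ∀ t, Measurable (Function.uncurry (φ t)))
    (h1 : ∀ t x, ∫⁻ ω, ENNReal.ofReal (Real.exp (φ t x (ξ t ω))) ∂μ ≤ 1) (n : ℕ) (x : ℝ) :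
    μ {ω | x ≤ ∑ t ∈ Finset.range n, φ t (a t ω) (ξ t ω)} ≤ ENNReal.ofReal (Real.exp (-x)) := by
  have hξ' : ∀ t, Measurable (ξ t) := fun t => (hξ t).mono (hle _) le_rfl
  have ha' : ∀ t, Measurable (a t) := fun t => (ha t).mono (hle _) le_rfl
  refine measure_le_of_lintegral_exp_le ?_ ?_ x
  · exact (Finset.measurable_sum _ fun t _ => (hφ _).comp ((ha' t).prodMk (hξ' t))).aemeasurable
  · have := lintegral_prod_le_one hm hle hξ ha hind
      (ψ := fun t x y => ENNReal.ofReal (Real.exp (φ t x y)))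
      (fun t => (Real.measurable_exp.comp (hφ t)).ennreal_ofReal) h1 n
    refine le_trans (le_of_eq ?_) this
    refine lintegral_congr fun ω => ?_
    rw [Real.exp_sum, ENNReal.ofReal_prod_of_nonneg fun _ _ => (Real.exp_pos _).le]

theorem ProbabilityTheory.HasSubgaussianMGF.lintegral_exp_mul_le {X : Ω → ℝ} {s : ℝ≥0}
    (h : HasSubgaussianMGF X s μ) (u : ℝ) :
    ∫⁻ ω, ENNReal.ofReal (Real.exp (u * X ω)) ∂μ ≤ ENNReal.ofReal (Real.exp (s * u ^ 2 / 2)) := by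
  rw [← ofReal_integral_eq_lintegral_ofReal (h.integrable_exp_mul u)
    (ae_of_all _ fun _ => (Real.exp_pos _).le)]
  exact ENNReal.ofReal_le_ofReal (h.mgf_le u)

theorem ProbabilityTheory.HasSubgaussianMGF.of_le {X : Ω → ℝ} {s s' : ℝ≥0}
    (h : HasSubgaussianMGF X s μ) (hs : s ≤ s') : HasSubgaussianMGF X s' μ where
  integrable_exp_mul := h.integrable_exp_mul
  mgf_le t := (h.mgf_le t).trans (by
    apply Real.exp_le_exp.2
    have : (s : ℝ) ≤ s' := hs
    gcongr)

/-- Self-normalized bound for a martingale transform with sub-Gaussian increments. -/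
theorem measure_sum_mul_ge_le [IsProbabilityMeasure μ] {m : ℕ → MeasurableSpace Ω}
    (hm : Monotone m) (hle : ∀ t, m t ≤ mΩ) {ξ a : ℕ → Ω → ℝ}
    (hξ : ∀ t, Measurable[m (t + 1)] (ξ t)) (ha : ∀ t, Measurable[m t] (a t))
    (hind : ∀ t, Indep (MeasurableSpace.comap (ξ t) inferInstance) (m t) μ)
    {s : ℝ≥0} (hs : ∀ t, HasSubgaussianMGF (ξ t) s μ) (n : ℕ) {l : ℝ} (x : ℝ) :
    μ {ω | l ^ 2 * s / 2 * ∑ t ∈ Finset.range n, a t ω ^ 2 + x ≤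
      l * ∑ t ∈ Finset.range n, a t ω * ξ t ω} ≤ ENNReal.ofReal (Real.exp (-x)) := by
  have := measure_sum_ge_le_exp hm hle hξ ha hind
    (φ := fun _ y z => l * (y * z) - l ^ 2 * s / 2 * y ^ 2) (fun _ => by
      unfold Function.uncurry; fun_prop) (fun t y => ?_) n x
  · refine le_trans (le_of_eq ?_) this
    congr 1; ext ω
    simp only [Set.mem_ofPred_eq, Finset.sum_sub_distrib, ← Finset.mul_sum]
    constructor <;> intro h <;> linarith
  · have h2 := (hs t).lintegral_exp_mul_le (l * y)
    calc ∫⁻ ω, ENNReal.ofReal (Real.exp (l * (y * ξ t ω) - l ^ 2 * s / 2 * y ^ 2)) ∂μ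
        = ∫⁻ ω, ENNReal.ofReal (Real.exp (l * y * ξ t ω)) *
            ENNReal.ofReal (Real.exp (- (s * (l * y) ^ 2 / 2))) ∂μ := by
          refine lintegral_congr fun ω => ?_
          rw [← ENNReal.ofReal_mul (Real.exp_pos _).le, ← Real.exp_add]
          congr 2; ring
      _ = (∫⁻ ω, ENNReal.ofReal (Real.exp (l * y * ξ t ω)) ∂μ) *
            ENNReal.ofReal (Real.exp (- (s * (l * y) ^ 2 / 2))) := by
          rw [lintegral_mul_const' _ _ ENNReal.ofReal_ne_top]
      _ ≤ ENNReal.ofReal (Real.exp (s * (l * y) ^ 2 / 2)) *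
            ENNReal.ofReal (Real.exp (- (s * (l * y) ^ 2 / 2))) := by gcongr
      _ = 1 := by
          rw [← ENNReal.ofReal_mul (Real.exp_pos _).le, ← Real.exp_add]; simp

/-- Exponential moment of the square of a sub-Gaussian variable. -/
theorem ProbabilityTheory.HasSubgaussianMGF.lintegral_exp_sq_le [SFinite μ] {X : Ω → ℝ} {s : ℝ≥0}
    (h : HasSubgaussianMGF X s μ) (hs : 0 < s) :
    ∫⁻ ω, ENNReal.ofReal (Real.exp (X ω ^ 2 / (4 * s))) ∂μ ≤ 2 := by
  set γ := gaussianReal 0 1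
  -- Gaussian linearization: for an auxiliary standard Gaussian z, exp(x²/(4s)) is the mean of exp(r
  -- x z), because r²/2 = 1/(4s). After exchanging integrals, sub-Gaussianity leaves the mean of
  -- exp(z²/4), which is √2.
  set r : ℝ := 1 / Real.sqrt (2 * s) with hr
  have hs' : (0 : ℝ) < s := by exact_mod_cast hs
  have hr2 : r ^ 2 = 1 / (2 * s) := by
    rw [hr, div_pow, Real.sq_sqrt (by positivity), one_pow]
  have hg : ∀ y : ℝ, ∫⁻ z, ENNReal.ofReal (Real.exp (y * z)) ∂γ =
      ENNReal.ofReal (Real.exp (y ^ 2 / 2)) := by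
    intro y
    rw [← ofReal_integral_eq_lintegral_ofReal (integrable_exp_mul_gaussianReal y)
      (ae_of_all _ fun _ => (Real.exp_pos _).le)]
    have := mgf_gaussianReal (p := γ) (X := id) (μ := 0) (v := 1) (by simp [γ]) y
    simp only [mgf, id] at this
    rw [this]; congr 2; simp
  have hgauss : ∫⁻ z, ENNReal.ofReal (Real.exp (z ^ 2 / 4)) ∂γ ≤ 2 := by
    have hfin : ∫⁻ z, ENNReal.ofReal (Real.exp (z ^ 2 / 4)) ∂γ =
        ENNReal.ofReal (Real.sqrt 2) := by
      rw [show γ = gaussianReal 0 1 from rfl, gaussianReal_of_var_ne_zero _ one_ne_zero,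
        lintegral_withDensity_eq_lintegral_mul _ (measurable_gaussianPDF _ _) (by fun_prop)]
      have : ∀ z : ℝ, (gaussianPDF 0 1 * fun z => ENNReal.ofReal (Real.exp (z ^ 2 / 4))) z =
          ENNReal.ofReal ((Real.sqrt (2 * Real.pi))⁻¹ * Real.exp (-(1 / 4) * z ^ 2)) := by
        intro z
        simp only [Pi.mul_apply, gaussianPDF, gaussianPDFReal]
        rw [← ENNReal.ofReal_mul (by positivity)]
        congr 1
        rw [mul_assoc, ← Real.exp_add]
        simp only [NNReal.coe_one, mul_one, sub_zero]
        congr 2; ring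
      simp_rw [this]
      rw [← ofReal_integral_eq_lintegral_ofReal
        ((integrable_exp_neg_mul_sq (by norm_num)).const_mul _)
        (ae_of_all _ fun _ => by positivity), integral_const_mul, integral_gaussian]
      congr 1
      rw [← Real.sqrt_inv, ← Real.sqrt_mul (by positivity)]
      congr 1
      field_simp; norm_num
    rw [hfin]
    rw [show (2 : ENNReal) = ENNReal.ofReal 2 by simp]
    apply ENNReal.ofReal_le_ofReal
    rw [Real.sqrt_le_left (by norm_num)]; norm_num
  obtain ⟨X', hX'm, hXX'⟩ := h.aemeasurable
  calc ∫⁻ ω, ENNReal.ofReal (Real.exp (X ω ^ 2 / (4 * s))) ∂μ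
      = ∫⁻ ω, ENNReal.ofReal (Real.exp (X' ω ^ 2 / (4 * s))) ∂μ :=
        lintegral_congr_ae (hXX'.mono fun ω hω => by simp only [hω])
    _ = ∫⁻ ω, ∫⁻ z, ENNReal.ofReal (Real.exp (r * X' ω * z)) ∂γ ∂μ := by
        refine lintegral_congr fun ω => ?_
        rw [hg]; congr 2; rw [mul_pow, hr2]; field_simp; norm_num
    _ = ∫⁻ z, ∫⁻ ω, ENNReal.ofReal (Real.exp (r * X' ω * z)) ∂μ ∂γ := by
        rw [lintegral_lintegral_swap]
        exact (Measurable.aemeasurable (by unfold Function.uncurry; fun_prop))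
    _ = ∫⁻ z, ∫⁻ ω, ENNReal.ofReal (Real.exp (r * z * X ω)) ∂μ ∂γ := by
        refine lintegral_congr fun z => lintegral_congr_ae (hXX'.mono fun ω hω => ?_)
        simp only [hω]; congr 2; ring
    _ ≤ ∫⁻ z, ENNReal.ofReal (Real.exp (z ^ 2 / 4)) ∂γ := by
        refine lintegral_mono fun z => (h.lintegral_exp_mul_le _).trans (le_of_eq ?_)
        congr 2; rw [mul_pow, hr2]; field_simp; ring
    _ ≤ 2 := hgauss

theorem ProbabilityTheory.HasSubgaussianMGF.integral_pow_four_le [IsProbabilityMeasure μ]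
    {X : Ω → ℝ} {s : ℝ≥0}
    (h : HasSubgaussianMGF X s μ) (hs : 0 < s) : ∫ ω, X ω ^ 4 ∂μ ≤ 64 * s ^ 2 := by
  have hs' : (0 : ℝ) < s := by exact_mod_cast hs
  have hint : Integrable (fun ω => X ω ^ 4) μ := by
    have := (h.memLp 4).integrable_norm_pow (p := 4) (by norm_num)
    refine this.congr (ae_of_all _ fun ω => ?_)
    simp [Real.norm_eq_abs, Even.pow_abs (show Even 4 by decide)]
  have h1 : ENNReal.ofReal (∫ ω, X ω ^ 4 ∂μ) ≤ ENNReal.ofReal (64 * s ^ 2) := by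
    rw [ofReal_integral_eq_lintegral_ofReal hint (ae_of_all _ fun _ => by positivity)]
    calc ∫⁻ ω, ENNReal.ofReal (X ω ^ 4) ∂μ
        ≤ ∫⁻ ω, ENNReal.ofReal (32 * s ^ 2) * ENNReal.ofReal (Real.exp (X ω ^ 2 / (4 * s))) ∂μ := by
          refine lintegral_mono fun ω => ?_
          rw [← ENNReal.ofReal_mul (by positivity)]
          apply ENNReal.ofReal_le_ofReal
          have hy : 0 ≤ X ω ^ 2 / (4 * s) := by positivity
          have := Real.quadratic_le_exp_of_nonneg hy
          calc X ω ^ 4 = 32 * s ^ 2 * ((X ω ^ 2 / (4 * s)) ^ 2 / 2) := by field_simp; ring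
            _ ≤ _ := by gcongr; linarith
      _ = ENNReal.ofReal (32 * s ^ 2) * ∫⁻ ω, ENNReal.ofReal (Real.exp (X ω ^ 2 / (4 * s))) ∂μ := by
          rw [lintegral_const_mul' _ _ ENNReal.ofReal_ne_top]
      _ ≤ ENNReal.ofReal (32 * s ^ 2) * 2 := by gcongr; exact h.lintegral_exp_sq_le hs
      _ = ENNReal.ofReal (64 * s ^ 2) := by
          rw [show (2 : ENNReal) = ENNReal.ofReal 2 by simp, ← ENNReal.ofReal_mul (by positivity)]
          congr 1; ring
  exact (ENNReal.ofReal_le_ofReal_iff (by positivity)).1 h1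

/-- The exponent ξ²/(4s) - log 2 has exponential moment at most one. At the threshold 8sn the
exponents sum to 2n - n log 2, which is at least n. -/
theorem measure_sum_sq_ge_le [IsProbabilityMeasure μ] {m : ℕ → MeasurableSpace Ω}
    (hm : Monotone m) (hle : ∀ t, m t ≤ mΩ) {ξ : ℕ → Ω → ℝ}
    (hξ : ∀ t, Measurable[m (t + 1)] (ξ t))
    (hind : ∀ t, Indep (MeasurableSpace.comap (ξ t) inferInstance) (m t) μ)
    {s : ℝ≥0} (hs0 : 0 < s) (hs : ∀ t, HasSubgaussianMGF (ξ t) s μ) (n : ℕ) :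
    μ {ω | 8 * s * n ≤ ∑ t ∈ Finset.range n, ξ t ω ^ 2} ≤ ENNReal.ofReal (Real.exp (-n)) := by
  have hs' : (0 : ℝ) < s := by exact_mod_cast hs0
  have := measure_sum_ge_le_exp (a := fun _ _ => 0) hm hle hξ (fun _ => measurable_const) hind
    (φ := fun _ _ z => z ^ 2 / (4 * s) - Real.log 2) (fun _ => by
      unfold Function.uncurry; fun_prop) (fun t y => ?_) n n
  · refine le_trans (measure_mono fun ω hω => ?_) this
    simp only [Set.mem_ofPred_eq, Finset.sum_sub_distrib, Finset.sum_const, Finset.card_range,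
      nsmul_eq_mul, ← Finset.sum_div] at hω ⊢
    have h2 : (2 : ℝ) * n ≤ (∑ t ∈ Finset.range n, ξ t ω ^ 2) / (4 * s) := by
      rw [le_div_iff₀ (by positivity)]; linarith
    have := Real.log_two_lt_d9
    have hn : (0 : ℝ) ≤ n := Nat.cast_nonneg n
    nlinarith
  · calc ∫⁻ ω, ENNReal.ofReal (Real.exp (ξ t ω ^ 2 / (4 * s) - Real.log 2)) ∂μ
        = ∫⁻ ω, ENNReal.ofReal (Real.exp (ξ t ω ^ 2 / (4 * s))) * ENNReal.ofReal (1 / 2) ∂μ := by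
          refine lintegral_congr fun ω => ?_
          rw [← ENNReal.ofReal_mul (Real.exp_pos _).le, Real.exp_sub, Real.exp_log (by norm_num)]
          congr 1; ring
      _ = (∫⁻ ω, ENNReal.ofReal (Real.exp (ξ t ω ^ 2 / (4 * s))) ∂μ) * ENNReal.ofReal (1 / 2) := by
          rw [lintegral_mul_const' _ _ ENNReal.ofReal_ne_top]
      _ ≤ 2 * ENNReal.ofReal (1 / 2) := by gcongr; exact (hs t).lintegral_exp_sq_le hs0
      _ = 1 := by
          rw [show (2 : ENNReal) = ENNReal.ofReal 2 by simp, ← ENNReal.ofReal_mul (by positivity)]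
          norm_num

/-- Squares are nonnegative, so their lower tail is governed by second and fourth moments alone,
through exp(-y) ≤ 1 - y + y²/2. With E ξ⁴ ≤ 64 s² the exponent per step is l v s - 32 s² l²; the
choice l = v/(64s) maximizes it, with value v²/128. -/
theorem measure_sum_sq_lower_le [IsProbabilityMeasure μ] {m : ℕ → MeasurableSpace Ω}
    (hm : Monotone m) (hle : ∀ t, m t ≤ mΩ) {ξ : ℕ → Ω → ℝ}
    (hξ : ∀ t, Measurable[m (t + 1)] (ξ t))
    (hind : ∀ t, Indep (MeasurableSpace.comap (ξ t) inferInstance) (m t) μ)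
    {s : ℝ≥0} (hs0 : 0 < s) (hs : ∀ t, HasSubgaussianMGF (ξ t) s μ) {w : ℕ → ℝ}
    (n : ℕ) {v : ℝ} (hv : 0 ≤ v) (hw : ∀ t, ∫ ω, ξ t ω ^ 2 ∂μ = w t) :
    μ {ω | ∑ t ∈ Finset.range n, ξ t ω ^ 2 ≤ ∑ t ∈ Finset.range n, w t - v * s * n} ≤
      ENNReal.ofReal (Real.exp (-(v ^ 2 / 128 * n))) := by
  have hs' : (0 : ℝ) < s := by exact_mod_cast hs0
  set l : ℝ := v / (64 * s) with hl
  have hl0 : 0 ≤ l := by positivity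
  have hmom : ∀ t, ∫⁻ ω, ENNReal.ofReal (Real.exp (-(l * ξ t ω ^ 2))) ∂μ ≤
      ENNReal.ofReal (Real.exp (- (l * w t) + 32 * s ^ 2 * l ^ 2)) := by
    intro t
    have hξm : Measurable (ξ t) := (hξ t).mono (hle _) le_rfl
    have i2 : Integrable (fun ω => ξ t ω ^ 2) μ := ((hs t).memLp 2).integrable_sq
    have i4 : Integrable (fun ω => ξ t ω ^ 4) μ := by
      have := ((hs t).memLp 4).integrable_norm_pow (p := 4) (by norm_num)
      refine this.congr (ae_of_all _ fun ω => ?_)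
      simp [Real.norm_eq_abs, Even.pow_abs (show Even 4 by decide)]
    have ie : Integrable (fun ω => Real.exp (-(l * ξ t ω ^ 2))) μ := by
      refine Integrable.of_bound (C := 1) (by fun_prop) (ae_of_all _ fun ω => ?_)
      rw [Real.norm_eq_abs, abs_of_pos (Real.exp_pos _), Real.exp_le_one_iff]
      have : 0 ≤ l * ξ t ω ^ 2 := by positivity
      linarith
    rw [← ofReal_integral_eq_lintegral_ofReal ie (ae_of_all _ fun _ => (Real.exp_pos _).le)]
    apply ENNReal.ofReal_le_ofReal
    have hpt : ∀ y : ℝ, 0 ≤ y → Real.exp (-y) ≤ 1 - y + y ^ 2 / 2 := by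
      intro y hy
      have h1 := Real.quadratic_le_exp_of_nonneg hy
      rw [Real.exp_neg, inv_le_iff_one_le_mul₀ (Real.exp_pos _)]
      have h3 : 0 < 1 - y + y ^ 2 / 2 := by nlinarith [sq_nonneg (y - 1)]
      -- The product equals 1 + y⁴/4.
      have h4 : 1 ≤ (1 - y + y ^ 2 / 2) * (1 + y + y ^ 2 / 2) := by nlinarith [sq_nonneg (y ^ 2)]
      exact h4.trans (by gcongr)
    calc ∫ ω, Real.exp (-(l * ξ t ω ^ 2)) ∂μ
        ≤ ∫ ω, (1 - l * ξ t ω ^ 2 + l ^ 2 / 2 * ξ t ω ^ 4) ∂μ := by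
          refine integral_mono ie (((integrable_const _).sub (i2.const_mul _)).add
            (i4.const_mul _)) fun ω => ?_
          have := hpt (l * ξ t ω ^ 2) (by positivity)
          simp only
          nlinarith [this]
      _ = 1 - l * w t + l ^ 2 / 2 * ∫ ω, ξ t ω ^ 4 ∂μ := by
          have e1 : ∫ ω, (1 - l * ξ t ω ^ 2 + l ^ 2 / 2 * ξ t ω ^ 4) ∂μ =
              ∫ ω, (1 - l * ξ t ω ^ 2) ∂μ + ∫ ω, l ^ 2 / 2 * ξ t ω ^ 4 ∂μ :=
            integral_add ((integrable_const _).sub (i2.const_mul _)) (i4.const_mul _)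
          have e2 : ∫ ω, (1 - l * ξ t ω ^ 2) ∂μ = 1 - l * w t := by
            rw [integral_sub (integrable_const _) (i2.const_mul _), integral_const_mul, hw t]
            simp
          rw [e1, e2, integral_const_mul]
      _ ≤ 1 - l * w t + l ^ 2 / 2 * (64 * s ^ 2) := by
          gcongr; exact (hs t).integral_pow_four_le hs0
      _ ≤ _ := by
          have := Real.add_one_le_exp (- (l * w t) + 32 * s ^ 2 * l ^ 2)
          linarith
  have := measure_sum_ge_le_exp (a := fun _ _ => 0) hm hle hξ (fun _ => measurable_const) hind
    (φ := fun t _ z => l * w t - 32 * s ^ 2 * l ^ 2 - l * z ^ 2) (fun _ => by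
      unfold Function.uncurry; fun_prop) (fun t y => ?_) n (v ^ 2 / 128 * n)
  · refine le_trans (measure_mono fun ω hω => ?_) this
    simp only [Set.mem_ofPred_eq, Finset.sum_sub_distrib, Finset.sum_const, Finset.card_range,
      nsmul_eq_mul, ← Finset.mul_sum] at hω ⊢
    have h2 := mul_le_mul_of_nonneg_left hω hl0
    have h3 : l * (v * s * n) = v ^ 2 / 64 * n := by rw [hl]; field_simp
    have h4 : 32 * (s : ℝ) ^ 2 * l ^ 2 = v ^ 2 / 128 := by rw [hl]; field_simp; norm_num; ring
    rw [h4]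
    rw [mul_sub, h3] at h2
    linarith
  · calc ∫⁻ ω, ENNReal.ofReal (Real.exp (l * w t - 32 * s ^ 2 * l ^ 2 - l * ξ t ω ^ 2)) ∂μ
        = ∫⁻ ω, ENNReal.ofReal (Real.exp (-(l * ξ t ω ^ 2))) *
            ENNReal.ofReal (Real.exp (l * w t - 32 * s ^ 2 * l ^ 2)) ∂μ := by
          refine lintegral_congr fun ω => ?_
          rw [← ENNReal.ofReal_mul (Real.exp_pos _).le, ← Real.exp_add]
          congr 2; ring
      _ = (∫⁻ ω, ENNReal.ofReal (Real.exp (-(l * ξ t ω ^ 2))) ∂μ) *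
            ENNReal.ofReal (Real.exp (l * w t - 32 * s ^ 2 * l ^ 2)) := by
          rw [lintegral_mul_const' _ _ ENNReal.ofReal_ne_top]
      _ ≤ ENNReal.ofReal (Real.exp (- (l * w t) + 32 * s ^ 2 * l ^ 2)) *
            ENNReal.ofReal (Real.exp (l * w t - 32 * s ^ 2 * l ^ 2)) := by gcongr; exact hmom t
      _ = 1 := by
          rw [← ENNReal.ofReal_mul (Real.exp_pos _).le, ← Real.exp_add]; simp

end Generic

/-! ### Energy of a covariate signal plus moving-average noise, one lag at a time. -/

section Energy

variable {Ω : Type*}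

/-- `f` plus the noise terms of lags `k, …, T - 1`. -/
def lagSum (T : ℕ) (f : ℕ → Ω → ℝ) (h : ℕ → ℕ → Ω → ℝ) (k t : ℕ) (ω : Ω) : ℝ :=
  f t ω + ∑ k' ∈ Finset.Ico k T, h k' t ω

theorem lagSum_self (T : ℕ) (f : ℕ → Ω → ℝ) (h : ℕ → ℕ → Ω → ℝ) (t : ℕ) (ω : Ω) :
    lagSum T f h T t ω = f t ω := by simp [lagSum]

theorem lagSum_of_lt {T k : ℕ} (hk : k < T) (f : ℕ → Ω → ℝ) (h : ℕ → ℕ → Ω → ℝ) (t : ℕ) (ω : Ω) :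
    lagSum T f h k t ω = lagSum T f h (k + 1) t ω + h k t ω := by
  simp only [lagSum]
  rw [Finset.sum_eq_sum_Ico_succ_bot hk]; ring

variable [mΩ : MeasurableSpace Ω] {μ : Measure Ω}

/-- The noise of lag `k` at time `t` is a function of the innovation at time `t - k`, the
σ-algebras `𝒢 r` contain all innovations before time `r`, and `f` is measurable with respect to
all of them. -/
structure LagNoise (μ : Measure Ω) (𝒢 : ℤ → MeasurableSpace Ω) (f : ℕ → Ω → ℝ)
    (h : ℕ → ℕ → Ω → ℝ) (sd : ℕ → ℝ≥0) : Prop where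
  mono : Monotone 𝒢
  le : ∀ r, 𝒢 r ≤ mΩ
  meas_f : ∀ r t, Measurable[𝒢 r] (f t)
  meas_h : ∀ k t : ℕ, Measurable[𝒢 ((t : ℤ) - k + 1)] (h k t)
  indep : ∀ k t : ℕ, Indep (MeasurableSpace.comap (h k t) inferInstance) (𝒢 ((t : ℤ) - k)) μ
  sd_pos : ∀ k, 0 < sd k
  subG : ∀ k t, HasSubgaussianMGF (h k t) (sd k ^ 2) μ

variable {𝒢 : ℤ → MeasurableSpace Ω} {f : ℕ → Ω → ℝ} {h : ℕ → ℕ → Ω → ℝ} {sd : ℕ → ℝ≥0}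

theorem LagNoise.measurable_lagSum (H : LagNoise μ 𝒢 f h sd) (T k t : ℕ) :
    Measurable[𝒢 ((t : ℤ) - k)] (lagSum T f h (k + 1) t) := by
  unfold lagSum
  refine (H.meas_f _ t).add (Finset.measurable_sum _ fun k' hk' => ?_)
  have := (Finset.mem_Ico.1 hk').1
  exact (H.meas_h k' t).mono (H.mono (by omega)) le_rfl

/-- Cauchy–Schwarz over the lags with weights `sd k`: the squared noise sum is at most Σ sd times Σ
h²/sd, so the bound involves only the sum of the scales, which is finite uniformly in T when they
decay geometrically. -/
theorem LagNoise.lagSum_sq_le (H : LagNoise μ 𝒢 f h sd) {T : ℕ} (k : ℕ) {ω : Ω}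
    (h2 : ∀ k < T, ∑ t ∈ Finset.range T, h k t ω ^ 2 ≤ 8 * sd k ^ 2 * T) :
    ∑ t ∈ Finset.range T, lagSum T f h k t ω ^ 2 ≤
      2 * ∑ t ∈ Finset.range T, f t ω ^ 2 + 16 * (∑ k ∈ Finset.range T, (sd k : ℝ)) ^ 2 * T := by
  set S := ∑ k ∈ Finset.range T, (sd k : ℝ) with hS
  have hS0 : 0 ≤ S := Finset.sum_nonneg fun _ _ => NNReal.coe_nonneg _
  have hsub : Finset.Ico k T ⊆ Finset.range T := by
    intro x hx; simp at hx ⊢; omega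
  have hpt : ∀ t, lagSum T f h k t ω ^ 2 ≤ 2 * f t ω ^ 2 +
      2 * (S * ∑ k' ∈ Finset.range T, h k' t ω ^ 2 / sd k') := by
    intro t
    have hCS : (∑ k' ∈ Finset.Ico k T, h k' t ω) ^ 2 ≤
        (∑ k' ∈ Finset.Ico k T, (sd k' : ℝ)) * ∑ k' ∈ Finset.Ico k T, h k' t ω ^ 2 / sd k' := by
      apply Finset.sum_sq_le_sum_mul_sum_of_sq_le_mul
      · intro i _; exact NNReal.coe_nonneg _
      · intro i _; positivity
      · intro i _
        have : (0 : ℝ) < sd i := by exact_mod_cast H.sd_pos i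
        exact le_of_eq (by field_simp)
    have h3 : (∑ k' ∈ Finset.Ico k T, (sd k' : ℝ)) ≤ S :=
      Finset.sum_le_sum_of_subset_of_nonneg hsub fun _ _ _ => NNReal.coe_nonneg _
    have h4 : ∑ k' ∈ Finset.Ico k T, h k' t ω ^ 2 / sd k' ≤
        ∑ k' ∈ Finset.range T, h k' t ω ^ 2 / sd k' :=
      Finset.sum_le_sum_of_subset_of_nonneg hsub fun _ _ _ => by positivity
    have h5 : 0 ≤ ∑ k' ∈ Finset.Ico k T, h k' t ω ^ 2 / sd k' :=
      Finset.sum_nonneg fun _ _ => by positivity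
    have h6 := hCS.trans (mul_le_mul h3 h4 h5 hS0)
    unfold lagSum
    nlinarith [sq_nonneg (f t ω - ∑ k' ∈ Finset.Ico k T, h k' t ω)]
  have h7 : ∑ t ∈ Finset.range T, ∑ k' ∈ Finset.range T, h k' t ω ^ 2 / sd k' ≤ 8 * S * T := by
    rw [Finset.sum_comm, hS, Finset.mul_sum, Finset.sum_mul]
    refine Finset.sum_le_sum fun k' hk' => ?_
    have h0 : (0 : ℝ) < sd k' := by exact_mod_cast H.sd_pos k'
    rw [← Finset.sum_div, div_le_iff₀ h0]
    refine (h2 k' (Finset.mem_range.1 hk')).trans (le_of_eq (by ring))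
  calc ∑ t ∈ Finset.range T, lagSum T f h k t ω ^ 2
      ≤ ∑ t ∈ Finset.range T, (2 * f t ω ^ 2 +
      2 * (S * ∑ k' ∈ Finset.range T, h k' t ω ^ 2 / sd k')) := Finset.sum_le_sum fun t _ => hpt t
    _ = 2 * ∑ t ∈ Finset.range T, f t ω ^ 2 +
      2 * (S * ∑ t ∈ Finset.range T, ∑ k' ∈ Finset.range T, h k' t ω ^ 2 / sd k') := by
        rw [Finset.sum_add_distrib, Finset.mul_sum, Finset.mul_sum, Finset.mul_sum]
    _ ≤ _ := by
        have := mul_le_mul_of_nonneg_left h7 hS0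
        nlinarith

/-- The energies of the partial sums telescope in the lag: adding lag k changes the energy by twice
the cross term with the sum over larger lags, plus the energy of lag k itself. The hypotheses bound
each contribution from below with an error proportional to θ and to a power of `sd k`, so the errors
remain summable. -/
theorem LagNoise.le_lagSum_sq (H : LagNoise μ 𝒢 f h sd) {T : ℕ} {w : ℕ → ℕ → ℝ} {θ : ℝ}
    (hθ : 0 ≤ θ) {ω : Ω}
    (h1 : ∀ k < T, -(sd k * θ * (∑ t ∈ Finset.range T, lagSum T f h (k + 1) t ω ^ 2 / 2 + T)) ≤
      ∑ t ∈ Finset.range T, lagSum T f h (k + 1) t ω * h k t ω)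
    (h2 : ∀ k < T, ∑ t ∈ Finset.range T, h k t ω ^ 2 ≤ 8 * sd k ^ 2 * T)
    (h3 : ∀ k < T, ∑ t ∈ Finset.range T, w k t - θ * sd k ^ 2 * T ≤
      ∑ t ∈ Finset.range T, h k t ω ^ 2) :
    ∑ t ∈ Finset.range T, f t ω ^ 2 + ∑ k ∈ Finset.range T, ∑ t ∈ Finset.range T, w k t
      - θ * (∑ k ∈ Finset.range T, (sd k : ℝ)) ^ 2 * T
      - θ * (∑ k ∈ Finset.range T, (sd k : ℝ)) * (2 * ∑ t ∈ Finset.range T, f t ω ^ 2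
        + 16 * (∑ k ∈ Finset.range T, (sd k : ℝ)) ^ 2 * T + 2 * T) ≤
      ∑ t ∈ Finset.range T, lagSum T f h 0 t ω ^ 2 := by
  set S := ∑ k ∈ Finset.range T, (sd k : ℝ) with hS
  set U := 2 * ∑ t ∈ Finset.range T, f t ω ^ 2 + 16 * S ^ 2 * T with hU
  set e : ℕ → ℝ := fun k => ∑ t ∈ Finset.range T, lagSum T f h k t ω ^ 2 with he
  have hstep : ∀ k < T, (∑ t ∈ Finset.range T, w k t) - θ * sd k ^ 2 * T
      - θ * sd k * (U + 2 * T) ≤ e k - e (k + 1) := by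
    intro k hk
    have e1 : e k - e (k + 1) = 2 * ∑ t ∈ Finset.range T, lagSum T f h (k + 1) t ω * h k t ω +
        ∑ t ∈ Finset.range T, h k t ω ^ 2 := by
      simp only [he]
      rw [← Finset.sum_sub_distrib, Finset.mul_sum, ← Finset.sum_add_distrib]
      refine Finset.sum_congr rfl fun t _ => ?_
      rw [lagSum_of_lt hk]; ring
    have h4 := H.lagSum_sq_le (k + 1) h2
    have h5 := h1 k hk
    rw [← Finset.sum_div] at h5
    have h6 : sd k * θ * ((∑ t ∈ Finset.range T, lagSum T f h (k + 1) t ω ^ 2) / 2 + T) ≤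
        sd k * θ * (U / 2 + T) := by gcongr
    rw [e1]
    have := h3 k hk
    nlinarith
  have hsum := Finset.sum_le_sum fun k hk => hstep k (Finset.mem_range.1 hk)
  rw [Finset.sum_range_sub'] at hsum
  have h7 : e T = ∑ t ∈ Finset.range T, f t ω ^ 2 := by simp [he, lagSum_self]
  have h8 : ∑ k ∈ Finset.range T, (sd k : ℝ) ^ 2 ≤ S ^ 2 :=
    Finset.sum_sq_le_sq_sum_of_nonneg fun _ _ => NNReal.coe_nonneg _
  simp only [Finset.sum_sub_distrib, ← Finset.sum_mul, ← Finset.mul_sum] at hsum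
  rw [← hS, h7] at hsum
  have h9 : θ * (∑ k ∈ Finset.range T, (sd k : ℝ) ^ 2) * T ≤ θ * S ^ 2 * T := by gcongr
  nlinarith

theorem LagNoise.measure_bad_le [IsProbabilityMeasure μ] (H : LagNoise μ 𝒢 f h sd) (T : ℕ) {θ : ℝ}
    (hθ : 0 < θ) (hθ1 : θ ≤ 1) :
    μ {ω | ¬ ((∀ k < T,
        -(sd k * θ * (∑ t ∈ Finset.range T, lagSum T f h (k + 1) t ω ^ 2 / 2 + T)) ≤
          ∑ t ∈ Finset.range T, lagSum T f h (k + 1) t ω * h k t ω) ∧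
      (∀ k < T, ∑ t ∈ Finset.range T, h k t ω ^ 2 ≤ 8 * sd k ^ 2 * T) ∧
      (∀ k < T, ∑ t ∈ Finset.range T, ∫ ω', h k t ω' ^ 2 ∂μ - θ * sd k ^ 2 * T ≤
        ∑ t ∈ Finset.range T, h k t ω ^ 2))} ≤
      ENNReal.ofReal (3 * T * Real.exp (-(θ ^ 2 / 128 * T))) := by
  set p := ENNReal.ofReal (Real.exp (-(θ ^ 2 / 128 * T))) with hp
  have hmono : ∀ k : ℕ, Monotone fun t : ℕ => 𝒢 ((t : ℤ) - k) := fun k a b hab =>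
    H.mono (by omega)
  have hmh : ∀ k t : ℕ, Measurable[𝒢 (((t + 1 : ℕ) : ℤ) - k)] (h k t) := fun k t =>
    (H.meas_h k t).mono (H.mono (by push_cast; omega)) le_rfl
  have hsd : ∀ k, (0 : ℝ) < sd k := fun k => by exact_mod_cast H.sd_pos k
  have hT0 : (0 : ℝ) ≤ T := Nat.cast_nonneg T
  have b1 : ∀ k, μ {ω | ¬ -(sd k * θ * (∑ t ∈ Finset.range T, lagSum T f h (k + 1) t ω ^ 2 / 2 + T)) ≤
          ∑ t ∈ Finset.range T, lagSum T f h (k + 1) t ω * h k t ω} ≤ p := by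
    intro k
    have := measure_sum_mul_ge_le (μ := μ) (hmono k) (fun t => H.le _) (ξ := h k)
      (a := lagSum T f h (k + 1)) (hmh k) (H.measurable_lagSum T k) (H.indep k) (H.subG k) T
      -- With this l the variance term l² sd²/2 is θ²/2, so the self-normalized inequality becomes
      -- the required lower bound, negated and multiplied by θ/sd.
      (l := -(θ / sd k)) (θ ^ 2 * T)
    refine (measure_mono fun ω hω => ?_).trans (this.trans ?_)
    · simp only [Set.mem_ofPred_eq, not_le, ← Finset.sum_div] at hω ⊢
      push_cast
      have e1 : (-(θ / (sd k : ℝ))) ^ 2 * (sd k : ℝ) ^ 2 / 2 = θ ^ 2 / 2 := by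
        have := hsd k; field_simp
      rw [e1]
      have h2 : θ / sd k * ∑ t ∈ Finset.range T, lagSum T f h (k + 1) t ω * h k t ω ≤
        θ / sd k * -(sd k * θ * ((∑ t ∈ Finset.range T, lagSum T f h (k + 1) t ω ^ 2) / 2 + T)) :=
        mul_le_mul_of_nonneg_left hω.le (by positivity)
      have e2 : θ / sd k * -(sd k * θ * ((∑ t ∈ Finset.range T, lagSum T f h (k + 1) t ω ^ 2) / 2 + T)) =
        -(θ ^ 2 * ((∑ t ∈ Finset.range T, lagSum T f h (k + 1) t ω ^ 2) / 2 + T)) := by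
        have := hsd k; field_simp
      rw [e2] at h2
      linarith
    · apply ENNReal.ofReal_le_ofReal; apply Real.exp_le_exp.2
      have : 0 ≤ θ ^ 2 * T := by positivity
      linarith
  have b2 : ∀ k, μ {ω | ¬ ∑ t ∈ Finset.range T, h k t ω ^ 2 ≤ 8 * sd k ^ 2 * T} ≤ p := by
    intro k
    have := measure_sum_sq_ge_le (μ := μ) (hmono k) (fun t => H.le _) (ξ := h k)
      (hmh k) (H.indep k) (pow_pos (H.sd_pos k) 2) (H.subG k) T
    refine (measure_mono fun ω hω => ?_).trans (this.trans ?_)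
    · simp only [Set.mem_ofPred_eq, not_le] at hω ⊢
      push_cast; exact hω.le
    · apply ENNReal.ofReal_le_ofReal; apply Real.exp_le_exp.2
      have : θ ^ 2 / 128 ≤ 1 := by nlinarith
      nlinarith
  have b3 : ∀ k, μ {ω | ¬ ∑ t ∈ Finset.range T, ∫ ω', h k t ω' ^ 2 ∂μ - θ * sd k ^ 2 * T ≤
        ∑ t ∈ Finset.range T, h k t ω ^ 2} ≤ p := by
    intro k
    have := measure_sum_sq_lower_le (μ := μ) (hmono k) (fun t => H.le _) (ξ := h k)
      (hmh k) (H.indep k) (pow_pos (H.sd_pos k) 2) (H.subG k) T hθ.le (fun t => rfl)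
    refine (measure_mono fun ω hω => ?_).trans this
    simp only [Set.mem_ofPred_eq, not_le] at hω ⊢
    push_cast; exact hω.le
  calc _ ≤ μ (⋃ k ∈ Finset.range T,
        ({ω | ¬ -(sd k * θ * (∑ t ∈ Finset.range T, lagSum T f h (k + 1) t ω ^ 2 / 2 + T)) ≤
          ∑ t ∈ Finset.range T, lagSum T f h (k + 1) t ω * h k t ω} ∪
        {ω | ¬ ∑ t ∈ Finset.range T, h k t ω ^ 2 ≤ 8 * sd k ^ 2 * T}) ∪
        {ω | ¬ ∑ t ∈ Finset.range T, ∫ ω', h k t ω' ^ 2 ∂μ - θ * sd k ^ 2 * T ≤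
        ∑ t ∈ Finset.range T, h k t ω ^ 2}) := by
        refine measure_mono fun ω hω => ?_
        simp only [Set.mem_iUnion, Finset.mem_range, Set.mem_union, Set.mem_ofPred_eq] at hω ⊢
        by_contra hcon
        push Not at hcon
        exact hω ⟨fun k hk => (hcon k hk).1.1, fun k hk => (hcon k hk).1.2,
          fun k hk => (hcon k hk).2⟩
    _ ≤ ∑ k ∈ Finset.range T, (p + p + p) := by
        refine (measure_biUnion_finset_le _ _).trans (Finset.sum_le_sum fun k _ => ?_)
        exact (measure_union_le _ _).trans (add_le_add ((measure_union_le _ _).trans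
          (add_le_add (b1 k) (b2 k))) (b3 k))
    _ = _ := by
        rw [Finset.sum_const, Finset.card_range, nsmul_eq_mul, hp, ← ENNReal.ofReal_add,
          ← ENNReal.ofReal_add, ← ENNReal.ofReal_natCast, ← ENNReal.ofReal_mul]
        · congr 1; ring
        all_goals positivity

/-- Orthogonality: lag k is centered and independent of f and of the noise of larger lags, which
comes from earlier innovations. -/
theorem integral_lagSum_sq [IsProbabilityMeasure μ] (H : LagNoise μ 𝒢 f h sd) (T t : ℕ)
    (hf : MemLp (f t) 2 μ) (h0 : ∀ k, ∫ ω, h k t ω ∂μ = 0) :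
    MemLp (lagSum T f h 0 t) 2 μ ∧
    ∫ ω, lagSum T f h 0 t ω ^ 2 ∂μ = ∫ ω, f t ω ^ 2 ∂μ +
      ∑ k ∈ Finset.range T, ∫ ω, h k t ω ^ 2 ∂μ := by
  have hmem : ∀ k, MemLp (lagSum T f h k t) 2 μ := fun k => by
    unfold lagSum
    exact hf.add (memLp_finsetSum _ fun k _ => (H.subG k t).memLp 2)
  refine ⟨hmem 0, ?_⟩
  have hstep : ∀ k < T, ∫ ω, lagSum T f h k t ω ^ 2 ∂μ =
      ∫ ω, lagSum T f h (k + 1) t ω ^ 2 ∂μ + ∫ ω, h k t ω ^ 2 ∂μ := by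
    intro k hk
    have hB := hmem (k + 1)
    have hh : MemLp (h k t) 2 μ := (H.subG k t).memLp 2
    have hI : IndepFun (lagSum T f h (k + 1) t) (h k t) μ := by
      rw [IndepFun_iff_Indep]
      exact (indep_of_indep_of_le_right (H.indep k t) (H.measurable_lagSum T k t).comap_le).symm
    have hcross : ∫ ω, lagSum T f h (k + 1) t ω * h k t ω ∂μ = 0 := by
      have := hI.integral_fun_mul_eq_mul_integral hB.aestronglyMeasurable hh.aestronglyMeasurable
      rw [this, h0 k, mul_zero]
    have hint : Integrable (fun ω => lagSum T f h (k + 1) t ω * h k t ω) μ := hB.integrable_mul hh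
    have : ∀ ω, lagSum T f h k t ω ^ 2 = lagSum T f h (k + 1) t ω ^ 2 +
        (2 * (lagSum T f h (k + 1) t ω * h k t ω) + h k t ω ^ 2) := fun ω => by
      rw [lagSum_of_lt hk]; ring
    simp_rw [this]
    have e1 : ∫ ω, (lagSum T f h (k + 1) t ω ^ 2 +
        (2 * (lagSum T f h (k + 1) t ω * h k t ω) + h k t ω ^ 2)) ∂μ =
        ∫ ω, lagSum T f h (k + 1) t ω ^ 2 ∂μ +
        ∫ ω, (2 * (lagSum T f h (k + 1) t ω * h k t ω) + h k t ω ^ 2) ∂μ :=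
      integral_add hB.integrable_sq ((hint.const_mul 2).add hh.integrable_sq)
    rw [e1, integral_add (hint.const_mul 2) hh.integrable_sq, integral_const_mul, hcross]
    ring
  have hsum : ∑ k ∈ Finset.range T, (∫ ω, lagSum T f h k t ω ^ 2 ∂μ -
      ∫ ω, lagSum T f h (k + 1) t ω ^ 2 ∂μ) = ∑ k ∈ Finset.range T, ∫ ω, h k t ω ^ 2 ∂μ :=
    Finset.sum_congr rfl fun k hk => by rw [hstep k (Finset.mem_range.1 hk)]; ring
  rw [Finset.sum_range_sub'] at hsum
  simp only [lagSum_self] at hsum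
  linarith

/-- Here P and F stand for the first and second moments of φ. From φ ≥ P - θ, P ≤ 2 and P² ≥ F - θ
one gets φ² ≥ F - 5θ. Together with the loss θS² for the squares and θS(18 + 16S² + 2) for the cross
terms, the total loss is at most 3T/16, which leaves 7/16 - 3/16 = 1/4 of T. -/
theorem energy_arith {T F W θ S S' φ e P : ℝ} (hT : 0 < T) (hθ : 0 < θ) (hθ1 : θ ≤ 1)
    (hS' : 0 ≤ S') (hS : S' ≤ S) (hP0 : 0 ≤ P) (hP2 : P ≤ 2) (hF3 : F ≤ 3) (hFP : F - θ ≤ P ^ 2)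
    (hPF : P ^ 2 ≤ F) (hφ0 : 0 ≤ φ) (habs : -θ < φ - P ∧ φ - P < θ)
    (hlow : 7 / 16 * T ≤ T * F + W) (hθS : θ * (5 + S ^ 2 + S * (20 + 16 * S ^ 2)) ≤ 3 / 16)
    (hlower : T * φ ^ 2 + W - θ * S' ^ 2 * T -
      θ * S' * (2 * (T * φ ^ 2) + 16 * S' ^ 2 * T + 2 * T) ≤ e)
    (hupper : e ≤ 2 * (T * φ ^ 2) + 16 * S' ^ 2 * T) :
    T / 4 ≤ e ∧ e ≤ (18 + 16 * S ^ 2) * T := by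
  have hS0 : 0 ≤ S := hS'.trans hS
  have hφ3 : φ ≤ 3 := by linarith
  have hφu : φ ^ 2 ≤ 9 := by nlinarith
  have hφl : F - 5 * θ ≤ φ ^ 2 := by
    have h1 : P ^ 2 - 2 * θ * P ≤ φ ^ 2 := by
      rcases le_total θ P with hle | hle
      · have : (P - θ) ^ 2 ≤ φ ^ 2 := by
          apply pow_le_pow_left₀ <;> linarith
        nlinarith [sq_nonneg θ]
      · have : P * P ≤ θ * P := by gcongr
        nlinarith [sq_nonneg φ]
    have : θ * P ≤ θ * 2 := by gcongr
    linarith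
  have hS2 : S' ^ 2 ≤ S ^ 2 := by gcongr
  have k1 : θ * S' ^ 2 * T ≤ θ * S ^ 2 * T := by gcongr
  have k2 : θ * S' * (2 * (T * φ ^ 2) + 16 * S' ^ 2 * T + 2 * T) ≤
      θ * S * (2 * (T * 9) + 16 * S ^ 2 * T + 2 * T) := by gcongr
  have k3 : T * (F - 5 * θ) ≤ T * φ ^ 2 := by gcongr
  have k4 := mul_le_mul_of_nonneg_left hθS hT.le
  have k5 : T * φ ^ 2 ≤ T * 9 := by gcongr
  have k6 : S' ^ 2 * T ≤ S ^ 2 * T := by gcongr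
  constructor
  · linarith
  · linarith

/-- The covariate part enters only through φ, the root mean square of f over time: unlike the energy
itself, it is Lipschitz in the covariates and hence concentrates. The smallness of the initial term
is kept as part of the event, because it is controlled elsewhere for all directions at once.
Comparing the energy e of the lag sum with that of a costs a factor 2 and T/16 for the initial term,
so e ≥ T/4 gives T/8 - T/16 = T/16. -/
theorem LagNoise.energy_bounds [IsProbabilityMeasure μ] (H : LagNoise μ 𝒢 f h sd) {T : ℕ}
    (hT : 0 < T) {a ini : ℕ → Ω → ℝ} {S θ : ℝ} {δ : ENNReal} (hθ : 0 < θ) (hθ1 : θ ≤ 1)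
    (ha : ∀ t < T, ∀ᵐ ω ∂μ, a t ω = lagSum T f h 0 t ω + ini t ω)
    (hA : ∀ t < T, ∫ ω, a t ω ^ 2 ∂μ = 1)
    (haL : ∀ t < T, MemLp (a t) 2 μ) (hiL : ∀ t < T, MemLp (ini t) 2 μ)
    (hi : ∑ t ∈ Finset.range T, ∫ ω, ini t ω ^ 2 ∂μ ≤ T / 16)
    (h0 : ∀ k t, ∫ ω, h k t ω ∂μ = 0)
    (hS : ∑ k ∈ Finset.range T, (sd k : ℝ) ≤ S)
    {φ : Ω → ℝ} (hφ0 : ∀ ω, 0 ≤ φ ω) (hφ : ∀ ω, ∑ t ∈ Finset.range T, f t ω ^ 2 = T * φ ω ^ 2)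
    (hφL : MemLp φ 2 μ) (hφt : μ {ω | θ ≤ |φ ω - ∫ ω', φ ω' ∂μ|} ≤ δ)
    (hφv : ∫ ω, (φ ω - ∫ ω', φ ω' ∂μ) ^ 2 ∂μ ≤ θ)
    (hθS : θ * (5 + S ^ 2 + S * (20 + 16 * S ^ 2)) ≤ 3 / 16) :
    μ {ω | ∑ t ∈ Finset.range T, ini t ω ^ 2 ≤ T / 16 ∧
      ¬ (T / 16 ≤ ∑ t ∈ Finset.range T, a t ω ^ 2 ∧
        ∑ t ∈ Finset.range T, a t ω ^ 2 ≤ (37 + 32 * S ^ 2) * T)} ≤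
      δ + ENNReal.ofReal (3 * T * Real.exp (-(θ ^ 2 / 128 * T))) := by
  have hT' : (0 : ℝ) < T := by exact_mod_cast hT
  set S' := ∑ k ∈ Finset.range T, (sd k : ℝ) with hS'
  have hS'0 : 0 ≤ S' := Finset.sum_nonneg fun _ _ => NNReal.coe_nonneg _
  have hhL : ∀ k t, MemLp (h k t) 2 μ := fun k t => (H.subG k t).memLp 2
  have hfL : ∀ t < T, MemLp (f t) 2 μ := by
    intro t ht
    have h1 : MemLp (fun ω => a t ω - ini t ω - ∑ k ∈ Finset.Ico 0 T, h k t ω) 2 μ :=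
      ((haL t ht).sub (hiL t ht)).sub (memLp_finsetSum _ fun k _ => hhL k t)
    refine h1.ae_eq ?_
    filter_upwards [ha t ht] with ω hω
    rw [hω]; simp only [lagSum]; ring
  set P := ∫ ω, φ ω ∂μ with hP
  set F := ∫ ω, φ ω ^ 2 ∂μ with hF
  set W := ∑ k ∈ Finset.range T, ∑ t ∈ Finset.range T, ∫ ω, h k t ω ^ 2 ∂μ with hW
  have hW0 : 0 ≤ W := Finset.sum_nonneg fun _ _ => Finset.sum_nonneg fun _ _ =>
    integral_nonneg fun _ => sq_nonneg _
  have hF0 : 0 ≤ F := integral_nonneg fun _ => sq_nonneg _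
  have hP0 : 0 ≤ P := integral_nonneg hφ0
  have hFf : T * F = ∑ t ∈ Finset.range T, ∫ ω, f t ω ^ 2 ∂μ := by
    rw [← integral_finsetSum _ fun t ht => (hfL t (Finset.mem_range.1 ht)).integrable_sq, hF, ← integral_const_mul]
    exact integral_congr_ae (ae_of_all _ fun ω => (hφ ω).symm)
  have hvar : ∫ ω, (φ ω - P) ^ 2 ∂μ = F - P ^ 2 := by
    have e0 : ∀ ω, (φ ω - P) ^ 2 = φ ω ^ 2 - 2 * P * φ ω + P ^ 2 := fun ω => by ring
    simp_rw [e0]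
    have i1 : Integrable φ μ := hφL.integrable (by norm_num)
    have e1 : ∫ ω, (φ ω ^ 2 - 2 * P * φ ω + P ^ 2) ∂μ =
        ∫ ω, (φ ω ^ 2 - 2 * P * φ ω) ∂μ + ∫ ω, P ^ 2 ∂μ :=
      integral_add (hφL.integrable_sq.sub (i1.const_mul _)) (integrable_const _)
    rw [e1, integral_sub hφL.integrable_sq (i1.const_mul _), integral_const_mul]
    simp [← hP, ← hF]; ring
  have hFP : F - θ ≤ P ^ 2 := by linarith
  have hPF : P ^ 2 ≤ F := by
    have : 0 ≤ ∫ ω, (φ ω - P) ^ 2 ∂μ := integral_nonneg fun _ => sq_nonneg _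
    linarith
  have hb : ∀ t < T, ∫ ω, lagSum T f h 0 t ω ^ 2 ∂μ = ∫ ω, f t ω ^ 2 ∂μ +
      ∑ k ∈ Finset.range T, ∫ ω, h k t ω ^ 2 ∂μ := fun t ht =>
    (integral_lagSum_sq H T t (hfL t ht) fun k => h0 k t).2
  have hbL : ∀ t < T, MemLp (lagSum T f h 0 t) 2 μ := fun t ht =>
    (integral_lagSum_sq H T t (hfL t ht) fun k => h0 k t).1
  have hbs : ∑ t ∈ Finset.range T, ∫ ω, lagSum T f h 0 t ω ^ 2 ∂μ = T * F + W := by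
    rw [Finset.sum_congr rfl fun t ht => hb t (Finset.mem_range.1 ht)]
    rw [Finset.sum_add_distrib, hFf, hW, Finset.sum_comm]
  have hcomp : ∀ t < T, 1 ≤ 2 * ∫ ω, lagSum T f h 0 t ω ^ 2 ∂μ + 2 * ∫ ω, ini t ω ^ 2 ∂μ ∧
      ∫ ω, lagSum T f h 0 t ω ^ 2 ∂μ ≤ 2 + 2 * ∫ ω, ini t ω ^ 2 ∂μ := by
    intro t ht
    have ib := (hbL t ht).integrable_sq
    have ii := (hiL t ht).integrable_sq
    have ia := (haL t ht).integrable_sq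
    constructor
    · rw [← hA t ht, ← integral_const_mul, ← integral_const_mul,
        ← integral_add (ib.const_mul 2) (ii.const_mul 2)]
      refine integral_mono_ae ia ((ib.const_mul 2).add (ii.const_mul 2)) ?_
      filter_upwards [ha t ht] with ω hω
      simp only [hω]
      nlinarith [sq_nonneg (lagSum T f h 0 t ω - ini t ω)]
    · have e2 : ∫ ω, lagSum T f h 0 t ω ^ 2 ∂μ ≤
          2 * ∫ ω, a t ω ^ 2 ∂μ + 2 * ∫ ω, ini t ω ^ 2 ∂μ := by
        rw [← integral_const_mul, ← integral_const_mul,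
          ← integral_add (ia.const_mul 2) (ii.const_mul 2)]
        refine integral_mono_ae ib ((ia.const_mul 2).add (ii.const_mul 2)) ?_
        filter_upwards [ha t ht] with ω hω
        simp only [hω]
        nlinarith [sq_nonneg (lagSum T f h 0 t ω + 2 * ini t ω)]
      rw [hA t ht] at e2; linarith
  -- The unit second moments of a sum to T, and T ≤ 2(TF + W) + 2 · T/16.
  have hlow : 7 / 16 * T ≤ T * F + W := by
    have := Finset.sum_le_sum fun t (ht : t ∈ Finset.range T) => (hcomp t (Finset.mem_range.1 ht)).1
    rw [Finset.sum_add_distrib, ← Finset.mul_sum, ← Finset.mul_sum, hbs] at this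
    simp at this
    linarith
  have hup : T * F + W ≤ 3 * T := by
    have := Finset.sum_le_sum fun t (ht : t ∈ Finset.range T) => (hcomp t (Finset.mem_range.1 ht)).2
    rw [Finset.sum_add_distrib, ← Finset.mul_sum, hbs] at this
    simp at this
    linarith
  have hF3 : F ≤ 3 := by
    by_contra hcon
    push Not at hcon
    nlinarith
  have hP2 : P ≤ 2 := by nlinarith
  have hS0 : 0 ≤ S := hS'0.trans hS
  have hae : ∀ᵐ ω ∂μ, ∀ t < T, a t ω = lagSum T f h 0 t ω + ini t ω := by
    refine ae_all_iff.2 fun t => ?_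
    by_cases ht : t < T
    · filter_upwards [ha t ht] with ω hω _ using hω
    · exact ae_of_all _ fun ω h => absurd h ht
  have hbad := H.measure_bad_le T hθ hθ1
  refine le_trans (le_trans (measure_mono_ae ?_) (measure_union_le _ _)) (add_le_add hφt hbad)
  filter_upwards [hae] with ω hω hmem
  obtain ⟨hini, hneg⟩ := hmem
  by_contra hcon
  apply hneg
  have hcon' := not_or.1 hcon
  obtain ⟨hc1, hc2⟩ := hcon'
  simp only [Set.mem_ofPred_eq, not_le] at hc1
  replace hc2 := not_not.1 hc2
  obtain ⟨g1, g2, g3⟩ := hc2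
  have hlower := H.le_lagSum_sq hθ.le g1 g2 g3
  have hupper := H.lagSum_sq_le 0 g2
  rw [← hS', hφ ω] at hlower hupper
  rw [← hW] at hlower
  set e := ∑ t ∈ Finset.range T, lagSum T f h 0 t ω ^ 2 with he
  obtain ⟨hl2, hu2⟩ := energy_arith hT' hθ hθ1 hS'0 hS hP0 hP2 hF3 hFP hPF (hφ0 ω)
    (abs_lt.1 hc1) hlow hθS hlower hupper
  have hsum : ∑ t ∈ Finset.range T, a t ω ^ 2 ≤ 2 * e + 2 * ∑ t ∈ Finset.range T, ini t ω ^ 2 := by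
    rw [he, Finset.mul_sum, Finset.mul_sum, ← Finset.sum_add_distrib]
    refine Finset.sum_le_sum fun t ht => ?_
    rw [hω t (Finset.mem_range.1 ht)]; nlinarith [sq_nonneg (lagSum T f h 0 t ω - ini t ω)]
  have hsum' : e ≤ 2 * ∑ t ∈ Finset.range T, a t ω ^ 2 + 2 * ∑ t ∈ Finset.range T, ini t ω ^ 2 := by
    rw [he, Finset.mul_sum, Finset.mul_sum, ← Finset.sum_add_distrib]
    refine Finset.sum_le_sum fun t ht => ?_
    rw [hω t (Finset.mem_range.1 ht)]; nlinarith [sq_nonneg (lagSum T f h 0 t ω + 2 * ini t ω)]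
  constructor
  · linarith
  · linarith

end Energy

/-! ### Variances and rescaling under convex concentration. -/

section Concentration

variable {Ω : Type*} [mΩ : MeasurableSpace Ω] {μ : Measure Ω}

/-- Layer cake: the variance is the integral of 2s times the tail, and 2s exp(-s²/k²) integrates to
k². -/
theorem integral_sq_le_of_tail [IsProbabilityMeasure μ] {X : Ω → ℝ} (hX : Integrable X μ) {k : ℝ}
    (hk : 0 < k) (htail : ∀ s : ℝ, 0 < s →
      μ.real {ω | s ≤ |X ω - ∫ ω', X ω' ∂μ|} ≤ 2 * Real.exp (-(s ^ 2 / k ^ 2))) :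
    MemLp X 2 μ ∧ ∫ ω, (X ω - ∫ ω', X ω' ∂μ) ^ 2 ∂μ ≤ 2 * k ^ 2 := by
  set e := ∫ ω', X ω' ∂μ
  have hm : AEStronglyMeasurable (fun ω => X ω - e) μ :=
    hX.aestronglyMeasurable.sub aestronglyMeasurable_const
  have hint : IntegrableOn (fun s : ℝ => 2 * (s * Real.exp (-(1 / k ^ 2) * s ^ 2))) (Set.Ioi 0) := by
    have := integrable_mul_exp_neg_mul_sq (b := 1 / k ^ 2) (by positivity)
    exact (this.const_mul 2).integrableOn
  have hval : ∫ s in Set.Ioi (0 : ℝ), 2 * (s * Real.exp (-(1 / k ^ 2) * s ^ 2)) = k ^ 2 := by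
    have hd : ∀ x ∈ Set.Ici (0 : ℝ), HasDerivAt (fun s => -(k ^ 2) * Real.exp (-(1 / k ^ 2) * s ^ 2))
        (2 * (x * Real.exp (-(1 / k ^ 2) * x ^ 2))) x := by
      intro x _
      have h1 : HasDerivAt (fun s : ℝ => -(1 / k ^ 2) * s ^ 2) (-(1 / k ^ 2) * (2 * x)) x := by
        simpa only [Nat.cast_ofNat, pow_one, Nat.add_one_sub_one] using
          (hasDerivAt_pow 2 x).const_mul (-(1 / k ^ 2))
      refine (h1.exp.const_mul (-(k ^ 2))).congr_deriv ?_
      have hk0 := hk.ne'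
      rw [show -(k ^ 2) * (Real.exp (-(1 / k ^ 2) * x ^ 2) * (-(1 / k ^ 2) * (2 * x))) =
        (k ^ 2 / k ^ 2) * (2 * (x * Real.exp (-(1 / k ^ 2) * x ^ 2))) by ring,
        div_self (pow_ne_zero 2 hk0), one_mul]
    have ht : Tendsto (fun s : ℝ => -(k ^ 2) * Real.exp (-(1 / k ^ 2) * s ^ 2)) atTop (𝓝 0) := by
      have h2 : Tendsto (fun s : ℝ => -(1 / k ^ 2) * s ^ 2) atTop atBot :=
        (tendsto_pow_atTop two_ne_zero).const_mul_atTop_of_neg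
          (by have : 0 < 1 / k ^ 2 := by positivity
              linarith)
      simpa using (Real.tendsto_exp_atBot.comp h2).const_mul (-(k ^ 2))
    rw [integral_Ioi_of_hasDerivAt_of_tendsto' hd hint ht]
    simp
  have hl : ∫⁻ ω, ENNReal.ofReal ((X ω - e) ^ 2) ∂μ ≤ ENNReal.ofReal (2 * k ^ 2) := by
    have h1 := lintegral_rpow_eq_lintegral_meas_le_mul μ (f := fun ω => |X ω - e|)
      (ae_of_all _ fun _ => abs_nonneg _) hm.aemeasurable.abs (p := 2) (by norm_num)
    have h2 : ∀ ω, |X ω - e| ^ (2 : ℝ) = (X ω - e) ^ 2 := fun ω => by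
      rw [Real.rpow_two, sq_abs]
    simp_rw [h2] at h1
    rw [h1]
    calc ENNReal.ofReal 2 * ∫⁻ s in Set.Ioi (0 : ℝ),
          μ {ω | s ≤ |X ω - e|} * ENNReal.ofReal (s ^ ((2 : ℝ) - 1))
        ≤ ENNReal.ofReal 2 * ∫⁻ s in Set.Ioi (0 : ℝ),
          ENNReal.ofReal (2 * (s * Real.exp (-(1 / k ^ 2) * s ^ 2))) := by
          refine mul_le_mul_right (setLIntegral_mono' measurableSet_Ioi fun s hs => ?_) _
          have hs' : 0 < s := hs
          have h3 := htail s hs'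
          rw [← ofReal_measureReal (by finiteness), ← ENNReal.ofReal_mul (by positivity)]
          apply ENNReal.ofReal_le_ofReal
          rw [show (2 : ℝ) - 1 = 1 by norm_num, Real.rpow_one]
          calc _ ≤ 2 * Real.exp (-(s ^ 2 / k ^ 2)) * s := by gcongr
            _ = _ := by
              rw [show -(1 / k ^ 2) * s ^ 2 = -(s ^ 2 / k ^ 2) by ring]; ring
      _ = ENNReal.ofReal 2 * ENNReal.ofReal (k ^ 2) := by
          rw [← ofReal_integral_eq_lintegral_ofReal hint, hval]
          refine (ae_restrict_mem measurableSet_Ioi).mono fun s hs => ?_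
          have hs' : 0 < s := hs
          simp only [Pi.zero_apply]; positivity
      _ = _ := by rw [← ENNReal.ofReal_mul (by norm_num)]
  have hint2 : Integrable (fun ω => (X ω - e) ^ 2) μ := by
    refine ⟨(hm.pow 2), ?_⟩
    rw [hasFiniteIntegral_iff_ofReal (ae_of_all _ fun _ => sq_nonneg _)]
    exact hl.trans_lt ENNReal.ofReal_lt_top
  constructor
  · have : MemLp (fun ω => X ω - e) 2 μ := (memLp_two_iff_integrable_sq hm).2 hint2
    have h3 := this.add (memLp_const e)
    refine h3.ae_eq (ae_of_all _ fun ω => ?_)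
    simp only [Pi.add_apply]; ring
  · rw [← ENNReal.ofReal_le_ofReal_iff (by positivity),
      ofReal_integral_eq_lintegral_ofReal hint2 (ae_of_all _ fun _ => sq_nonneg _)]
    exact hl

theorem ConvexConcentration.of_lipschitz {ι : Type*} [Fintype ι] {V : Ω → EuclideanSpace ℝ ι}
    {K : ℝ} (hV : ConvexConcentration μ V K) (hK : 0 < K) {φ : EuclideanSpace ℝ ι → ℝ}
    (hφ : ConvexOn ℝ Set.univ φ) {L : ℝ≥0} (hL0 : 0 < L) (hL : LipschitzWith L φ) :
    Integrable (fun ω => φ (V ω)) μ ∧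
    ∀ s : ℝ, 0 < s → μ.real {ω | s ≤ |φ (V ω) - ∫ ω', φ (V ω') ∂μ|} ≤
      2 * Real.exp (-(s ^ 2 / (K * L) ^ 2)) := by
  have hL' : (0 : ℝ) < L := by exact_mod_cast hL0
  have h1 : ConvexOn ℝ Set.univ (fun x => (L : ℝ)⁻¹ * φ x) := hφ.smul (by positivity)
  have h2 : LipschitzWith 1 (fun x => (L : ℝ)⁻¹ * φ x) := by
    refine LipschitzWith.of_dist_le_mul fun x y => ?_
    have := hL.dist_le_mul x y
    rw [Real.dist_eq] at this ⊢
    rw [← mul_sub, abs_mul, abs_of_pos (by positivity : (0 : ℝ) < (L : ℝ)⁻¹), inv_mul_le_iff₀ hL']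
    simpa using this
  obtain ⟨h3, h4⟩ := hV _ h1 h2
  have h5 : Integrable (fun ω => φ (V ω)) μ := by
    have := h3.const_mul (L : ℝ)
    refine this.congr (ae_of_all _ fun ω => ?_)
    field_simp
  refine ⟨h5, fun s hs => ?_⟩
  have h6 := h4 (s / L) (by positivity)
  rw [integral_const_mul] at h6
  have hiff : ∀ ω, s / L ≤ |(L : ℝ)⁻¹ * φ (V ω) - (L : ℝ)⁻¹ * ∫ ω', φ (V ω') ∂μ| ↔
      s ≤ |φ (V ω) - ∫ ω', φ (V ω') ∂μ| := fun ω => by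
    rw [← mul_sub, abs_mul, abs_of_pos (by positivity : (0 : ℝ) < (L : ℝ)⁻¹), div_le_iff₀ hL',
      mul_comm _ (L : ℝ), ← mul_assoc, mul_inv_cancel₀ hL'.ne', one_mul]
  simp_rw [hiff] at h6
  refine h6.trans (le_of_eq ?_)
  congr 3
  field_simp

end Concentration

/-! ### Nets of the unit sphere and linear maps. -/

section Nets

variable {E : Type*} [NormedAddCommGroup E] [NormedSpace ℝ E] [FiniteDimensional ℝ E]

open Module in
/-- An `ε`-separated subset of the unit ball has at most `(3 / ε) ^ dim` elements. -/
theorem card_le_of_separated_unitBall {ε : ℝ} (hε : 0 < ε) (hε1 : ε ≤ 1) (s : Finset E)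
    (hs : ∀ c ∈ s, ‖c‖ ≤ 1) (h : ∀ c ∈ s, ∀ d ∈ s, c ≠ d → ε ≤ ‖c - d‖) :
    (s.card : ℝ) ≤ (3 / ε) ^ finrank ℝ E := by
  borelize E
  let μ : Measure E := Measure.addHaar
  have hδ : 0 < ε / 2 := by positivity
  have hρ : (0 : ℝ) < 3 / 2 := by norm_num
  have D : (s : Set E).PairwiseDisjoint fun c => Metric.ball c (ε / 2) := by
    intro c hc d hd hcd
    apply Metric.ball_disjoint_ball
    rw [dist_eq_norm]
    have := h c hc d hd hcd
    linarith
  have hsub : (⋃ c ∈ s, Metric.ball c (ε / 2)) ⊆ Metric.ball (0 : E) (3 / 2) := by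
    refine Set.iUnion₂_subset fun x hx => Metric.ball_subset_ball' ?_
    rw [dist_zero_right]
    have := hs x hx
    linarith
  have I : (s.card : ENNReal) * ENNReal.ofReal ((ε / 2) ^ finrank ℝ E) * μ (Metric.ball 0 1) ≤
      ENNReal.ofReal ((3 / 2) ^ finrank ℝ E) * μ (Metric.ball 0 1) :=
    calc _ = μ (⋃ c ∈ s, Metric.ball c (ε / 2)) := by
          rw [measure_biUnion_finset D fun c _ => Metric.isOpen_ball.measurableSet]
          simp only [μ.addHaar_ball_of_pos _ hδ, Finset.sum_const, nsmul_eq_mul, mul_assoc]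
      _ ≤ μ (Metric.ball (0 : E) (3 / 2)) := measure_mono hsub
      _ = _ := by rw [μ.addHaar_ball_of_pos _ hρ]
  have J := (ENNReal.mul_le_mul_iff_left (Metric.measure_ball_pos μ _ zero_lt_one).ne'
    measure_ball_lt_top.ne).1 I
  have K := ENNReal.toReal_le_of_le_ofReal (by positivity) J
  rw [ENNReal.toReal_mul, ENNReal.toReal_natCast, ENNReal.toReal_ofReal (by positivity),
    ← le_div_iff₀ (by positivity), ← div_pow] at K
  refine K.trans (le_of_eq ?_)
  congr 1
  field_simp

open Module in
/-- Nets of the unit sphere of size exponential in the dimension. -/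
theorem exists_net_sphere (E : Type*) [NormedAddCommGroup E] [NormedSpace ℝ E]
    [FiniteDimensional ℝ E] {ε : ℝ} (hε : 0 < ε) (hε1 : ε ≤ 1) :
    ∃ N : Finset E, (N.card : ℝ) ≤ (3 / ε) ^ finrank ℝ E ∧ (∀ c ∈ N, ‖c‖ = 1) ∧
      ∀ x : E, ‖x‖ = 1 → ∃ c ∈ N, ‖x - c‖ ≤ ε := by
  classical
  let p : ℕ → Prop := fun k => ∃ s : Finset E, s.card = k ∧ (∀ c ∈ s, ‖c‖ = 1) ∧
    ∀ c ∈ s, ∀ d ∈ s, c ≠ d → ε ≤ ‖c - d‖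
  have hb : ∀ k, p k → k ≤ ⌊(3 / ε) ^ finrank ℝ E⌋₊ := by
    rintro _ ⟨s, rfl, h1, h2⟩
    exact Nat.le_floor (card_le_of_separated_unitBall hε hε1 s (fun c hc => (h1 c hc).le) h2)
  have h0 : p 0 := ⟨∅, by simp⟩
  -- A separated subset of the sphere of maximal cardinality is a net, since a point far from all
  -- its elements could be added to it.
  obtain ⟨s, hcard, h1, h2⟩ := Nat.findGreatest_spec (P := p) (Nat.zero_le _) h0
  refine ⟨s, card_le_of_separated_unitBall hε hε1 s (fun c hc => (h1 c hc).le) h2, h1, ?_⟩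
  intro x hx
  by_contra hcon
  push Not at hcon
  have hxs : x ∉ s := fun hxs => by
    have := hcon x hxs
    simp at this; linarith
  have hp : p (s.card + 1) := by
    refine ⟨insert x s, Finset.card_insert_of_notMem hxs, ?_, ?_⟩
    · intro c hc
      rcases Finset.mem_insert.1 hc with rfl | hc
      · exact hx
      · exact h1 c hc
    · intro c hc d hd hcd
      rcases Finset.mem_insert.1 hc with rfl | hc' <;> rcases Finset.mem_insert.1 hd with rfl | hd'
      · exact absurd rfl hcd
      · exact (hcon d hd').le
      · rw [norm_sub_rev]; exact (hcon c hc').le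
      · exact h2 c hc' d hd' hcd
  have := Nat.le_findGreatest (hb _ hp) hp
  exact absurd (this.trans hcard.ge) (by simp)

variable {F : Type*} [NormedAddCommGroup F] [NormedSpace ℝ F]

/-- The norm of A is attained at some z of the sphere. Approximating z by a net point gives ‖Az‖ ≤ b
+ ε‖Az‖, and ε ≤ 1/2 absorbs the last term. -/
theorem norm_le_of_net {N : Finset E} {ε b : ℝ} (hε1 : ε ≤ 1 / 2)
    (hN : ∀ x : E, ‖x‖ = 1 → ∃ c ∈ N, ‖x - c‖ ≤ ε) (A : E →ₗ[ℝ] F)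
    (hb : ∀ c ∈ N, ‖A c‖ ≤ b) (x : E) : ‖A x‖ ≤ 2 * b * ‖x‖ := by
  rcases eq_or_ne x 0 with rfl | hx0
  · simp
  have hscale : ∀ y : E, y ≠ 0 → ‖(‖y‖⁻¹ • y)‖ = 1 := fun y hy => by
    rw [norm_smul, norm_inv, norm_norm, inv_mul_cancel₀ (norm_ne_zero_iff.2 hy)]
  have hcont : Continuous fun y => ‖A y‖ := A.continuous_of_finiteDimensional.norm
  obtain ⟨z, hz, hmax⟩ := (isCompact_sphere (0 : E) 1).exists_isMaxOn
    ⟨‖x‖⁻¹ • x, by simpa using hscale x hx0⟩ hcont.continuousOn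
  have hz1 : ‖z‖ = 1 := by simpa using hz
  have hle : ∀ y : E, ‖A y‖ ≤ ‖A z‖ * ‖y‖ := by
    intro y
    rcases eq_or_ne y 0 with rfl | hy
    · simp
    have h1 : ‖A (‖y‖⁻¹ • y)‖ ≤ ‖A z‖ := hmax (by simpa using hscale y hy)
    rw [map_smul, norm_smul, norm_inv, norm_norm, inv_mul_le_iff₀ (norm_pos_iff.2 hy)] at h1
    linarith
  obtain ⟨c, hc, hzc⟩ := hN z hz1
  have h2 : ‖A z‖ ≤ ‖A c‖ + ‖A z‖ * ε := by
    calc ‖A z‖ = ‖A c + A (z - c)‖ := by rw [← map_add]; congr 2; abel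
      _ ≤ ‖A c‖ + ‖A (z - c)‖ := norm_add_le _ _
      _ ≤ ‖A c‖ + ‖A z‖ * ε := by
          gcongr
          exact (hle _).trans (by gcongr)
  have h3 : ‖A z‖ ≤ 2 * b := by
    have := hb c hc
    nlinarith [norm_nonneg (A z)]
  exact (hle x).trans (by gcongr)

/-- A lower bound on a net extends to the sphere only given an upper bound on the whole operator:
passing to a net point costs at most ε · 2b, half of c. -/
theorem le_norm_of_net {N : Finset E} {ε b c : ℝ} (hε1 : ε ≤ 1 / 2) (hεb : ε * (2 * b) ≤ c / 2)
    (hb0 : 0 ≤ b)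
    (hN : ∀ x : E, ‖x‖ = 1 → ∃ c ∈ N, ‖x - c‖ ≤ ε) (A : E →ₗ[ℝ] F)
    (hb : ∀ c ∈ N, ‖A c‖ ≤ b) (hc : ∀ y ∈ N, c ≤ ‖A y‖) (x : E) : c / 2 * ‖x‖ ≤ ‖A x‖ := by
  rcases eq_or_ne x 0 with rfl | hx0
  · simp
  have hx1 : ‖(‖x‖⁻¹ • x)‖ = 1 := by
    rw [norm_smul, norm_inv, norm_norm, inv_mul_cancel₀ (norm_ne_zero_iff.2 hx0)]
  obtain ⟨y, hy, hxy⟩ := hN _ hx1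
  have h1 := norm_le_of_net hε1 hN A hb (y - ‖x‖⁻¹ • x)
  rw [norm_sub_rev y] at h1
  have h2 : ‖A y‖ ≤ ‖A (‖x‖⁻¹ • x)‖ + ‖A (y - ‖x‖⁻¹ • x)‖ := by
    calc ‖A y‖ = ‖A (‖x‖⁻¹ • x) + A (y - ‖x‖⁻¹ • x)‖ := by rw [← map_add]; congr 2; abel
      _ ≤ _ := norm_add_le _ _
  have h3 : 2 * b * ‖‖x‖⁻¹ • x - y‖ ≤ ε * (2 * b) := by rw [mul_comm ε]; gcongr
  have h4 : c / 2 ≤ ‖A (‖x‖⁻¹ • x)‖ := by linarith [hc y hy]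
  rw [map_smul, norm_smul, norm_inv, norm_norm, ← div_eq_inv_mul,
    le_div_iff₀ (norm_pos_iff.2 hx0)] at h4
  exact h4

end Nets

/-! ### Exact classification from quadratic losses. -/

section Classification

/-- Exact classification from two-sided quadratic bounds on the loss: `P a j` is the true
profile of group `a`, `Phat a j` the estimated one. -/
theorem exists_perm_of_loss {I J A V : Type*} [Fintype I] [Fintype J] [Fintype A] [DecidableEq A]
    [NormedAddCommGroup V] [Nonempty I] [Nonempty J] {g₀ ghat : I → A} {P Phat : A → J → V}
    {F : I → J → V → ℝ} {α β b cpi d : ℝ} (hα : 0 < α) (hβ : 0 ≤ β) (hb : 0 ≤ b) (hcpi : 0 < cpi)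
    (hcpi1 : cpi ≤ 1)
    (hlow : ∀ i j v, α * ‖v‖ ^ 2 - b ≤ F i j v) (hup : ∀ i j v, F i j v ≤ β * ‖v‖ ^ 2 + b)
    (htot : ∑ i, ∑ j, F i j (Phat (ghat i) j - P (g₀ i) j) ≤ 0)
    (hrow : ∀ i a, ∑ j, F i j (Phat (ghat i) j - P (g₀ i) j) ≤
      ∑ j, F i j (Phat a j - P (g₀ i) j))
    (hprop : ∀ a, cpi * Fintype.card I ≤ ((Finset.univ.filter fun i => g₀ i = a).card : ℝ))
    (hgap : ∀ a a', a ≠ a' → Fintype.card J * d ≤ ∑ j, ‖P a j - P a' j‖ ^ 2)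
    (hd : 2 * b * (β + 3 * α) < d * α ^ 2 * cpi) :
    ∃ s : Equiv.Perm A, ∀ i, ghat i = s (g₀ i) := by
  have hnI : (0 : ℝ) < Fintype.card I := by exact_mod_cast Fintype.card_pos
  have hnJ : (0 : ℝ) < Fintype.card J := by exact_mod_cast Fintype.card_pos
  set nI : ℝ := (Fintype.card I : ℝ)
  set nJ : ℝ := (Fintype.card J : ℝ) with hnJdef
  set Δ : I → J → V := fun i j => Phat (ghat i) j - P (g₀ i) j with hΔ
  set S : I → ℝ := fun i => ∑ j, ‖Δ i j‖ ^ 2 with hS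
  have hS0 : ∀ i, 0 ≤ S i := fun i => Finset.sum_nonneg fun _ _ => sq_nonneg _
  have hrowlow : ∀ i, α * S i - nJ * b ≤ ∑ j, F i j (Δ i j) := by
    intro i
    have := Finset.sum_le_sum fun j (_ : j ∈ Finset.univ) => hlow i j (Δ i j)
    rw [Finset.sum_sub_distrib, ← Finset.mul_sum] at this
    simpa [hnJdef] using this
  have htotal : α * ∑ i, S i ≤ nI * nJ * b := by
    have := Finset.sum_le_sum fun i (_ : i ∈ Finset.univ) => hrowlow i
    rw [Finset.sum_sub_distrib, ← Finset.mul_sum] at this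
    simp only [Finset.sum_const, Finset.card_univ, nsmul_eq_mul] at this
    have h2 : (Fintype.card I : ℝ) * (nJ * b) = nI * nJ * b := by ring
    linarith [htot]
  -- Averaging: if every row of group a exceeded this error, its cpi * nI rows alone would exceed
  -- the total error nI * nJ * b / α.
  have hrep : ∀ a, ∃ i, g₀ i = a ∧ S i ≤ nJ * (b / (α * cpi)) := by
    intro a
    by_contra hcon
    push Not at hcon
    have hne : (Finset.univ.filter fun i => g₀ i = a).Nonempty := by
      rw [← Finset.card_pos]
      have := hprop a
      have h2 : 0 < cpi * nI := by positivity
      exact_mod_cast h2.trans_le this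
    have h1 : ((Finset.univ.filter fun i => g₀ i = a).card : ℝ) * (nJ * (b / (α * cpi))) <
        ∑ i ∈ Finset.univ.filter (fun i => g₀ i = a), S i := by
      rw [← nsmul_eq_mul]
      exact Finset.sum_lt_sum_of_nonempty (f := fun _ => nJ * (b / (α * cpi))) hne
        (fun i hi => hcon i (Finset.mem_filter.1 hi).2) |>.trans_eq' (by simp)
    have h2 : ∑ i ∈ Finset.univ.filter (fun i => g₀ i = a), S i ≤ ∑ i, S i :=
      Finset.sum_le_sum_of_subset_of_nonneg (Finset.filter_subset _ _) fun i _ _ => hS0 i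
    have h3 : cpi * nI * (nJ * (b / (α * cpi))) ≤
        ((Finset.univ.filter fun i => g₀ i = a).card : ℝ) * (nJ * (b / (α * cpi))) := by
      gcongr; exact hprop a
    have h4 : α * (cpi * nI * (nJ * (b / (α * cpi)))) = nI * nJ * b := by field_simp
    have h5 := mul_lt_mul_of_pos_left (h3.trans_lt (h1.trans_le h2)) hα
    linarith
  choose rep hrep1 hrep2 using hrep
  have hall : ∀ i, α * S i ≤ nJ * (2 * b + β * (b / (α * cpi))) := by
    intro i
    -- Row i competes against the label of its group's representative. Both rows have the same true
    -- profile, so the error under that label is exactly the representative's, and the upper loss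
    -- bound applies.
    have h1 := hrow i (ghat (rep (g₀ i)))
    have h2 : ∀ j, Phat (ghat (rep (g₀ i))) j - P (g₀ i) j = Δ (rep (g₀ i)) j := fun j => by
      simp only [hΔ, hrep1]
    simp only [h2] at h1
    have h3 := Finset.sum_le_sum fun j (_ : j ∈ Finset.univ) => hup i j (Δ (rep (g₀ i)) j)
    rw [Finset.sum_add_distrib, ← Finset.mul_sum] at h3
    simp only [Finset.sum_const, Finset.card_univ, nsmul_eq_mul, ← hnJdef] at h3
    have h4 := hrowlow i
    have h5 := mul_le_mul_of_nonneg_left (hrep2 (g₀ i)) hβ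
    simp only [hS] at h5 h4 ⊢
    nlinarith
  -- With a common estimated label the estimated profiles cancel, and the difference of the two true
  -- profiles is a difference of two small errors. Multiplied by α² cpi, the two bounds add up to nJ
  -- · 2b(β + 3α), using cpi ≤ 1.
  have hsep : ∀ i a, a ≠ g₀ i → ghat i ≠ ghat (rep a) := by
    intro i a ha hcon
    have h1 := hgap (g₀ i) a ha.symm
    have h2 : ∀ j, ‖P (g₀ i) j - P a j‖ ^ 2 ≤ 2 * ‖Δ (rep a) j‖ ^ 2 + 2 * ‖Δ i j‖ ^ 2 := by
      intro j
      have e : P (g₀ i) j - P a j = Δ (rep a) j - Δ i j := by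
        simp only [hΔ, hrep1, hcon]; abel
      rw [e]
      have := norm_sub_le (Δ (rep a) j) (Δ i j)
      have h0 := norm_nonneg (Δ (rep a) j - Δ i j)
      nlinarith [sq_nonneg (‖Δ (rep a) j‖ - ‖Δ i j‖)]
    have h3 := Finset.sum_le_sum fun j (_ : j ∈ Finset.univ) => h2 j
    rw [Finset.sum_add_distrib, ← Finset.mul_sum, ← Finset.mul_sum] at h3
    have h4 : nJ * d ≤ 2 * S (rep a) + 2 * S i := h1.trans h3
    have h5 := hrep2 a
    have h6 := hall i
    have h7 : nJ * (d * α ^ 2 * cpi) ≤ nJ * (2 * b * (β + 3 * α)) := by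
      have e1 : α ^ 2 * cpi * (2 * S (rep a)) ≤ α ^ 2 * cpi * (2 * (nJ * (b / (α * cpi)))) := by
        gcongr
      have e2 : α ^ 2 * cpi * (2 * (nJ * (b / (α * cpi)))) = 2 * nJ * α * b := by field_simp
      have e3 : α * cpi * 2 * (α * S i) ≤ α * cpi * 2 * (nJ * (2 * b + β * (b / (α * cpi)))) := by
        gcongr
      have e4 : α * cpi * 2 * (nJ * (2 * b + β * (b / (α * cpi)))) =
        4 * nJ * α * b * cpi + 2 * nJ * β * b := by field_simp; ring
      have e5 : 4 * nJ * α * b * cpi ≤ 4 * nJ * α * b * 1 := by gcongr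
      have e6 := mul_le_mul_of_nonneg_left h4 (by positivity : 0 ≤ α ^ 2 * cpi)
      linarith
    have := mul_lt_mul_of_pos_left hd hnJ
    linarith
  have hinj : Function.Injective fun a => ghat (rep a) := by
    intro a a' haa
    by_contra hne
    have := hsep (rep a) a' (by rw [hrep1]; exact Ne.symm hne)
    exact this haa
  have hbij : Function.Bijective fun a => ghat (rep a) := Finite.injective_iff_bijective.1 hinj
  refine ⟨Equiv.ofBijective _ hbij, fun i => ?_⟩
  obtain ⟨a, ha⟩ := hbij.2 (ghat i)
  have : a = g₀ i := by
    by_contra hne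
    exact hsep i a hne ha.symm
  simp only [Equiv.ofBijective_apply]
  rw [← this]; exact ha.symm

end Classification

/-! ### Linear forms on matrices, bounded in the entrywise maximum norm. -/

section LinearForms

variable {m n : ℕ}

/-- The linear form `L` on matrices is bounded by `B` for the entrywise maximum norm. -/
def FormBound (L : (Fin m → Fin n → ℝ) →ₗ[ℝ] ℝ) (B : ℝ) : Prop :=
  ∀ y : Fin m → Fin n → ℝ, (∀ i j, |y i j| ≤ 1) → |L y| ≤ B

/-- Coefficients of a linear form on matrices. -/
noncomputable def formCoef (L : (Fin m → Fin n → ℝ) →ₗ[ℝ] ℝ) (i : Fin m) (j : Fin n) : ℝ :=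
  L (Pi.single i (Pi.single j 1))

theorem form_eq_sum (L : (Fin m → Fin n → ℝ) →ₗ[ℝ] ℝ) (y : Fin m → Fin n → ℝ) :
    L y = ∑ p : Fin m × Fin n, formCoef L p.1 p.2 * y p.1 p.2 := by
  have hy : y = ∑ p : Fin m × Fin n, y p.1 p.2 • (Pi.single p.1 (Pi.single p.2 (1 : ℝ))) := by
    ext i j
    simp only [Finset.sum_apply, Pi.smul_apply, smul_eq_mul]
    rw [Finset.sum_eq_single (i, j)]
    · simp
    · rintro ⟨i', j'⟩ _ hne
      by_cases hi : i' = i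
      · subst hi
        have : j ≠ j' := fun h => hne (by rw [h])
        simp [Pi.single_eq_of_ne this]
      · rw [Pi.single_eq_of_ne (Ne.symm hi)]; simp
    · simp
  conv_lhs => rw [hy]
  rw [map_sum]
  exact Finset.sum_congr rfl fun p _ => by rw [map_smul, smul_eq_mul, mul_comm]; rfl

/-- Duality of the maximum norm and the ℓ¹ norm: the sign matrix of the coefficients attains the ℓ¹
norm. This makes all later moment bounds independent of the number of rows and columns. -/
theorem FormBound.sum_abs_le {L : (Fin m → Fin n → ℝ) →ₗ[ℝ] ℝ} {B : ℝ} (h : FormBound L B) :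
    ∑ p : Fin m × Fin n, |formCoef L p.1 p.2| ≤ B := by
  have h1 := h (fun i j => SignType.sign (formCoef L i j)) (fun i j => by
    rcases lt_trichotomy (formCoef L i j) 0 with h | h | h
    · simp [sign_neg h]
    · simp [h]
    · simp [sign_pos h])
  refine le_trans (le_of_eq ?_) ((le_abs_self _).trans h1)
  rw [form_eq_sum]
  exact Finset.sum_congr rfl fun p _ => (self_mul_sign _).symm

theorem FormBound.nonneg {L : (Fin m → Fin n → ℝ) →ₗ[ℝ] ℝ} {B : ℝ} (h : FormBound L B) : 0 ≤ B :=
  (Finset.sum_nonneg fun _ _ => abs_nonneg _).trans h.sum_abs_le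

theorem FormBound.abs_le {L : (Fin m → Fin n → ℝ) →ₗ[ℝ] ℝ} {B b : ℝ} (h : FormBound L B)
    {y : Fin m → Fin n → ℝ} (hb : 0 ≤ b) (hy : ∀ i j, |y i j| ≤ b) : |L y| ≤ B * b := by
  rw [form_eq_sum]
  calc |∑ p : Fin m × Fin n, formCoef L p.1 p.2 * y p.1 p.2|
      ≤ ∑ p : Fin m × Fin n, |formCoef L p.1 p.2| * b := by
        refine (Finset.abs_sum_le_sum_abs _ _).trans (Finset.sum_le_sum fun p _ => ?_)
        rw [abs_mul]; gcongr; exact hy _ _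
    _ ≤ B * b := by rw [← Finset.sum_mul]; gcongr; exact h.sum_abs_le

theorem FormBound.sq_le {L : (Fin m → Fin n → ℝ) →ₗ[ℝ] ℝ} {B : ℝ} (h : FormBound L B)
    (y : Fin m → Fin n → ℝ) :
    L y ^ 2 ≤ B * ∑ p : Fin m × Fin n, |formCoef L p.1 p.2| * y p.1 p.2 ^ 2 := by
  rw [form_eq_sum]
  have h1 : (∑ p : Fin m × Fin n, formCoef L p.1 p.2 * y p.1 p.2) ^ 2 ≤
      (∑ p : Fin m × Fin n, |formCoef L p.1 p.2|) *
        ∑ p : Fin m × Fin n, |formCoef L p.1 p.2| * y p.1 p.2 ^ 2 := by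
    apply Finset.sum_sq_le_sum_mul_sum_of_sq_le_mul
    · intro p _; positivity
    · intro p _; positivity
    · intro p _
      rw [mul_pow, ← mul_assoc, abs_mul_abs_self, pow_two (formCoef L p.1 p.2)]
  refine h1.trans (mul_le_mul_of_nonneg_right h.sum_abs_le ?_)
  exact Finset.sum_nonneg fun _ _ => by positivity

theorem measurable_form (L : (Fin m → Fin n → ℝ) →ₗ[ℝ] ℝ) : Measurable L := by
  have : (L : (Fin m → Fin n → ℝ) → ℝ) =
      fun y => ∑ p : Fin m × Fin n, formCoef L p.1 p.2 * y p.1 p.2 := funext (form_eq_sum L)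
  rw [this]; fun_prop

/-- Cauchy–Schwarz with weights |coefficient|; nothing is assumed about the dependence between
entries. -/
theorem FormBound.integral_sq_le {Ω : Type*} [MeasurableSpace Ω] {μ : Measure Ω}
    {L : (Fin m → Fin n → ℝ) →ₗ[ℝ] ℝ} {B D : ℝ} (h : FormBound L B) {W : Ω → Fin m → Fin n → ℝ}
    (hW : ∀ i j, MemLp (fun ω => W ω i j) 2 μ) (hD : ∀ i j, ∫ ω, W ω i j ^ 2 ∂μ ≤ D) (hD0 : 0 ≤ D) :
    MemLp (fun ω => L (W ω)) 2 μ ∧ ∫ ω, L (W ω) ^ 2 ∂μ ≤ B ^ 2 * D := by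
  have hL : MemLp (fun ω => L (W ω)) 2 μ := by
    have : (fun ω => L (W ω)) = fun ω => ∑ p : Fin m × Fin n, formCoef L p.1 p.2 * W ω p.1 p.2 :=
      funext fun ω => form_eq_sum L _
    rw [this]
    exact memLp_finsetSum _ fun p _ => (hW _ _).const_mul _
  refine ⟨hL, ?_⟩
  have hint : ∀ p : Fin m × Fin n, Integrable (fun ω => |formCoef L p.1 p.2| * W ω p.1 p.2 ^ 2) μ :=
    fun p => (hW _ _).integrable_sq.const_mul _
  calc ∫ ω, L (W ω) ^ 2 ∂μ
      ≤ ∫ ω, B * ∑ p : Fin m × Fin n, |formCoef L p.1 p.2| * W ω p.1 p.2 ^ 2 ∂μ :=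
        integral_mono hL.integrable_sq ((integrable_finsetSum _ fun p _ => hint p).const_mul _)
          fun ω => h.sq_le _
    _ = B * ∑ p : Fin m × Fin n, |formCoef L p.1 p.2| * ∫ ω, W ω p.1 p.2 ^ 2 ∂μ := by
        rw [integral_const_mul, integral_finsetSum _ fun p _ => hint p]
        simp_rw [integral_const_mul]
    _ ≤ B * (B * D) := by
        have hB := h.nonneg
        gcongr
        calc _ ≤ ∑ p : Fin m × Fin n, |formCoef L p.1 p.2| * D := by
              gcongr with p _; exact hD _ _
          _ ≤ B * D := by rw [← Finset.sum_mul]; gcongr; exact h.sum_abs_le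
    _ = B ^ 2 * D := by ring

end LinearForms

/-! ### The autoregression as a linear recursion. -/

namespace GMNAR

variable (M : GMNAR)

/-- The assumptions on a single model, with normalized constants. -/
structure Regular (R τ c K κ C : ℝ) (σ : ℝ≥0) : Prop where
  model : M.IsModel
  param : M.ParamSpace R
  convex : M.Convexity τ
  noise : M.NoiseAssumption σ
  cov : M.CovariateAssumption c K
  stable : ∀ (k : ℕ) (y : Fin M.N₁ → Fin M.N₂ → ℝ), (∀ i j, |y i j| ≤ 1) →
    ∀ i j, |(M.transition^[k] y) i j| ≤ C * κ ^ k
  sqInt : ∀ t i j, MemLp (fun ω => M.Y t ω i j) 2 M.μ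
  stat : ∀ s : ℤ, IdentDistrib (fun ω (t : ℤ) => (M.Y t ω, M.X t ω, M.Z t ω))
    (fun ω (t : ℤ) => (M.Y (t + s) ω, M.X (t + s) ω, M.Z (t + s) ω)) M.μ M.μ
  R_pos : 0 < R
  τ_pos : 0 < τ
  c_pos : 0 < c
  K_pos : 0 < K
  κ_ge : 1 / 2 ≤ κ
  κ_lt : κ < 1
  C_ge : 1 ≤ C
  σ_pos : 0 < σ
  N₁_pos : 0 < M.N₁
  N₂_pos : 0 < M.N₂

/-- Row coefficient, covariate, column coefficient and lag positions of the regressor. -/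
abbrev ixRow : M.RegIdx := Sum.inl ()
abbrev ixX (k : Fin M.p₁) : M.RegIdx := Sum.inr (Sum.inl k)
abbrev ixCol : M.RegIdx := Sum.inr (Sum.inr (Sum.inl ()))
abbrev ixZ (k : Fin M.p₂) : M.RegIdx := Sum.inr (Sum.inr (Sum.inr (Sum.inl k)))
abbrev ixLag : M.RegIdx := Sum.inr (Sum.inr (Sum.inr (Sum.inr ())))

theorem sum_regIdx (F : M.RegIdx → ℝ) :
    ∑ a, F a = F M.ixRow + (∑ k, F (M.ixX k)) + F M.ixCol + (∑ k, F (M.ixZ k)) + F M.ixLag := by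
  simp only [RegIdx, Fintype.sum_sum_type, Finset.univ_unique, Finset.sum_singleton]
  simp only [ixRow, ixX, ixCol, ixZ, ixLag, PUnit.default_eq_unit]
  ring

theorem card_regIdx : Fintype.card M.RegIdx = M.m := by
  simp [RegIdx, m]; ring

/-- The transition as a linear map. -/
noncomputable def stepLin : (Fin M.N₁ → Fin M.N₂ → ℝ) →ₗ[ℝ] (Fin M.N₁ → Fin M.N₂ → ℝ) where
  toFun := M.transition
  map_add' y z := by
    ext i j
    simp only [transition, rowNet, colNet, Pi.add_apply, mul_add, add_mul, Finset.sum_add_distrib]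
    ring
  map_smul' a y := by
    ext i j
    simp only [transition, rowNet, colNet, Pi.smul_apply, smul_eq_mul, RingHom.id_apply]
    have h1 : ∀ k, rowNormalize M.A₁ i k * (a * y k j) = a * (rowNormalize M.A₁ i k * y k j) :=
      fun k => by ring
    have h2 : ∀ k, a * y i k * colNormalize M.A₂ k j = a * (y i k * colNormalize M.A₂ k j) :=
      fun k => by ring
    simp only [h1, h2, ← Finset.mul_sum]
    ring

theorem stepLin_apply (y : Fin M.N₁ → Fin M.N₂ → ℝ) : M.stepLin y = M.transition y := rfl

theorem stepLin_pow_apply (k : ℕ) (y : Fin M.N₁ → Fin M.N₂ → ℝ) :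
    (M.stepLin ^ k) y = M.transition^[k] y := by
  rw [Module.End.pow_apply]; rfl

/-- Contribution of the lagged response to `v · regressor`. -/
noncomputable def lagForm (v : M.RegIdx → ℝ) (i : Fin M.N₁) (j : Fin M.N₂) :
    (Fin M.N₁ → Fin M.N₂ → ℝ) →ₗ[ℝ] ℝ where
  toFun y := v M.ixRow * M.rowNet y i j + v M.ixCol * M.colNet y i j + v M.ixLag * y i j
  map_add' y z := by
    simp only [rowNet, colNet, Pi.add_apply, mul_add, add_mul, Finset.sum_add_distrib]
    ring
  map_smul' a y := by
    simp only [rowNet, colNet, Pi.smul_apply, smul_eq_mul, RingHom.id_apply]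
    have h1 : ∀ k, rowNormalize M.A₁ i k * (a * y k j) = a * (rowNormalize M.A₁ i k * y k j) :=
      fun k => by ring
    have h2 : ∀ k, a * y i k * colNormalize M.A₂ k j = a * (y i k * colNormalize M.A₂ k j) :=
      fun k => by ring
    simp only [h1, h2, ← Finset.mul_sum]
    ring

/-- `v · regressor`. -/
noncomputable def proj (v : M.RegIdx → ℝ) (i : Fin M.N₁) (j : Fin M.N₂) (t : ℤ) (ω : M.Ω) : ℝ :=
  ∑ a, v a * M.regressor i j t ω a

theorem proj_eq (v : M.RegIdx → ℝ) (i : Fin M.N₁) (j : Fin M.N₂) (t : ℤ) (ω : M.Ω) :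
    M.proj v i j t ω = M.lagForm v i j (M.Y (t - 1) ω) +
      (∑ k, M.X t ω i k * v (M.ixX k) + ∑ k, M.Z t ω j k * v (M.ixZ k)) := by
  simp only [proj, sum_regIdx, regressor, Sum.elim_inl, Sum.elim_inr, lagForm, LinearMap.coe_mk,
    AddHom.coe_mk]
  simp only [mul_comm (v _)]
  ring

/-- Coefficients of the regressor when the row has label `g` and the column has label `h`. -/
def coefVec {M : GMNAR} (θ : M.Params) (g : Fin M.G) (h : Fin M.H) : M.RegIdx → ℝ :=
  Sum.elim (fun _ => θ.lam g) <| Sum.elim (θ.zeta g) <| Sum.elim (fun _ => θ.gam h) <|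
    Sum.elim (θ.delta h) fun _ => θ.alpha g h

theorem fitted_eq_proj (θ : M.Params) (g : Fin M.G) (h : Fin M.H) (i : Fin M.N₁) (j : Fin M.N₂)
    (t : ℤ) (ω : M.Ω) : M.fitted θ g h i j t ω = M.proj (coefVec θ g h) i j t ω := by
  simp only [proj_eq, fitted, lagForm, LinearMap.coe_mk, AddHom.coe_mk, coefVec, Sum.elim_inl,
    Sum.elim_inr]
  ring

/-- The covariate part of the conditional mean. -/
noncomputable def covPart (t : ℤ) (ω : M.Ω) : Fin M.N₁ → Fin M.N₂ → ℝ := fun i j =>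
  (∑ k, M.X t ω i k * M.θ₀.zeta (M.g₀ i) k) + ∑ k, M.Z t ω j k * M.θ₀.delta (M.h₀ j) k

theorem fitted_true (i : Fin M.N₁) (j : Fin M.N₂) (t : ℤ) (ω : M.Ω) :
    M.fitted M.θ₀ (M.g₀ i) (M.h₀ j) i j t ω =
      M.stepLin (M.Y (t - 1) ω) i j + M.covPart t ω i j := by
  simp only [fitted, stepLin_apply, transition, covPart]; ring

variable {M}

theorem abs_rowNet_le (hA : ∀ i k, 0 ≤ M.A₁ i k) {y : Fin M.N₁ → Fin M.N₂ → ℝ}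
    (hy : ∀ i j, |y i j| ≤ 1) (i : Fin M.N₁) (j : Fin M.N₂) : |M.rowNet y i j| ≤ 1 := by
  have hs : 0 ≤ ∑ l, M.A₁ i l := Finset.sum_nonneg fun l _ => hA i l
  calc |M.rowNet y i j| ≤ ∑ k, rowNormalize M.A₁ i k := by
        refine (Finset.abs_sum_le_sum_abs _ _).trans (Finset.sum_le_sum fun k _ => ?_)
        have h0 : 0 ≤ rowNormalize M.A₁ i k := div_nonneg (hA i k) hs
        rw [abs_mul, abs_of_nonneg h0]
        exact mul_le_of_le_one_right h0 (hy k j)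
    _ ≤ 1 := by
        simp only [rowNormalize, ← Finset.sum_div]; exact div_self_le_one _

theorem abs_colNet_le (hA : ∀ i k, 0 ≤ M.A₂ i k) {y : Fin M.N₁ → Fin M.N₂ → ℝ}
    (hy : ∀ i j, |y i j| ≤ 1) (i : Fin M.N₁) (j : Fin M.N₂) : |M.colNet y i j| ≤ 1 := by
  have hs : 0 ≤ ∑ l, M.A₂ l j := Finset.sum_nonneg fun l _ => hA l j
  calc |M.colNet y i j| ≤ ∑ k, colNormalize M.A₂ k j := by
        refine (Finset.abs_sum_le_sum_abs _ _).trans (Finset.sum_le_sum fun k _ => ?_)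
        have h0 : 0 ≤ colNormalize M.A₂ k j := div_nonneg (hA k j) hs
        rw [abs_mul, abs_of_nonneg h0]
        exact mul_le_of_le_one_left h0 (hy i k)
    _ ≤ 1 := by
        simp only [colNormalize, ← Finset.sum_div]; exact div_self_le_one _

variable {R τ c K κ C : ℝ} {σ : ℝ≥0}

theorem Regular.lagForm_bound (h : M.Regular R τ c K κ C σ) (v : M.RegIdx → ℝ) (i : Fin M.N₁)
    (j : Fin M.N₂) : FormBound (M.lagForm v i j) (|v M.ixRow| + |v M.ixCol| + |v M.ixLag|) := by
  intro y hy
  obtain ⟨-, -, -, -, -, hA1, -, hA2, -⟩ := h.model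
  have h1 := abs_rowNet_le (M := M) hA1 hy i j
  have h2 := abs_colNet_le (M := M) hA2 hy i j
  have h3 := hy i j
  simp only [lagForm, LinearMap.coe_mk, AddHom.coe_mk]
  refine (abs_add_le _ _).trans (add_le_add ((abs_add_le _ _).trans (add_le_add ?_ ?_)) ?_)
  all_goals rw [abs_mul]; exact mul_le_of_le_one_right (abs_nonneg _) (by assumption)

theorem Regular.pow_bound (h : M.Regular R τ c K κ C σ) (k : ℕ)
    {y : Fin M.N₁ → Fin M.N₂ → ℝ} (hy : ∀ i j, |y i j| ≤ 1) (i : Fin M.N₁) (j : Fin M.N₂) :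
    |(M.stepLin ^ k) y i j| ≤ C * κ ^ k := by
  rw [stepLin_pow_apply]; exact h.stable k y hy i j

theorem Regular.comp_pow_bound (h : M.Regular R τ c K κ C σ)
    {L : (Fin M.N₁ → Fin M.N₂ → ℝ) →ₗ[ℝ] ℝ} {B : ℝ} (hL : FormBound L B) (k : ℕ) :
    FormBound (L ∘ₗ (M.stepLin ^ k)) (B * C * κ ^ k) := by
  intro y hy
  have h1 := h.pow_bound k hy
  have hC : 0 ≤ C * κ ^ k :=
    mul_nonneg (by linarith [h.C_ge]) (pow_nonneg (by linarith [h.κ_ge]) _)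
  rw [mul_assoc]
  exact hL.abs_le hC h1

/-- The entry `(i, j)` as a linear form. -/
def entryForm (i : Fin M.N₁) (j : Fin M.N₂) : (Fin M.N₁ → Fin M.N₂ → ℝ) →ₗ[ℝ] ℝ where
  toFun y := y i j
  map_add' _ _ := rfl
  map_smul' _ _ := rfl

theorem entryForm_bound (i : Fin M.N₁) (j : Fin M.N₂) : FormBound (entryForm i j) 1 :=
  fun _ hy => hy i j

theorem Regular.ae_step (h : M.Regular R τ c K κ C σ) :
    ∀ᵐ ω ∂M.μ, ∀ t : ℤ, M.Y t ω = M.stepLin (M.Y (t - 1) ω) + (M.covPart t ω + M.E t ω) := by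
  obtain ⟨-, -, -, -, -, -, -, -, -, hY, -⟩ := h.model
  have : ∀ᵐ ω ∂M.μ, ∀ t i j,
      M.Y t ω i j = M.fitted M.θ₀ (M.g₀ i) (M.h₀ j) i j t ω + M.E t ω i j := by
    simp only [ae_all_iff]; exact fun t i j => hY t i j
  filter_upwards [this] with ω hω t
  ext i j
  rw [hω, fitted_true]; simp only [Pi.add_apply]; ring

/-- The recursion is unrolled only down to time 0, not to the infinite past, because the
concentration hypothesis covers covariates at times 0, …, T. Everything earlier is carried by the
response at time 0. -/
theorem Regular.ae_expand (h : M.Regular R τ c K κ C σ) :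
    ∀ᵐ ω ∂M.μ, ∀ t : ℕ, M.Y t ω = (M.stepLin ^ t) (M.Y 0 ω) +
      ∑ k ∈ Finset.range t, (M.stepLin ^ k) (M.covPart ((t : ℤ) - k) ω + M.E ((t : ℤ) - k) ω) := by
  filter_upwards [h.ae_step] with ω hω t
  induction t with
  | zero => simp
  | succ t ih =>
    rw [hω, show ((t + 1 : ℕ) : ℤ) - 1 = t by push_cast; ring, ih, map_add, map_sum,
      Finset.sum_range_succ', add_assoc]
    have e1 : M.stepLin ((M.stepLin ^ t) (M.Y 0 ω)) = (M.stepLin ^ (t + 1)) (M.Y 0 ω) := by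
      rw [pow_succ', Module.End.mul_apply]
    have e2 : ∀ k : ℕ, M.stepLin ((M.stepLin ^ k) (M.covPart ((t : ℤ) - k) ω + M.E ((t : ℤ) - k) ω)) =
        (M.stepLin ^ (k + 1)) (M.covPart (((t + 1 : ℕ) : ℤ) - (k + 1 : ℕ)) ω +
          M.E (((t + 1 : ℕ) : ℤ) - (k + 1 : ℕ)) ω) := fun k => by
      rw [pow_succ', Module.End.mul_apply]
      congr 3 <;> congr 1 <;> push_cast <;> ring
    rw [e1]
    simp only [e2]
    simp

end GMNAR

/-! ### Noise given all covariates and the earlier noise. -/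

/-- Intersections b ∩ c form a π-system generating B ⊔ C, on which the product formula follows from
the two hypotheses. It will be used with A the current noise, B the earlier noise and C the
covariates. -/
theorem indep_sup_right_of_indep {Ω : Type*} {A B C mΩ : MeasurableSpace Ω} {μ : Measure Ω}
    [IsProbabilityMeasure μ] (hA : A ≤ mΩ) (hB : B ≤ mΩ) (hC : C ≤ mΩ)
    (hAB : Indep A B μ) (hABC : Indep (A ⊔ B) C μ) : Indep A (B ⊔ C) μ := by
  set π : Set (Set Ω) := {s | ∃ b c, MeasurableSet[B] b ∧ MeasurableSet[C] c ∧ s = b ∩ c} with hπ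
  have hpi : IsPiSystem π := by
    rintro _ ⟨b, c, hb, hc, rfl⟩ _ ⟨b', c', hb', hc', rfl⟩ _
    exact ⟨b ∩ b', c ∩ c', hb.inter hb', hc.inter hc', by
      ext x; simp only [Set.mem_inter_iff]; tauto⟩
  have hgen : B ⊔ C = MeasurableSpace.generateFrom π := by
    apply le_antisymm
    · refine sup_le (fun b hb => ?_) (fun c hc => ?_)
      · exact MeasurableSpace.measurableSet_generateFrom
          ⟨b, Set.univ, hb, MeasurableSet.univ, by simp⟩
      · exact MeasurableSpace.measurableSet_generateFrom
          ⟨Set.univ, c, MeasurableSet.univ, hc, by simp⟩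
    · refine MeasurableSpace.generateFrom_le ?_
      rintro _ ⟨b, c, hb, hc, rfl⟩
      have hb' : MeasurableSet[B ⊔ C] b := (le_sup_left : B ≤ B ⊔ C) b hb
      have hc' : MeasurableSet[B ⊔ C] c := (le_sup_right : C ≤ B ⊔ C) c hc
      exact hb'.inter hc'
  refine IndepSets.indep hA (sup_le hB hC) (@MeasurableSpace.isPiSystem_measurableSet Ω A) hpi
    (@MeasurableSpace.generateFrom_measurableSet Ω A).symm hgen ?_
  rw [IndepSets_iff]
  rintro a _ ha ⟨b, c, hb, hc, rfl⟩
  have hab : MeasurableSet[A ⊔ B] (a ∩ b) := by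
    have ha' : MeasurableSet[A ⊔ B] a := (le_sup_left : A ≤ A ⊔ B) a ha
    have hb' : MeasurableSet[A ⊔ B] b := (le_sup_right : B ≤ A ⊔ B) b hb
    exact ha'.inter hb'
  have hb' : MeasurableSet[A ⊔ B] b := (le_sup_right : B ≤ A ⊔ B) b hb
  have h1 := (Indep_iff _ _ _).1 hABC (a ∩ b) c hab hc
  have h2 := (Indep_iff _ _ _).1 hABC b c hb' hc
  have h3 := (Indep_iff _ _ _).1 hAB a b ha hb
  rw [← Set.inter_assoc, h1, h2, h3, mul_assoc]

/-- No independence is needed: standard-deviation scales, not variances, add up. With ℓ¹-bounded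
coefficients and geometric lags this is sufficient. -/
theorem ProbabilityTheory.HasSubgaussianMGF.finset_sum {Ω ι : Type*} [MeasurableSpace Ω]
    {μ : Measure Ω} [IsProbabilityMeasure μ] {X : ι → Ω → ℝ} {s : ι → ℝ≥0} (S : Finset ι)
    (h : ∀ i ∈ S, HasSubgaussianMGF (X i) (s i ^ 2) μ) :
    HasSubgaussianMGF (fun ω => ∑ i ∈ S, X i ω) ((∑ i ∈ S, s i) ^ 2) μ := by
  classical
  induction S using Finset.induction_on with
  | empty => simp
  | insert i S hi ih =>
    have h1 := (h i (Finset.mem_insert_self _ _)).add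
      (ih fun j hj => h j (Finset.mem_insert_of_mem hj))
    simp only [Finset.sum_insert hi]
    convert h1 using 2
    simp

namespace GMNAR

variable {M : GMNAR} {R τ c K κ C : ℝ} {σ : ℝ≥0}

/-- The σ-algebra of the noise entries with index in `S`. -/
@[reducible]
def noiseSigma (M : GMNAR) (S : Set (Fin M.N₁ × Fin M.N₂ × ℤ)) : MeasurableSpace M.Ω :=
  ⨆ q ∈ S, MeasurableSpace.comap (fun ω => M.E q.2.2 ω q.1 q.2.1) inferInstance

/-- The σ-algebra of the covariates. -/
@[reducible]
def covSigma (M : GMNAR) : MeasurableSpace M.Ω :=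
  MeasurableSpace.comap (fun ω (t : ℤ) => (M.X t ω, M.Z t ω)) inferInstance

/-- Everything the noise of time `r` is independent of: earlier noise and all covariates. -/
@[reducible]
def pastNoise (M : GMNAR) (r : ℤ) : MeasurableSpace M.Ω :=
  M.noiseSigma {q | q.2.2 < r} ⊔ M.covSigma

/-- The noise of lag `k` in a linear form of the expanded response at time `t`. -/
noncomputable def noiseTerm (M : GMNAR) (L : ℕ → (Fin M.N₁ → Fin M.N₂ → ℝ) →ₗ[ℝ] ℝ)
    (k t : ℕ) (ω : M.Ω) : ℝ :=
  if k < t then L k (M.E ((t : ℤ) - k) ω) else 0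

/-- Sub-Gaussian scale of the noise of lag `k`. -/
noncomputable def noiseScale (β κ : ℝ) (σ : ℝ≥0) (k : ℕ) : ℝ≥0 := Real.toNNReal (β * κ ^ k) * σ

theorem noiseScale_coe {β κ : ℝ} (hβ : 0 ≤ β) (hκ : 0 ≤ κ) (σ : ℝ≥0) (k : ℕ) :
    (noiseScale β κ σ k : ℝ) = β * κ ^ k * σ := by
  rw [noiseScale, NNReal.coe_mul, Real.coe_toNNReal _ (by positivity)]

theorem sum_pow_le_inv {κ : ℝ} (h0 : 0 ≤ κ) (h1 : κ < 1) (T : ℕ) :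
    ∑ k ∈ Finset.range T, κ ^ k ≤ (1 - κ)⁻¹ := by
  rw [← tsum_geometric_of_lt_one h0 h1]
  exact (summable_geometric_of_lt_one h0 h1).sum_le_tsum _ fun k _ => pow_nonneg h0 k

theorem sum_noiseScale_le {β κ : ℝ} (hβ : 0 ≤ β) (hκ : 0 ≤ κ) (hκ1 : κ < 1) (σ : ℝ≥0) (T : ℕ) :
    ∑ k ∈ Finset.range T, (noiseScale β κ σ k : ℝ) ≤ β * σ / (1 - κ) := by
  simp_rw [noiseScale_coe hβ hκ]
  rw [← Finset.sum_mul, ← Finset.mul_sum]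
  have := sum_pow_le_inv hκ hκ1 T
  calc _ ≤ β * (1 - κ)⁻¹ * σ := by gcongr
    _ = _ := by ring

theorem Regular.prob (h : M.Regular R τ c K κ C σ) : IsProbabilityMeasure M.μ := h.model.1

theorem Regular.measurable_Y (h : M.Regular R τ c K κ C σ) (t : ℤ) : Measurable (M.Y t) :=
  h.model.2.1 t

theorem Regular.measurable_X (h : M.Regular R τ c K κ C σ) (t : ℤ) : Measurable (M.X t) :=
  h.model.2.2.1 t

theorem Regular.measurable_Z (h : M.Regular R τ c K κ C σ) (t : ℤ) : Measurable (M.Z t) :=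
  h.model.2.2.2.1 t

theorem Regular.measurable_E (h : M.Regular R τ c K κ C σ) (t : ℤ) : Measurable (M.E t) :=
  h.model.2.2.2.2.1 t

theorem Regular.measurable_entry (h : M.Regular R τ c K κ C σ) (t : ℤ) (i : Fin M.N₁)
    (j : Fin M.N₂) : Measurable fun ω => M.E t ω i j :=
  measurable_pi_iff.1 (measurable_pi_iff.1 (h.measurable_E t) i) j

theorem Regular.subG_form (h : M.Regular R τ c K κ C σ)
    {L : (Fin M.N₁ → Fin M.N₂ → ℝ) →ₗ[ℝ] ℝ} {B : ℝ} (hL : FormBound L B) (t : ℤ) :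
    HasSubgaussianMGF (fun ω => L (M.E t ω)) ((Real.toNNReal B * σ) ^ 2) M.μ ∧
      ∫ ω, L (M.E t ω) ∂M.μ = 0 := by
  have := h.prob
  obtain ⟨-, -, hzero, hsub, -⟩ := h.noise
  have hB := hL.nonneg
  have he : (fun ω => L (M.E t ω)) =
      fun ω => ∑ p : Fin M.N₁ × Fin M.N₂, formCoef L p.1 p.2 * M.E t ω p.1 p.2 :=
    funext fun ω => form_eq_sum L _
  constructor
  · rw [he]
    have h1 := HasSubgaussianMGF.finset_sum (μ := M.μ) (Finset.univ : Finset (Fin M.N₁ × Fin M.N₂))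
      (X := fun p ω => formCoef L p.1 p.2 * M.E t ω p.1 p.2)
      (s := fun p => Real.toNNReal |formCoef L p.1 p.2| * σ) (fun p _ => by
        have := (hsub p.1 p.2 t).const_mul (formCoef L p.1 p.2)
        refine this.of_le (le_of_eq ?_)
        rw [mul_pow]
        congr 1
        ext
        push_cast
        rw [Real.coe_toNNReal _ (abs_nonneg _), sq_abs]; rfl)
    refine h1.of_le ?_
    rw [← Finset.sum_mul]
    gcongr
    rw [← Real.toNNReal_sum_of_nonneg fun _ _ => abs_nonneg _]
    exact Real.toNNReal_le_toNNReal hL.sum_abs_le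
  · rw [he, integral_finsetSum _ fun p _ => ((hsub p.1 p.2 t).integrable).const_mul _]
    refine Finset.sum_eq_zero fun p _ => ?_
    rw [integral_const_mul, hzero, mul_zero]

theorem measurable_form_noise (L : (Fin M.N₁ → Fin M.N₂ → ℝ) →ₗ[ℝ] ℝ) (r : ℤ)
    {S : Set (Fin M.N₁ × Fin M.N₂ × ℤ)} (hS : ∀ q, q.2.2 = r → q ∈ S) :
    Measurable[M.noiseSigma S] fun ω => L (M.E r ω) := by
  have he : (fun ω => L (M.E r ω)) =
      fun ω => ∑ p : Fin M.N₁ × Fin M.N₂, formCoef L p.1 p.2 * M.E r ω p.1 p.2 :=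
    funext fun ω => form_eq_sum L _
  rw [he]
  refine Finset.measurable_sum _ fun p _ => Measurable.const_mul ?_ _
  have h1 : MeasurableSpace.comap (fun ω => M.E r ω p.1 p.2) inferInstance ≤ M.noiseSigma S :=
    le_iSup₂_of_le (p.1, p.2, r) (hS _ rfl) le_rfl
  exact (comap_measurable (fun ω => M.E r ω p.1 p.2)).mono h1 le_rfl

theorem Regular.noiseSigma_le (h : M.Regular R τ c K κ C σ) (S : Set (Fin M.N₁ × Fin M.N₂ × ℤ)) :
    M.noiseSigma S ≤ M.mΩ :=
  iSup₂_le fun q _ => (h.measurable_entry q.2.2 q.1 q.2.1).comap_le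

theorem Regular.covSigma_le (h : M.Regular R τ c K κ C σ) : M.covSigma ≤ M.mΩ :=
  (measurable_pi_iff.2 fun t => (h.measurable_X t).prodMk (h.measurable_Z t)).comap_le

theorem noiseSigma_le_comap (S : Set (Fin M.N₁ × Fin M.N₂ × ℤ)) :
    M.noiseSigma S ≤ MeasurableSpace.comap (fun ω t => M.E t ω) inferInstance := by
  refine iSup₂_le fun q _ => ?_
  have h1 : Measurable fun e : ℤ → Fin M.N₁ → Fin M.N₂ → ℝ => e q.2.2 q.1 q.2.1 := by fun_prop
  have h2 : Measurable[MeasurableSpace.comap (fun ω t => M.E t ω) inferInstance]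
      fun ω => M.E q.2.2 ω q.1 q.2.1 := h1.comp (comap_measurable (fun ω t => M.E t ω))
  exact h2.comap_le

theorem Regular.indep_noise (h : M.Regular R τ c K κ C σ)
    (L : (Fin M.N₁ → Fin M.N₂ → ℝ) →ₗ[ℝ] ℝ) (r : ℤ) :
    Indep (MeasurableSpace.comap (fun ω => L (M.E r ω)) inferInstance) (M.pastNoise r) M.μ := by
  have := h.prob
  have hAB : Indep (M.noiseSigma {q | q.2.2 = r}) (M.noiseSigma {q | q.2.2 < r}) M.μ :=
    indep_iSup_of_disjoint
      (m := fun q : Fin M.N₁ × Fin M.N₂ × ℤ =>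
        MeasurableSpace.comap (fun ω => M.E q.2.2 ω q.1 q.2.1) inferInstance)
      (fun q => (h.measurable_entry q.2.2 q.1 q.2.1).comap_le) h.noise.1.iIndep
      (Set.disjoint_left.2 fun q hq hq' => (lt_irrefl _ ((hq : q.2.2 = r) ▸ hq' : r < r)))
  have hexo : IndepFun (fun ω t => M.E t ω) (fun ω t => (M.X t ω, M.Z t ω)) M.μ :=
    h.model.2.2.2.2.2.2.2.2.2.2
  rw [IndepFun_iff_Indep] at hexo
  have hABC := indep_of_indep_of_le_left hexo
    (sup_le (noiseSigma_le_comap {q | q.2.2 = r}) (noiseSigma_le_comap {q | q.2.2 < r}))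
  exact indep_of_indep_of_le_left (indep_sup_right_of_indep (h.noiseSigma_le _) (h.noiseSigma_le _)
    h.covSigma_le hAB hABC) (measurable_form_noise L r fun q hq => hq).comap_le

/-- The filtration contains the whole covariate path, future included, so the covariate part f
behaves as a constant. Exogeneity makes this legitimate. Terms with lag k ≥ t are zero, since the
noise up to time 0 is already contained in the initial response. -/
theorem Regular.lagNoise (h : M.Regular R τ c K κ C σ)
    {L : ℕ → (Fin M.N₁ → Fin M.N₂ → ℝ) →ₗ[ℝ] ℝ} {β : ℝ} (hβ : 0 < β)
    (hL : ∀ k, FormBound (L k) (β * κ ^ k)) {f : ℕ → M.Ω → ℝ}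
    (hf : ∀ t, Measurable[M.covSigma] (f t)) :
    LagNoise M.μ M.pastNoise f (M.noiseTerm L) (noiseScale β κ σ) := by
  have := h.prob
  have hκ : 0 < κ := by linarith [h.κ_ge]
  refine ⟨?_, ?_, ?_, ?_, ?_, ?_, ?_⟩
  · intro r r' hrr
    exact sup_le_sup_right (biSup_mono fun q hq => lt_of_lt_of_le hq hrr) _
  · intro r
    exact sup_le (h.noiseSigma_le _) h.covSigma_le
  · intro r t
    exact (hf t).mono le_sup_right le_rfl
  · intro k t
    unfold noiseTerm
    split_ifs
    · refine (measurable_form_noise (L k) ((t : ℤ) - k)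
        (S := {q | q.2.2 < (t : ℤ) - k + 1}) fun q hq => ?_).mono le_sup_left le_rfl
      simp only [Set.mem_ofPred_eq]; omega
    · exact measurable_const
  · intro k t
    unfold noiseTerm
    split_ifs
    · exact h.indep_noise (L k) _
    · rw [MeasurableSpace.comap_const]
      exact indep_bot_left _
  · intro k
    have hs := h.σ_pos
    refine mul_pos ?_ hs
    rw [Real.toNNReal_pos]; positivity
  · intro k t
    unfold noiseTerm
    split_ifs
    · exact (h.subG_form (hL k) _).1
    · exact HasSubgaussianMGF.fun_zero.of_le (by positivity)

theorem Regular.integral_noiseTerm (h : M.Regular R τ c K κ C σ)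
    {L : ℕ → (Fin M.N₁ → Fin M.N₂ → ℝ) →ₗ[ℝ] ℝ} {β : ℝ}
    (hL : ∀ k, FormBound (L k) (β * κ ^ k)) (k t : ℕ) : ∫ ω, M.noiseTerm L k t ω ∂M.μ = 0 := by
  unfold noiseTerm
  split_ifs
  · exact (h.subG_form (hL k) _).2
  · simp

end GMNAR

/-! ### Covariate contributions as linear images of the projected covariates. -/

namespace GMNAR

variable (M : GMNAR)

/-- The space of the projected covariates. -/
abbrev CovSpace : Type := EuclideanSpace ℝ (Fin (M.T + 1) × Fin 2 × (Fin M.N₁ ⊕ Fin M.N₂))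

/-- Coordinates of a projected covariate vector, zero after time `T`. -/
noncomputable def covAt (r : Fin 2) (s : ℕ) (x : Fin M.N₁ ⊕ Fin M.N₂) : M.CovSpace →ₗ[ℝ] ℝ where
  toFun V := if hs : s < M.T + 1 then V (⟨s, hs⟩, r, x) else 0
  map_add' V W := by split_ifs <;> simp
  map_smul' a V := by split_ifs <;> simp

/-- The matrix of sums of row and column projections at time `s`. -/
noncomputable def covMat (r : Fin 2) (s : ℕ) :
    M.CovSpace →ₗ[ℝ] (Fin M.N₁ → Fin M.N₂ → ℝ) where
  toFun V := fun i j => M.covAt r s (Sum.inl i) V + M.covAt r s (Sum.inr j) V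
  map_add' V W := by ext i j; simp only [map_add, Pi.add_apply]; ring
  map_smul' a V := by
    ext i j; simp only [map_smul, Pi.smul_apply, smul_eq_mul, RingHom.id_apply]; ring

/-- Forms `l t` applied to the covariate matrices of times `s t`. -/
noncomputable def seqMap {n : ℕ} (r : Fin 2) (l : Fin n → (Fin M.N₁ → Fin M.N₂ → ℝ) →ₗ[ℝ] ℝ)
    (s : Fin n → ℕ) : M.CovSpace →ₗ[ℝ] EuclideanSpace ℝ (Fin n) where
  toFun V := WithLp.toLp 2 fun t => l t (M.covMat r (s t) V)
  map_add' V W := by ext t; simp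
  map_smul' a V := by ext t; simp

variable {M}

theorem seqMap_apply {n : ℕ} (r : Fin 2) (l : Fin n → (Fin M.N₁ → Fin M.N₂ → ℝ) →ₗ[ℝ] ℝ)
    (s : Fin n → ℕ) (V : M.CovSpace) (t : Fin n) :
    M.seqMap r l s V t = l t (M.covMat r (s t) V) := rfl

theorem sum_covAt_sq_le (r : Fin 2) (V : M.CovSpace) :
    ∑ s ∈ Finset.range (M.T + 1), ∑ x, M.covAt r s x V ^ 2 ≤ ‖V‖ ^ 2 := by
  rw [EuclideanSpace.norm_sq_eq, Fintype.sum_prod_type, ← Fin.sum_univ_eq_sum_range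
    (fun s => ∑ x, M.covAt r s x V ^ 2)]
  refine Finset.sum_le_sum fun s _ => ?_
  rw [Fintype.sum_prod_type]
  have h1 : ∀ x, M.covAt r (s : ℕ) x V = V (s, r, x) := fun x => dif_pos s.2
  simp only [h1]
  refine le_trans (le_of_eq ?_) (Finset.single_le_sum
    (f := fun r' => ∑ x, ‖V (s, r', x)‖ ^ 2) (fun r' _ => by positivity) (Finset.mem_univ r))
  simp

theorem covMat_sq_le (r : Fin 2) (s : ℕ) (V : M.CovSpace) (i : Fin M.N₁) (j : Fin M.N₂) :
    M.covMat r s V i j ^ 2 ≤ 2 * ∑ x, M.covAt r s x V ^ 2 := by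
  have h1 : M.covAt r s (Sum.inl i) V ^ 2 ≤ ∑ i, M.covAt r s (Sum.inl i) V ^ 2 :=
    Finset.single_le_sum (f := fun i => M.covAt r s (Sum.inl i) V ^ 2)
      (fun _ _ => sq_nonneg _) (Finset.mem_univ i)
  have h2 : M.covAt r s (Sum.inr j) V ^ 2 ≤ ∑ j, M.covAt r s (Sum.inr j) V ^ 2 :=
    Finset.single_le_sum (f := fun j => M.covAt r s (Sum.inr j) V ^ 2)
      (fun _ _ => sq_nonneg _) (Finset.mem_univ j)
  rw [Fintype.sum_sum_type]
  simp only [covMat, LinearMap.coe_mk, AddHom.coe_mk]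
  nlinarith [sq_nonneg (M.covAt r s (Sum.inl i) V - M.covAt r s (Sum.inr j) V)]

/-- By injectivity of s on the active indices, each time is read at most once, so the squared
outputs add up to at most the squared norm of V. The factor √2 comes from each matrix entry being a
row coordinate plus a column coordinate. -/
theorem norm_seqMap_le {n : ℕ} (r : Fin 2) {l : Fin n → (Fin M.N₁ → Fin M.N₂ → ℝ) →ₗ[ℝ] ℝ}
    {s : Fin n → ℕ} {B : ℝ} (hB : 0 ≤ B) (hl : ∀ t, FormBound (l t) B)
    (hs : Set.InjOn s {t | l t ≠ 0}) (V : M.CovSpace) :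
    ‖M.seqMap r l s V‖ ≤ Real.sqrt 2 * B * ‖V‖ := by
  classical
  set g : ℕ → ℝ := fun u => ∑ x, M.covAt r u x V ^ 2 with hg
  have hg0 : ∀ u, 0 ≤ g u := fun u => Finset.sum_nonneg fun _ _ => sq_nonneg _
  have hpt : ∀ t, ‖M.seqMap r l s V t‖ ^ 2 ≤ if l t ≠ 0 then 2 * B ^ 2 * g (s t) else 0 := by
    intro t
    split_ifs with h
    · have h1 := (hl t).abs_le (y := M.covMat r (s t) V) (b := Real.sqrt (2 * g (s t)))
        (Real.sqrt_nonneg _) fun i j => Real.abs_le_sqrt (covMat_sq_le r (s t) V i j)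
      rw [seqMap_apply, Real.norm_eq_abs]
      calc |l t (M.covMat r (s t) V)| ^ 2 ≤ (B * Real.sqrt (2 * g (s t))) ^ 2 := by gcongr
        _ = 2 * B ^ 2 * g (s t) := by
          rw [mul_pow, Real.sq_sqrt (by have := hg0 (s t); positivity)]; ring
    · rw [not_not] at h
      rw [seqMap_apply, h]; simp
  have hsum : ∑ t ∈ Finset.univ.filter (fun t => l t ≠ 0), g (s t) ≤ ‖V‖ ^ 2 := by
    rw [← Finset.sum_image (f := g) (g := s) (s := Finset.univ.filter (fun t => l t ≠ 0))
      (fun a ha b hb hab => hs (by simpa using ha) (by simpa using hb) hab)]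
    refine le_trans ?_ (sum_covAt_sq_le r V)
    rw [← Finset.sum_filter_ne_zero]
    refine Finset.sum_le_sum_of_subset_of_nonneg (fun u hu => ?_) fun u _ _ => hg0 u
    rw [Finset.mem_range]
    by_contra hlt
    apply (Finset.mem_filter.1 hu).2
    have : ∀ x, M.covAt r u x V = 0 := fun x => dif_neg hlt
    simp [hg, this]
  have h3 : ‖M.seqMap r l s V‖ ^ 2 ≤ (Real.sqrt 2 * B * ‖V‖) ^ 2 := by
    rw [EuclideanSpace.norm_sq_eq, mul_pow, mul_pow, Real.sq_sqrt (by norm_num)]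
    calc ∑ t, ‖M.seqMap r l s V t‖ ^ 2
        ≤ ∑ t, if l t ≠ 0 then 2 * B ^ 2 * g (s t) else 0 := Finset.sum_le_sum fun t _ => hpt t
      _ = 2 * B ^ 2 * ∑ t ∈ Finset.univ.filter (fun t => l t ≠ 0), g (s t) := by
          rw [← Finset.sum_filter, Finset.mul_sum]
      _ ≤ _ := by gcongr
  exact (pow_le_pow_iff_left₀ (norm_nonneg _) (by positivity) two_ne_zero).1 h3

variable (M) in
/-- Lags `0, …, t - 1` of the covariates, with weights `L`. -/
noncomputable def lagMap (n : ℕ) (L : ℕ → (Fin M.N₁ → Fin M.N₂ → ℝ) →ₗ[ℝ] ℝ) :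
    M.CovSpace →ₗ[ℝ] EuclideanSpace ℝ (Fin n) :=
  ∑ k ∈ Finset.range n, M.seqMap 1 (fun t : Fin n => if k < (t : ℕ) then L k else 0)
    fun t => (t : ℕ) - k

theorem formBound_zero {m n : ℕ} {B : ℝ} (hB : 0 ≤ B) :
    FormBound (0 : (Fin m → Fin n → ℝ) →ₗ[ℝ] ℝ) B := fun y _ => by simpa using hB

/-- Each lag is a time shift with norm decaying like κ ^ k, so the triangle inequality over lags
gives a bound free of n. -/
theorem norm_lagMap_le (n : ℕ) {L : ℕ → (Fin M.N₁ → Fin M.N₂ → ℝ) →ₗ[ℝ] ℝ} {β κ : ℝ} (hβ : 0 ≤ β)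
    (hκ : 0 ≤ κ) (hκ1 : κ < 1) (hL : ∀ k, FormBound (L k) (β * κ ^ k)) (V : M.CovSpace) :
    ‖M.lagMap n L V‖ ≤ Real.sqrt 2 * (β / (1 - κ)) * ‖V‖ := by
  rw [lagMap, LinearMap.sum_apply]
  calc _ ≤ ∑ k ∈ Finset.range n, Real.sqrt 2 * (β * κ ^ k) * ‖V‖ := by
        refine (norm_sum_le _ _).trans (Finset.sum_le_sum fun k _ => ?_)
        refine norm_seqMap_le _ (by positivity) (fun t => ?_) ?_ V
        · split_ifs
          · exact hL k
          · exact formBound_zero (by positivity)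
        · intro t ht t' ht' htt
          simp only [Set.mem_ofPred_eq, ne_eq, ite_eq_right_iff, Classical.not_imp] at ht ht'
          ext; simp only at htt; omega
    _ = Real.sqrt 2 * (β * ∑ k ∈ Finset.range n, κ ^ k) * ‖V‖ := by
        rw [← Finset.sum_mul, ← Finset.mul_sum, ← Finset.mul_sum]
    _ ≤ _ := by
        have := sum_pow_le_inv hκ hκ1 n
        rw [div_eq_mul_inv]
        gcongr

theorem lagMap_apply (n : ℕ) (L : ℕ → (Fin M.N₁ → Fin M.N₂ → ℝ) →ₗ[ℝ] ℝ) (V : M.CovSpace)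
    (t : Fin n) :
    M.lagMap n L V t = ∑ k ∈ Finset.range t, L k (M.covMat 1 ((t : ℕ) - k) V) := by
  have hsub : Finset.range t ⊆ Finset.range n := Finset.range_subset_range.2 t.2.le
  rw [lagMap, LinearMap.sum_apply, WithLp.ofLp_sum, Finset.sum_apply, ← Finset.sum_subset hsub]
  · refine Finset.sum_congr rfl fun k hk => ?_
    rw [seqMap_apply, if_pos (Finset.mem_range.1 hk)]
  · intro k _ hk
    rw [seqMap_apply, if_neg (by simpa using hk)]; rfl

variable {R τ c K κ C : ℝ} {σ : ℝ≥0}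

theorem covMat_projCov (η₁ : Fin 2 → Fin M.N₁ → EuclideanSpace ℝ (Fin M.p₁))
    (η₂ : Fin 2 → Fin M.N₂ → EuclideanSpace ℝ (Fin M.p₂)) (r : Fin 2) {s : ℕ} (hs : s ≤ M.T)
    (ω : M.Ω) (i : Fin M.N₁) (j : Fin M.N₂) :
    M.covMat r s (M.projCov η₁ η₂ ω) i j =
      ∑ k, M.X s ω i k * η₁ r i k + ∑ k, M.Z s ω j k * η₂ r j k := by
  simp [covMat, covAt, projCov, hs]

/-- Concentration of norms of linear images of the projected covariates. -/
theorem Regular.norm_concentration (h : M.Regular R τ c K κ C σ)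
    {η₁ : Fin 2 → Fin M.N₁ → EuclideanSpace ℝ (Fin M.p₁)}
    {η₂ : Fin 2 → Fin M.N₂ → EuclideanSpace ℝ (Fin M.p₂)}
    (h1 : ∀ r i, ‖η₁ r i‖ ≤ c) (h2 : ∀ r j, ‖η₂ r j‖ ≤ c)
    {F : Type*} [NormedAddCommGroup F] [NormedSpace ℝ F] (A : M.CovSpace →ₗ[ℝ] F) {Λ : ℝ}
    (hΛ : 0 < Λ) (hA : ∀ V, ‖A V‖ ≤ Λ * ‖V‖) :
    MemLp (fun ω => ‖A (M.projCov η₁ η₂ ω)‖) 2 M.μ ∧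
    ∫ ω, (‖A (M.projCov η₁ η₂ ω)‖ - ∫ ω', ‖A (M.projCov η₁ η₂ ω')‖ ∂M.μ) ^ 2 ∂M.μ ≤
      2 * (K * Λ) ^ 2 ∧
    ∀ s : ℝ, 0 < s → M.μ.real {ω | s ≤ |‖A (M.projCov η₁ η₂ ω)‖ -
      ∫ ω', ‖A (M.projCov η₁ η₂ ω')‖ ∂M.μ|} ≤ 2 * Real.exp (-(s ^ 2 / (K * Λ) ^ 2)) := by
  have := h.prob
  have hcc := h.cov.2.2 η₁ η₂ h1 h2
  have hconv : ConvexOn ℝ Set.univ fun V => ‖A V‖ := by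
    have := (convexOn_norm (convex_univ (𝕜 := ℝ) (E := F))).comp_linearMap A
    simpa [Function.comp_def] using this
  have hLip : LipschitzWith Λ.toNNReal fun V => ‖A V‖ := by
    refine LipschitzWith.of_dist_le_mul fun V W => ?_
    rw [Real.coe_toNNReal _ hΛ.le, Real.dist_eq, dist_eq_norm]
    refine (abs_norm_sub_norm_le _ _).trans ?_
    rw [← map_sub]; exact hA _
  have := hcc.of_lipschitz h.K_pos hconv (Real.toNNReal_pos.2 hΛ) hLip
  rw [Real.coe_toNNReal _ hΛ.le] at this
  have h4 := integral_sq_le_of_tail this.1 (mul_pos h.K_pos hΛ) this.2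
  exact ⟨h4.1, h4.2, this.2⟩

/-- Concentration of linear functionals of the projected covariates. -/
theorem Regular.linear_concentration (h : M.Regular R τ c K κ C σ)
    {η₁ : Fin 2 → Fin M.N₁ → EuclideanSpace ℝ (Fin M.p₁)}
    {η₂ : Fin 2 → Fin M.N₂ → EuclideanSpace ℝ (Fin M.p₂)}
    (h1 : ∀ r i, ‖η₁ r i‖ ≤ c) (h2 : ∀ r j, ‖η₂ r j‖ ≤ c)
    (A : M.CovSpace →ₗ[ℝ] ℝ) {Λ : ℝ} (hΛ : 0 < Λ) (hA : ∀ V, |A V| ≤ Λ * ‖V‖)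
    (hmean : ∫ ω, A (M.projCov η₁ η₂ ω) ∂M.μ = 0) :
    MemLp (fun ω => A (M.projCov η₁ η₂ ω)) 2 M.μ ∧
    ∫ ω, A (M.projCov η₁ η₂ ω) ^ 2 ∂M.μ ≤ 2 * (K * Λ) ^ 2 ∧
    ∀ s : ℝ, 0 < s → M.μ.real {ω | s ≤ |A (M.projCov η₁ η₂ ω)|} ≤
      2 * Real.exp (-(s ^ 2 / (K * Λ) ^ 2)) := by
  have := h.prob
  have hcc := h.cov.2.2 η₁ η₂ h1 h2
  have hconv : ConvexOn ℝ Set.univ fun V => A V := A.convexOn convex_univ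
  have hLip : LipschitzWith Λ.toNNReal fun V => A V := by
    refine LipschitzWith.of_dist_le_mul fun V W => ?_
    rw [Real.coe_toNNReal _ hΛ.le, Real.dist_eq, dist_eq_norm, ← map_sub]
    exact hA _
  have := hcc.of_lipschitz h.K_pos hconv (Real.toNNReal_pos.2 hΛ) hLip
  rw [Real.coe_toNNReal _ hΛ.le] at this
  have h4 := integral_sq_le_of_tail this.1 (mul_pos h.K_pos hΛ) this.2
  simp only [hmean, sub_zero] at h4 this
  exact ⟨h4.1, h4.2, this.2⟩

section Stationary

theorem Regular.ident (h : M.Regular R τ c K κ C σ) (s : ℤ)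
    {G : (ℤ → (Fin M.N₁ → Fin M.N₂ → ℝ) × (Fin M.N₁ → Fin M.p₁ → ℝ) × (Fin M.N₂ → Fin M.p₂ → ℝ)) → ℝ}
    (hG : Measurable G) :
    IdentDistrib (fun ω => G fun t => (M.Y t ω, M.X t ω, M.Z t ω))
      (fun ω => G fun t => (M.Y (t + s) ω, M.X (t + s) ω, M.Z (t + s) ω)) M.μ M.μ :=
  (h.stat s).comp hG

theorem Regular.measurable_regressor (h : M.Regular R τ c K κ C σ) (i : Fin M.N₁) (j : Fin M.N₂)
    (t : ℤ) (a : M.RegIdx) : Measurable fun ω => M.regressor i j t ω a := by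
  have hY : ∀ i j, Measurable fun ω => M.Y (t - 1) ω i j := fun i j =>
    measurable_pi_iff.1 (measurable_pi_iff.1 (h.measurable_Y (t - 1)) i) j
  have hX : ∀ i k, Measurable fun ω => M.X t ω i k := fun i k =>
    measurable_pi_iff.1 (measurable_pi_iff.1 (h.measurable_X t) i) k
  have hZ : ∀ j k, Measurable fun ω => M.Z t ω j k := fun j k =>
    measurable_pi_iff.1 (measurable_pi_iff.1 (h.measurable_Z t) j) k
  rcases a with _ | k | _ | k | _
  · simp only [regressor, Sum.elim_inl, rowNet]; fun_prop
  · simpa only [regressor, Sum.elim_inl, Sum.elim_inr] using hX i k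
  · simp only [regressor, Sum.elim_inl, Sum.elim_inr, colNet]; fun_prop
  · simpa only [regressor, Sum.elim_inl, Sum.elim_inr] using hZ j k
  · simpa only [regressor, Sum.elim_inr] using hY i j

/-- Square integrability is hidden in the eigenvalue hypothesis: a diagonal entry of `Sig` is at
least τ > 0, whereas the Bochner integral of a non-integrable function is 0. -/
theorem Regular.memLp_regressor (h : M.Regular R τ c K κ C σ) (i : Fin M.N₁) (j : Fin M.N₂)
    (t : ℤ) (a : M.RegIdx) : MemLp (fun ω => M.regressor i j t ω a) 2 M.μ := by
  have hd := (h.convex i j t).diag_nonneg (i := a)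
  simp only [Matrix.sub_apply, Matrix.smul_apply, Matrix.one_apply_eq, smul_eq_mul, mul_one] at hd
  have h1 : ∫ ω, M.regressor i j t ω a * M.regressor i j t ω a ∂M.μ ≠ 0 := by
    have := h.τ_pos
    intro h0
    change 0 ≤ (∫ ω, M.regressor i j t ω a * M.regressor i j t ω a ∂M.μ) - τ at hd
    linarith
  have h2 : Integrable (fun ω => M.regressor i j t ω a * M.regressor i j t ω a) M.μ :=
    not_imp_comm.1 integral_undef h1
  rw [memLp_two_iff_integrable_sq (h.measurable_regressor i j t a).aestronglyMeasurable]
  exact h2.congr (ae_of_all _ fun ω => by ring)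

theorem Regular.memLp_X (h : M.Regular R τ c K κ C σ) (t : ℤ) (i : Fin M.N₁) (k : Fin M.p₁) :
    MemLp (fun ω => M.X t ω i k) 2 M.μ :=
  h.memLp_regressor i ⟨0, h.N₂_pos⟩ t (M.ixX k)

theorem Regular.memLp_Z (h : M.Regular R τ c K κ C σ) (t : ℤ) (j : Fin M.N₂) (k : Fin M.p₂) :
    MemLp (fun ω => M.Z t ω j k) 2 M.μ :=
  h.memLp_regressor ⟨0, h.N₁_pos⟩ j t (M.ixZ k)

theorem Regular.memLp_proj (h : M.Regular R τ c K κ C σ) (v : M.RegIdx → ℝ) (i : Fin M.N₁)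
    (j : Fin M.N₂) (t : ℤ) : MemLp (M.proj v i j t) 2 M.μ :=
  memLp_finsetSum _ fun a _ => (h.memLp_regressor i j t a).const_mul (v a)

theorem Regular.memLp_covPart (h : M.Regular R τ c K κ C σ) (t : ℤ) (i : Fin M.N₁) (j : Fin M.N₂) :
    MemLp (fun ω => M.covPart t ω i j) 2 M.μ := by
  refine MemLp.add (memLp_finsetSum _ fun k _ => ?_) (memLp_finsetSum _ fun k _ => ?_)
  · exact (h.memLp_X t i k).mul_const _
  · exact (h.memLp_Z t j k).mul_const _

/-- A linear form in the covariates at one time is centered. -/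
theorem Regular.integral_cov (h : M.Regular R τ c K κ C σ) (t : ℤ) (i : Fin M.N₁) (j : Fin M.N₂)
    (a : Fin M.p₁ → ℝ) (b : Fin M.p₂ → ℝ) :
    ∫ ω, (∑ k, M.X t ω i k * a k + ∑ k, M.Z t ω j k * b k) ∂M.μ = 0 := by
  have := h.prob
  have hX : ∀ k, Integrable (fun ω => M.X t ω i k * a k) M.μ := fun k =>
    ((h.memLp_X t i k).integrable (by norm_num)).mul_const _
  have hZ : ∀ k, Integrable (fun ω => M.Z t ω j k * b k) M.μ := fun k =>
    ((h.memLp_Z t j k).integrable (by norm_num)).mul_const _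
  rw [integral_add (integrable_finsetSum _ fun k _ => hX k) (integrable_finsetSum _ fun k _ => hZ k),
    integral_finsetSum _ fun k _ => hX k, integral_finsetSum _ fun k _ => hZ k]
  simp_rw [integral_mul_const, h.cov.1, h.cov.2.1]
  simp

theorem Regular.integral_form_covPart (h : M.Regular R τ c K κ C σ)
    (L : (Fin M.N₁ → Fin M.N₂ → ℝ) →ₗ[ℝ] ℝ) (t : ℤ) :
    Integrable (fun ω => L (M.covPart t ω)) M.μ ∧ ∫ ω, L (M.covPart t ω) ∂M.μ = 0 := by
  have := h.prob
  have hi : ∀ p : Fin M.N₁ × Fin M.N₂,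
      Integrable (fun ω => formCoef L p.1 p.2 * M.covPart t ω p.1 p.2) M.μ := fun p =>
    ((h.memLp_covPart t p.1 p.2).integrable (by norm_num)).const_mul _
  simp_rw [form_eq_sum L]
  refine ⟨integrable_finsetSum _ fun p _ => hi p, ?_⟩
  rw [integral_finsetSum _ fun p _ => hi p]
  refine Finset.sum_eq_zero fun p _ => ?_
  rw [integral_const_mul]
  have : ∫ ω, M.covPart t ω p.1 p.2 ∂M.μ = 0 := h.integral_cov t p.1 p.2 _ _
  rw [this, mul_zero]

end Stationary

end GMNAR

/-! ### Second moments of responses and regressors. -/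

theorem ProbabilityTheory.HasSubgaussianMGF.integral_sq_le {Ω : Type*} [MeasurableSpace Ω]
    {μ : Measure Ω} [IsProbabilityMeasure μ] {X : Ω → ℝ} {s : ℝ≥0} (h : HasSubgaussianMGF X s μ)
    (hs : 0 < s) : ∫ ω, X ω ^ 2 ∂μ ≤ 8 * s := by
  have hs' : (0 : ℝ) < s := by exact_mod_cast hs
  have i4 : Integrable (fun ω => X ω ^ 4) μ := by
    have := (h.memLp 4).integrable_norm_pow (p := 4) (by norm_num)
    refine this.congr (ae_of_all _ fun ω => ?_)
    simp [Real.norm_eq_abs, Even.pow_abs (show Even 4 by decide)]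
  have h4 := h.integral_pow_four_le hs
  calc ∫ ω, X ω ^ 2 ∂μ ≤ ∫ ω, (1 / (16 * s) * X ω ^ 4 + 4 * s) ∂μ := by
        refine integral_mono ((h.memLp 2).integrable_sq) ((i4.const_mul _).add
          (integrable_const _)) fun ω => ?_
        have e : 1 / (16 * s) * X ω ^ 4 + 4 * s - X ω ^ 2 =
          1 / (16 * s) * (X ω ^ 2 - 8 * s) ^ 2 := by field_simp; ring
        have : 0 ≤ 1 / (16 * (s : ℝ)) * (X ω ^ 2 - 8 * s) ^ 2 := by positivity
        simp only
        linarith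
    _ = 1 / (16 * s) * ∫ ω, X ω ^ 4 ∂μ + 4 * s := by
        rw [integral_add (i4.const_mul _) (integrable_const _), integral_const_mul]; simp
    _ ≤ 1 / (16 * s) * (64 * s ^ 2) + 4 * s := by gcongr
    _ = 8 * s := by field_simp; norm_num

namespace GMNAR

variable {M : GMNAR} {R τ c K κ C : ℝ} {σ : ℝ≥0}

theorem Regular.m_ge : (3 : ℝ) ≤ M.m := by
  have : 3 ≤ M.m := by unfold m; omega
  exact_mod_cast this

theorem norm_smul_toLp_le {n : ℕ} {a : Fin n → ℝ} {ρ c : ℝ} (hc : 0 < c) (hρ : 0 < ρ)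
    (ha : ∑ k, a k ^ 2 ≤ ρ ^ 2) : ‖(c / ρ) • (WithLp.toLp 2 a : EuclideanSpace ℝ (Fin n))‖ ≤ c := by
  rw [norm_smul, Real.norm_of_nonneg (by positivity), EuclideanSpace.norm_eq]
  have : Real.sqrt (∑ k, ‖a k‖ ^ 2) ≤ ρ := by
    rw [Real.sqrt_le_left hρ.le]; simpa using ha
  calc c / ρ * Real.sqrt (∑ k, ‖a k‖ ^ 2) ≤ c / ρ * ρ := by gcongr
    _ = c := by field_simp

/-- Stationarity moves t to time 0, inside the window of the concentration hypothesis. Rescaling the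
directions to length c gives a linear functional with Lipschitz constant √2 ρ/c. -/
theorem Regular.integral_cov_sq_le (h : M.Regular R τ c K κ C σ) (t : ℤ) (i : Fin M.N₁)
    (j : Fin M.N₂) {a : Fin M.p₁ → ℝ} {b : Fin M.p₂ → ℝ} {ρ : ℝ} (hρ : 0 < ρ)
    (ha : ∑ k, a k ^ 2 ≤ ρ ^ 2) (hb : ∑ k, b k ^ 2 ≤ ρ ^ 2) :
    ∫ ω, (∑ k, M.X t ω i k * a k + ∑ k, M.Z t ω j k * b k) ^ 2 ∂M.μ ≤
      4 * K ^ 2 / c ^ 2 * ρ ^ 2 := by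
  have hc := h.c_pos
  have h1 := (h.ident t (G := fun p => (∑ k, (p 0).2.1 i k * a k + ∑ k, (p 0).2.2 j k * b k) ^ 2)
    (by fun_prop)).integral_eq
  simp only [zero_add] at h1
  rw [← h1]
  set η₁ : Fin 2 → Fin M.N₁ → EuclideanSpace ℝ (Fin M.p₁) := fun _ _ => (c / ρ) • WithLp.toLp 2 a
  set η₂ : Fin 2 → Fin M.N₂ → EuclideanSpace ℝ (Fin M.p₂) := fun _ _ => (c / ρ) • WithLp.toLp 2 b
  set A : M.CovSpace →ₗ[ℝ] ℝ := (ρ / c) • (entryForm i j ∘ₗ M.covMat 0 0) with hA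
  have hAV : ∀ ω, A (M.projCov η₁ η₂ ω) =
      ∑ k, M.X 0 ω i k * a k + ∑ k, M.Z 0 ω j k * b k := by
    intro ω
    have e : A (M.projCov η₁ η₂ ω) = ρ / c * M.covMat 0 0 (M.projCov η₁ η₂ ω) i j := rfl
    rw [e, covMat_projCov _ _ _ (Nat.zero_le _), mul_add, Finset.mul_sum, Finset.mul_sum]
    congr 1
    · refine Finset.sum_congr rfl fun k _ => ?_
      simp only [η₁, PiLp.smul_apply, smul_eq_mul, Nat.cast_zero]
      field_simp
    · refine Finset.sum_congr rfl fun k _ => ?_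
      simp only [η₂, PiLp.smul_apply, smul_eq_mul, Nat.cast_zero]
      field_simp
  have hbound : ∀ V, |A V| ≤ ρ / c * Real.sqrt 2 * ‖V‖ := by
    intro V
    have e : A V = ρ / c * M.covMat 0 0 V i j := rfl
    rw [e, abs_mul, abs_of_pos (by positivity), mul_assoc]
    gcongr
    have h3 := covMat_sq_le 0 0 V i j
    have h4 : ∑ x, M.covAt 0 0 x V ^ 2 ≤ ‖V‖ ^ 2 := by
      refine le_trans ?_ (sum_covAt_sq_le 0 V)
      exact Finset.single_le_sum (f := fun s => ∑ x, M.covAt 0 s x V ^ 2)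
        (fun _ _ => Finset.sum_nonneg fun _ _ => sq_nonneg _) (by simp)
    refine (Real.abs_le_sqrt (h3.trans (mul_le_mul_of_nonneg_left h4 (by norm_num)))).trans ?_
    rw [Real.sqrt_mul (by norm_num), Real.sqrt_sq (norm_nonneg _)]
  have := (h.linear_concentration (η₁ := η₁) (η₂ := η₂)
    (fun _ _ => norm_smul_toLp_le hc hρ ha) (fun _ _ => norm_smul_toLp_le hc hρ hb) A
    (Λ := ρ / c * Real.sqrt 2) (by positivity) hbound
    (by simp_rw [hAV]; exact h.integral_cov 0 i j a b)).2.1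
  simp_rw [hAV] at this
  refine this.trans (le_of_eq ?_)
  rw [mul_pow, mul_pow, Real.sq_sqrt (by norm_num)]
  field_simp; ring

theorem sum_sq_lt_of_coordsIn {n : ℕ} {a : Fin n → ℝ} {R : ℝ} {N : ℝ} (ha : ∀ k, a k ∈ Set.Ioo (-R) R)
    (hn : (n : ℝ) ≤ N) : ∑ k, a k ^ 2 ≤ (R * Real.sqrt N) ^ 2 := by
  have hN : 0 ≤ N := (Nat.cast_nonneg n).trans hn
  rw [mul_pow, Real.sq_sqrt hN]
  calc ∑ k, a k ^ 2 ≤ ∑ _k : Fin n, R ^ 2 := by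
        refine Finset.sum_le_sum fun k _ => sq_le_sq' (ha k).1.le (ha k).2.le
    _ = n * R ^ 2 := by simp
    _ ≤ R ^ 2 * N := by rw [mul_comm]; gcongr

theorem Regular.zeta_sq_le (h : M.Regular R τ c K κ C σ) (g : Fin M.G) :
    ∑ k, M.θ₀.zeta g k ^ 2 ≤ (R * Real.sqrt M.m) ^ 2 :=
  sum_sq_lt_of_coordsIn (fun k => h.param.2.1 g k) (by
    exact_mod_cast (show M.p₁ ≤ M.m by unfold m; omega))

theorem Regular.delta_sq_le (h : M.Regular R τ c K κ C σ) (g : Fin M.H) :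
    ∑ k, M.θ₀.delta g k ^ 2 ≤ (R * Real.sqrt M.m) ^ 2 :=
  sum_sq_lt_of_coordsIn (fun k => h.param.2.2.2.1 g k) (by
    exact_mod_cast (show M.p₂ ≤ M.m by unfold m; omega))

theorem Regular.sqrt_m_pos : 0 < Real.sqrt M.m := Real.sqrt_pos.2 (by linarith [m_ge (M := M)])

theorem Regular.integral_covPart_sq_le (h : M.Regular R τ c K κ C σ) (t : ℤ) (i : Fin M.N₁)
    (j : Fin M.N₂) : ∫ ω, M.covPart t ω i j ^ 2 ∂M.μ ≤ 4 * K ^ 2 / c ^ 2 * (R ^ 2 * M.m) := by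
  have := h.integral_cov_sq_le t i j (mul_pos h.R_pos sqrt_m_pos) (h.zeta_sq_le (M.g₀ i))
    (h.delta_sq_le (M.h₀ j))
  rw [mul_pow, Real.sq_sqrt (Nat.cast_nonneg _)] at this
  exact this

/-- Bound for the variance of the response per regressor dimension. -/
noncomputable def varBound (R c K κ C : ℝ) (σ : ℝ≥0) : ℝ :=
  2 * C ^ 2 * (8 * K ^ 2 * R ^ 2 / c ^ 2 + 16 * σ ^ 2) / (1 - κ) ^ 2

theorem Regular.varBound_pos (h : M.Regular R τ c K κ C σ) : 0 < varBound R c K κ C σ := by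
  have h1 : 0 < 1 - κ := by linarith [h.κ_lt]
  have h2 : 0 < C := by linarith [h.C_ge]
  have h3 := h.K_pos; have h4 := h.R_pos; have h5 := h.c_pos
  have h6 : (0 : ℝ) < σ := by exact_mod_cast h.σ_pos
  unfold varBound; positivity

/-- The response is expanded over t steps, with Cauchy–Schwarz weights κ ^ k on the lags. By
stationarity the left side does not depend on t, so t → ∞ removes the initial term, whose second
moment is finite but not uniformly bounded in the model a priori. -/
theorem Regular.integral_Y_sq_le (h : M.Regular R τ c K κ C σ) (t : ℤ) (i : Fin M.N₁)
    (j : Fin M.N₂) : ∫ ω, M.Y t ω i j ^ 2 ∂M.μ ≤ varBound R c K κ C σ * M.m := by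
  have := h.prob
  have hκ : 0 < κ := by linarith [h.κ_ge]
  have hκ1 : 0 < 1 - κ := by linarith [h.κ_lt]
  have hC : 0 < C := by linarith [h.C_ge]
  have hm := m_ge (M := M)
  have hstat : ∀ t : ℤ, ∫ ω, M.Y t ω i j ^ 2 ∂M.μ = ∫ ω, M.Y 0 ω i j ^ 2 ∂M.μ := by
    intro t
    have := (h.ident t (G := fun p => (p 0).1 i j ^ 2) (by fun_prop)).integral_eq
    simpa using this.symm
  rw [hstat]
  set Dw : ℝ := (8 * K ^ 2 * R ^ 2 / c ^ 2 + 16 * σ ^ 2) * M.m with hDw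
  have hDw0 : 0 ≤ Dw := by have := h.c_pos; positivity
  have hE : ∀ s i j, MemLp (fun ω => M.E s ω i j) 2 M.μ := fun s i j => (h.noise.2.2.2.1 i j s).memLp 2
  have hw : ∀ s i j, MemLp (fun ω => (M.covPart s ω + M.E s ω) i j) 2 M.μ := fun s i j =>
    (h.memLp_covPart s i j).add (hE s i j)
  have hwD : ∀ s i j, ∫ ω, (M.covPart s ω + M.E s ω) i j ^ 2 ∂M.μ ≤ Dw := by
    intro s i j
    have h1 := h.integral_covPart_sq_le s i j
    have h2 := (h.noise.2.2.2.1 i j s).integral_sq_le (pow_pos h.σ_pos 2)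
    calc ∫ ω, (M.covPart s ω + M.E s ω) i j ^ 2 ∂M.μ
        ≤ ∫ ω, (2 * M.covPart s ω i j ^ 2 + 2 * M.E s ω i j ^ 2) ∂M.μ := by
          refine integral_mono (hw s i j).integrable_sq
            (((h.memLp_covPart s i j).integrable_sq.const_mul 2).add
              ((hE s i j).integrable_sq.const_mul 2)) fun ω => ?_
          simp only [Pi.add_apply]
          nlinarith [sq_nonneg (M.covPart s ω i j - M.E s ω i j)]
      _ = 2 * ∫ ω, M.covPart s ω i j ^ 2 ∂M.μ + 2 * ∫ ω, M.E s ω i j ^ 2 ∂M.μ := by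
          rw [integral_add ((h.memLp_covPart s i j).integrable_sq.const_mul 2)
            ((hE s i j).integrable_sq.const_mul 2), integral_const_mul, integral_const_mul]
      _ ≤ 2 * (4 * K ^ 2 / c ^ 2 * (R ^ 2 * M.m)) + 2 * (8 * ((σ ^ 2 : ℝ≥0) : ℝ)) := by gcongr
      _ ≤ Dw := by
          push_cast
          have e1 : 2 * (4 * K ^ 2 / c ^ 2 * (R ^ 2 * M.m)) = 8 * K ^ 2 * R ^ 2 / c ^ 2 * M.m := by ring
          have e2 : 2 * (8 * (σ : ℝ) ^ 2) ≤ 16 * σ ^ 2 * M.m := by nlinarith [sq_nonneg (σ : ℝ)]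
          rw [e1, hDw, add_mul]; linarith
  set D0 : ℝ := ∑ i, ∑ j, ∫ ω, M.Y 0 ω i j ^ 2 ∂M.μ with hD0
  have hD0' : ∀ i j, ∫ ω, M.Y 0 ω i j ^ 2 ∂M.μ ≤ D0 := fun i j => by
    have hnn : ∀ i j, 0 ≤ ∫ ω, M.Y 0 ω i j ^ 2 ∂M.μ := fun i j =>
      integral_nonneg fun _ => sq_nonneg _
    refine le_trans (Finset.single_le_sum (f := fun j => ∫ ω, M.Y 0 ω i j ^ 2 ∂M.μ)
      (fun j _ => hnn i j) (Finset.mem_univ j)) ?_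
    exact Finset.single_le_sum (f := fun i => ∑ j, ∫ ω, M.Y 0 ω i j ^ 2 ∂M.μ)
      (fun i _ => Finset.sum_nonneg fun j _ => hnn i j) (Finset.mem_univ i)
  have hD00 : 0 ≤ D0 := (integral_nonneg fun _ => sq_nonneg _).trans (hD0' i j)
  set L : ℕ → (Fin M.N₁ → Fin M.N₂ → ℝ) →ₗ[ℝ] ℝ := fun k => entryForm i j ∘ₗ (M.stepLin ^ k) with hL
  have hLb : ∀ k, FormBound (L k) (1 * C * κ ^ k) := fun k => h.comp_pow_bound (entryForm_bound i j) k
  have hstep : ∀ t : ℕ, ∫ ω, M.Y 0 ω i j ^ 2 ∂M.μ ≤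
      2 * ((1 * C * κ ^ t) ^ 2 * D0) + 2 * ((1 - κ)⁻¹ * (C ^ 2 * Dw * (1 - κ)⁻¹)) := by
    intro t
    have h0 := (hLb t).integral_sq_le (fun i j => h.sqInt 0 i j) hD0' hD00
    have hk := fun k : ℕ => (hLb k).integral_sq_le (W := fun ω => M.covPart ((t : ℤ) - k) ω +
      M.E ((t : ℤ) - k) ω) (fun i j => hw _ i j) (fun i j => hwD _ i j) hDw0
    have ik : ∀ k : ℕ, Integrable (fun ω => L k (M.covPart ((t : ℤ) - k) ω +
        M.E ((t : ℤ) - k) ω) ^ 2 / κ ^ k) M.μ := fun k => ((hk k).1.integrable_sq).div_const _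
    have isum := (integrable_finsetSum (Finset.range t) fun k _ => ik k).const_mul (1 - κ)⁻¹
    rw [← hstat t]
    calc ∫ ω, M.Y t ω i j ^ 2 ∂M.μ
        ≤ ∫ ω, (2 * L t (M.Y 0 ω) ^ 2 + 2 * ((1 - κ)⁻¹ * ∑ k ∈ Finset.range t,
            L k (M.covPart ((t : ℤ) - k) ω + M.E ((t : ℤ) - k) ω) ^ 2 / κ ^ k)) ∂M.μ := by
          refine integral_mono_ae (h.sqInt t i j).integrable_sq
            ((h0.1.integrable_sq.const_mul 2).add (isum.const_mul 2)) ?_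
          filter_upwards [h.ae_expand] with ω hω
          have e1 : M.Y t ω i j = L t (M.Y 0 ω) + ∑ k ∈ Finset.range t,
              L k (M.covPart ((t : ℤ) - k) ω + M.E ((t : ℤ) - k) ω) := by
            rw [hω t]
            simp only [Pi.add_apply, Finset.sum_apply, hL, LinearMap.comp_apply]; rfl
          have hCS : (∑ k ∈ Finset.range t,
              L k (M.covPart ((t : ℤ) - k) ω + M.E ((t : ℤ) - k) ω)) ^ 2 ≤
              (1 - κ)⁻¹ * ∑ k ∈ Finset.range t,
              L k (M.covPart ((t : ℤ) - k) ω + M.E ((t : ℤ) - k) ω) ^ 2 / κ ^ k := by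
            refine le_trans (Finset.sum_sq_le_sum_mul_sum_of_sq_le_mul (Finset.range t)
              (f := fun k => κ ^ k) (g := fun k => L k (M.covPart ((t : ℤ) - k) ω +
                M.E ((t : ℤ) - k) ω) ^ 2 / κ ^ k) (fun k _ => by positivity)
              (fun k _ => by positivity) (fun k _ => le_of_eq (by field_simp))) ?_
            refine mul_le_mul_of_nonneg_right (sum_pow_le_inv hκ.le h.κ_lt t) ?_
            exact Finset.sum_nonneg fun k _ => by positivity
          simp only [e1]
          nlinarith [sq_nonneg (L t (M.Y 0 ω) - ∑ k ∈ Finset.range t,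
              L k (M.covPart ((t : ℤ) - k) ω + M.E ((t : ℤ) - k) ω))]
      _ = 2 * ∫ ω, L t (M.Y 0 ω) ^ 2 ∂M.μ + 2 * ((1 - κ)⁻¹ * ∑ k ∈ Finset.range t,
            (∫ ω, L k (M.covPart ((t : ℤ) - k) ω + M.E ((t : ℤ) - k) ω) ^ 2 ∂M.μ) / κ ^ k) := by
          rw [integral_add (h0.1.integrable_sq.const_mul 2) (isum.const_mul 2),
            integral_const_mul, integral_const_mul, integral_const_mul,
            integral_finsetSum _ fun k _ => ik k]
          simp_rw [integral_div]
      _ ≤ 2 * ((1 * C * κ ^ t) ^ 2 * D0) + 2 * ((1 - κ)⁻¹ * ∑ k ∈ Finset.range t,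
            ((1 * C * κ ^ k) ^ 2 * Dw) / κ ^ k) := by
          gcongr with k _
          · exact h0.2
          · exact (hk k).2
      _ ≤ _ := by
          have e2 : ∀ k : ℕ, ((1 * C * κ ^ k) ^ 2 * Dw) / κ ^ k = C ^ 2 * Dw * κ ^ k := fun k => by
            field_simp
          simp only [e2, ← Finset.mul_sum]
          have := sum_pow_le_inv hκ.le h.κ_lt t
          gcongr
  have hlim : Tendsto (fun t : ℕ => 2 * ((1 * C * κ ^ t) ^ 2 * D0) +
      2 * ((1 - κ)⁻¹ * (C ^ 2 * Dw * (1 - κ)⁻¹))) atTop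
      (𝓝 (2 * ((1 * C * 0) ^ 2 * D0) + 2 * ((1 - κ)⁻¹ * (C ^ 2 * Dw * (1 - κ)⁻¹)))) := by
    have := tendsto_pow_atTop_nhds_zero_of_lt_one hκ.le h.κ_lt
    exact (((((this.const_mul (1 * C)).pow 2).mul_const D0).const_mul 2).add_const _)
  refine (ge_of_tendsto' hlim hstep).trans (le_of_eq ?_)
  rw [hDw, varBound]
  field_simp
  ring

/-- The factor m enters through the variance of the response, which is driven by coefficient vectors
of length up to R√m. -/
theorem Regular.integral_proj_sq_le (h : M.Regular R τ c K κ C σ) (v : M.RegIdx → ℝ)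
    (i : Fin M.N₁) (j : Fin M.N₂) (t : ℤ) :
    ∫ ω, M.proj v i j t ω ^ 2 ∂M.μ ≤
      (6 * varBound R c K κ C σ + 8 * K ^ 2 / c ^ 2) * M.m * ∑ a, v a ^ 2 := by
  have hm := m_ge (M := M)
  have hc := h.c_pos
  have hV := h.varBound_pos
  rcases (Finset.sum_nonneg fun a _ => sq_nonneg (v a) : 0 ≤ ∑ a, v a ^ 2).eq_or_lt with h0 | h0
  · have hv : ∀ a, v a = 0 := fun a => by
      have := (Finset.sum_eq_zero_iff_of_nonneg fun a _ => sq_nonneg (v a)).1 h0.symm a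
        (Finset.mem_univ a)
      exact pow_eq_zero_iff two_ne_zero |>.1 this
    have : ∀ ω, M.proj v i j t ω = 0 := fun ω => by simp [proj, hv]
    simp [this, ← h0]
  set s := ∑ a, v a ^ 2 with hs
  have hs' := hs
  rw [sum_regIdx] at hs'
  have hx0 : 0 ≤ ∑ k, v (M.ixX k) ^ 2 := Finset.sum_nonneg fun _ _ => sq_nonneg _
  have hz0 : 0 ≤ ∑ k, v (M.ixZ k) ^ 2 := Finset.sum_nonneg fun _ _ => sq_nonneg _
  have hlag := (h.lagForm_bound v i j).integral_sq_le (W := fun ω => M.Y (t - 1) ω)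
    (fun i j => h.sqInt _ i j) (fun i j => h.integral_Y_sq_le _ i j) (by positivity)
  have hB : (|v M.ixRow| + |v M.ixCol| + |v M.ixLag|) ^ 2 ≤ 3 * s := by
    have e1 := sq_abs (v M.ixRow); have e2 := sq_abs (v M.ixCol); have e3 := sq_abs (v M.ixLag)
    nlinarith [sq_nonneg (|v M.ixRow| - |v M.ixCol|), sq_nonneg (|v M.ixRow| - |v M.ixLag|),
      sq_nonneg (|v M.ixCol| - |v M.ixLag|)]
  have hcov := h.integral_cov_sq_le t i j (a := fun k => v (M.ixX k)) (b := fun k => v (M.ixZ k))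
    (ρ := Real.sqrt s) (Real.sqrt_pos.2 h0)
    (by rw [Real.sq_sqrt h0.le]; nlinarith [sq_nonneg (v M.ixRow), sq_nonneg (v M.ixCol),
          sq_nonneg (v M.ixLag)])
    (by rw [Real.sq_sqrt h0.le]; nlinarith [sq_nonneg (v M.ixRow), sq_nonneg (v M.ixCol),
          sq_nonneg (v M.ixLag)])
  rw [Real.sq_sqrt h0.le] at hcov
  have hcovL : MemLp (fun ω => ∑ k, M.X t ω i k * v (M.ixX k) + ∑ k, M.Z t ω j k * v (M.ixZ k)) 2
      M.μ := (memLp_finsetSum _ fun k _ => (h.memLp_X t i k).mul_const _).add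
        (memLp_finsetSum _ fun k _ => (h.memLp_Z t j k).mul_const _)
  calc ∫ ω, M.proj v i j t ω ^ 2 ∂M.μ
      ≤ ∫ ω, (2 * M.lagForm v i j (M.Y (t - 1) ω) ^ 2 +
          2 * (∑ k, M.X t ω i k * v (M.ixX k) + ∑ k, M.Z t ω j k * v (M.ixZ k)) ^ 2) ∂M.μ := by
        refine integral_mono (h.memLp_proj v i j t).integrable_sq
          ((hlag.1.integrable_sq.const_mul 2).add (hcovL.integrable_sq.const_mul 2)) fun ω => ?_
        simp only [proj_eq]
        nlinarith [sq_nonneg (M.lagForm v i j (M.Y (t - 1) ω) -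
          (∑ k, M.X t ω i k * v (M.ixX k) + ∑ k, M.Z t ω j k * v (M.ixZ k)))]
    _ = 2 * ∫ ω, M.lagForm v i j (M.Y (t - 1) ω) ^ 2 ∂M.μ +
          2 * ∫ ω, (∑ k, M.X t ω i k * v (M.ixX k) + ∑ k, M.Z t ω j k * v (M.ixZ k)) ^ 2 ∂M.μ := by
        rw [integral_add (hlag.1.integrable_sq.const_mul 2) (hcovL.integrable_sq.const_mul 2),
          integral_const_mul, integral_const_mul]
    _ ≤ 2 * (3 * s * (varBound R c K κ C σ * M.m)) + 2 * (4 * K ^ 2 / c ^ 2 * s) := by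
        gcongr
        exact hlag.2.trans (by gcongr)
    _ ≤ _ := by
        have : 8 * K ^ 2 / c ^ 2 * s ≤ 8 * K ^ 2 / c ^ 2 * s * M.m :=
          le_mul_of_one_le_right (by positivity) (by linarith)
        have e : 2 * (4 * K ^ 2 / c ^ 2 * s) = 8 * K ^ 2 / c ^ 2 * s := by ring
        rw [e]; linarith

/-- Second moments of projections are given by the second moment matrix. -/
theorem Regular.integral_proj_sq (h : M.Regular R τ c K κ C σ) (v : M.RegIdx → ℝ)
    (i : Fin M.N₁) (j : Fin M.N₂) (t : ℤ) :
    ∫ ω, M.proj v i j t ω ^ 2 ∂M.μ = v ⬝ᵥ (M.Sig i j t).mulVec v := by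
  have e : ∀ ω, M.proj v i j t ω ^ 2 = ∑ a, ∑ b, v a * v b *
      (M.regressor i j t ω a * M.regressor i j t ω b) := fun ω => by
    rw [pow_two, proj, Finset.sum_mul_sum]
    refine Finset.sum_congr rfl fun a _ => Finset.sum_congr rfl fun b _ => by ring
  have hi : ∀ a b, Integrable (fun ω => v a * v b *
      (M.regressor i j t ω a * M.regressor i j t ω b)) M.μ := fun a b =>
    ((h.memLp_regressor i j t a).integrable_mul (h.memLp_regressor i j t b)).const_mul _
  simp_rw [e]
  rw [integral_finsetSum _ fun a _ => integrable_finsetSum _ fun b _ => hi a b]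
  simp only [dotProduct, Matrix.mulVec, Finset.mul_sum]
  refine Finset.sum_congr rfl fun a _ => ?_
  rw [integral_finsetSum _ fun b _ => hi a b]
  refine Finset.sum_congr rfl fun b _ => ?_
  rw [integral_const_mul, Sig]; ring

theorem Regular.le_integral_proj_sq (h : M.Regular R τ c K κ C σ) (v : M.RegIdx → ℝ)
    (i : Fin M.N₁) (j : Fin M.N₂) (t : ℤ) :
    τ * ∑ a, v a ^ 2 ≤ ∫ ω, M.proj v i j t ω ^ 2 ∂M.μ := by
  have h1 := (h.convex i j t).dotProduct_mulVec_nonneg v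
  rw [h.integral_proj_sq]
  simp only [Matrix.sub_mulVec, Matrix.smul_mulVec, Matrix.one_mulVec, dotProduct_sub,
    dotProduct_smul, star_trivial, smul_eq_mul] at h1
  have : v ⬝ᵥ v = ∑ a, v a ^ 2 := by
    simp only [dotProduct, pow_two]
  rw [this] at h1
  linarith

theorem Regular.integral_proj_sq_shift (h : M.Regular R τ c K κ C σ) (v : M.RegIdx → ℝ)
    (i : Fin M.N₁) (j : Fin M.N₂) (t : ℤ) :
    ∫ ω, M.proj v i j t ω ^ 2 ∂M.μ = ∫ ω, M.proj v i j 1 ω ^ 2 ∂M.μ := by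
  have hG : Measurable fun p : ℤ → (Fin M.N₁ → Fin M.N₂ → ℝ) × (Fin M.N₁ → Fin M.p₁ → ℝ) ×
      (Fin M.N₂ → Fin M.p₂ → ℝ) => (M.lagForm v i j (p 0).1 +
        (∑ k, (p 1).2.1 i k * v (M.ixX k) + ∑ k, (p 1).2.2 j k * v (M.ixZ k))) ^ 2 := by
    have := measurable_form (M.lagForm v i j)
    fun_prop
  have := (h.ident (t - 1) hG).integral_eq
  simp only [proj_eq]
  rw [show (1 : ℤ) - 1 = 0 by norm_num, this]
  simp only [zero_add, show (1 : ℤ) + (t - 1) = t by ring]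

end GMNAR

/-! ### Tails of the response and of the empirical energy in one direction. -/

namespace GMNAR

variable {M : GMNAR} {R τ c K κ C : ℝ} {σ : ℝ≥0}

/-- Rescaled true row coefficients, of norm at most `c`. -/
noncomputable def dirRow (M : GMNAR) (R c ρ : ℝ) (a : Fin M.p₁ → ℝ) :
    Fin 2 → Fin M.N₁ → EuclideanSpace ℝ (Fin M.p₁) := fun r i =>
  if r = 0 then (c / ρ) • WithLp.toLp 2 a
  else (c / (R * Real.sqrt M.m)) • WithLp.toLp 2 (M.θ₀.zeta (M.g₀ i))

/-- Rescaled true column coefficients, of norm at most `c`. -/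
noncomputable def dirCol (M : GMNAR) (R c ρ : ℝ) (b : Fin M.p₂ → ℝ) :
    Fin 2 → Fin M.N₂ → EuclideanSpace ℝ (Fin M.p₂) := fun r j =>
  if r = 0 then (c / ρ) • WithLp.toLp 2 b
  else (c / (R * Real.sqrt M.m)) • WithLp.toLp 2 (M.θ₀.delta (M.h₀ j))

theorem Regular.norm_dirRow_le (h : M.Regular R τ c K κ C σ) {ρ : ℝ} (hρ : 0 < ρ)
    {a : Fin M.p₁ → ℝ} (ha : ∑ k, a k ^ 2 ≤ ρ ^ 2) (r : Fin 2) (i : Fin M.N₁) :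
    ‖M.dirRow R c ρ a r i‖ ≤ c := by
  unfold dirRow
  split_ifs
  · exact norm_smul_toLp_le h.c_pos hρ ha
  · exact norm_smul_toLp_le h.c_pos (mul_pos h.R_pos sqrt_m_pos) (h.zeta_sq_le _)

theorem Regular.norm_dirCol_le (h : M.Regular R τ c K κ C σ) {ρ : ℝ} (hρ : 0 < ρ)
    {b : Fin M.p₂ → ℝ} (hb : ∑ k, b k ^ 2 ≤ ρ ^ 2) (r : Fin 2) (j : Fin M.N₂) :
    ‖M.dirCol R c ρ b r j‖ ≤ c := by
  unfold dirCol
  split_ifs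
  · exact norm_smul_toLp_le h.c_pos hρ hb
  · exact norm_smul_toLp_le h.c_pos (mul_pos h.R_pos sqrt_m_pos) (h.delta_sq_le _)

theorem Regular.covMat_dir_one (h : M.Regular R τ c K κ C σ) {ρ : ℝ}
    (a : Fin M.p₁ → ℝ) (b : Fin M.p₂ → ℝ) {s : ℕ} (hs : s ≤ M.T) (ω : M.Ω) :
    (R * Real.sqrt M.m / c) • M.covMat 1 s (M.projCov (M.dirRow R c ρ a) (M.dirCol R c ρ b) ω) =
      M.covPart s ω := by
  have h1 := h.c_pos; have h2 := h.R_pos; have h3 := sqrt_m_pos (M := M)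
  ext i j
  rw [Pi.smul_apply, Pi.smul_apply, covMat_projCov _ _ _ hs, smul_eq_mul, mul_add, Finset.mul_sum,
    Finset.mul_sum, covPart]
  congr 1
  all_goals
    refine Finset.sum_congr rfl fun k _ => ?_
    simp only [dirRow, dirCol, one_ne_zero, if_false, PiLp.smul_apply, smul_eq_mul]
    field_simp

theorem Regular.covMat_dir_zero (h : M.Regular R τ c K κ C σ) {ρ : ℝ} (hρ : 0 < ρ)
    (a : Fin M.p₁ → ℝ) (b : Fin M.p₂ → ℝ) {s : ℕ} (hs : s ≤ M.T) (ω : M.Ω) (i : Fin M.N₁)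
    (j : Fin M.N₂) :
    ρ / c * M.covMat 0 s (M.projCov (M.dirRow R c ρ a) (M.dirCol R c ρ b) ω) i j =
      ∑ k, M.X s ω i k * a k + ∑ k, M.Z s ω j k * b k := by
  have h1 := h.c_pos
  rw [covMat_projCov _ _ _ hs, mul_add, Finset.mul_sum, Finset.mul_sum]
  congr 1
  all_goals
    refine Finset.sum_congr rfl fun k _ => ?_
    simp only [dirRow, dirCol, if_true, PiLp.smul_apply, smul_eq_mul]
    field_simp

/-- Lagged covariate parts are a linear image of the projected covariates. -/
theorem Regular.lagMap_dir (h : M.Regular R τ c K κ C σ) {ρ : ℝ}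
    (a : Fin M.p₁ → ℝ) (b : Fin M.p₂ → ℝ) (L : ℕ → (Fin M.N₁ → Fin M.N₂ → ℝ) →ₗ[ℝ] ℝ)
    {n : ℕ} (hn : n ≤ M.T + 1) (t : Fin n) (ω : M.Ω) :
    R * Real.sqrt M.m / c *
        M.lagMap n L (M.projCov (M.dirRow R c ρ a) (M.dirCol R c ρ b) ω) t =
      ∑ k ∈ Finset.range t, L k (M.covPart ((t : ℕ) - k : ℤ) ω) := by
  rw [lagMap_apply, Finset.mul_sum]
  refine Finset.sum_congr rfl fun k hk => ?_
  have hk' := Finset.mem_range.1 hk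
  rw [← smul_eq_mul, ← map_smul, h.covMat_dir_one a b (by omega)]
  congr 2
  omega

theorem measure_abs_ge_le_of_subG {Ω : Type*} [MeasurableSpace Ω] {μ : Measure Ω}
    [IsProbabilityMeasure μ] {X : Ω → ℝ} {s : ℝ≥0} (hX : HasSubgaussianMGF X s μ) {y : ℝ}
    (hy : 0 ≤ y) : μ.real {ω | y ≤ |X ω|} ≤ 2 * Real.exp (-(y ^ 2 / (2 * s))) := by
  have h1 := hX.measure_ge_le hy
  have h2 := hX.neg.measure_ge_le hy
  calc μ.real {ω | y ≤ |X ω|} ≤ μ.real ({ω | y ≤ X ω} ∪ {ω | y ≤ (-X) ω}) := by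
        refine measureReal_mono (fun ω hω => ?_) (by finiteness)
        exact le_abs.1 (show y ≤ |X ω| from hω)
    _ ≤ _ := (measureReal_union_le _ _).trans (add_le_add h1 h2)
    _ = _ := by rw [neg_div]; ring

/-- Tail bound for the stationary response. -/
theorem Regular.response_tail (h : M.Regular R τ c K κ C σ) (i : Fin M.N₁) (j : Fin M.N₂) {y : ℝ}
    (hy : 0 < y) :
    M.μ.real {ω | y ≤ |M.Y 0 ω i j|} ≤
      4 * Real.exp (-(y ^ 2 / (2 * varBound R c K κ C σ * M.m))) +
        9 * C ^ 2 * (varBound R c K κ C σ * M.m) * κ ^ (2 * M.T) / y ^ 2 := by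
  have := h.prob
  have hκ : 0 < κ := by linarith [h.κ_ge]
  have hκ1 : 0 < 1 - κ := by linarith [h.κ_lt]
  have hC : 0 < C := by linarith [h.C_ge]
  have hR := h.R_pos; have hc := h.c_pos; have hK := h.K_pos
  have hm := m_ge (M := M)
  have hsm := sqrt_m_pos (M := M)
  have hσ : (0 : ℝ) < σ := by exact_mod_cast h.σ_pos
  have hV := h.varBound_pos
  set L : ℕ → (Fin M.N₁ → Fin M.N₂ → ℝ) →ₗ[ℝ] ℝ := fun k => entryForm i j ∘ₗ (M.stepLin ^ k) with hL
  have hLb : ∀ k, FormBound (L k) (C * κ ^ k) := fun k => by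
    simpa using h.comp_pow_bound (entryForm_bound i j) k
  -- By stationarity the response at time 0 may be replaced by the one at time T, whose expansion
  -- uses covariates at times 1, …, T. The three parts of that expansion are compared with y/3 each.
  have hid : M.μ.real {ω | y ≤ |M.Y 0 ω i j|} = M.μ.real {ω | y ≤ |M.Y M.T ω i j|} := by
    have h1 := h.ident M.T (G := fun p => (p 0).1 i j) (by fun_prop)
    have hs : MeasurableSet {z : ℝ | y ≤ |z|} := measurableSet_le measurable_const measurable_abs
    have h2 := h1.measure_mem_eq hs
    simp only [zero_add] at h2
    unfold Measure.real
    congr 1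
  rw [hid]
  set η₁ := M.dirRow R c 1 0
  set η₂ := M.dirCol R c 1 0
  set q := R * Real.sqrt M.m / c with hq
  have hq0 : 0 < q := by positivity
  set A : M.CovSpace →ₗ[ℝ] ℝ :=
    q • ((EuclideanSpace.proj (Fin.last M.T) : EuclideanSpace ℝ (Fin (M.T + 1)) →L[ℝ] ℝ).toLinearMap ∘ₗ
      M.lagMap (M.T + 1) L) with hA
  have hAe : ∀ V, A V = q * M.lagMap (M.T + 1) L V (Fin.last M.T) := fun V => rfl
  have hAω : ∀ ω, A (M.projCov η₁ η₂ ω) =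
      ∑ k ∈ Finset.range M.T, L k (M.covPart ((M.T : ℤ) - k) ω) := fun ω => by
    rw [hAe, h.lagMap_dir (ρ := 1) 0 0 L le_rfl]; simp
  set Λ := q * (Real.sqrt 2 * (C / (1 - κ))) with hΛ
  have hΛ0 : 0 < Λ := by positivity
  have hAb : ∀ V, |A V| ≤ Λ * ‖V‖ := by
    intro V
    rw [hAe, abs_mul, abs_of_pos hq0, hΛ, mul_assoc]
    gcongr
    exact (PiLp.norm_apply_le (M.lagMap (M.T + 1) L V) (Fin.last M.T)).trans
      (norm_lagMap_le _ hC.le hκ.le h.κ_lt hLb V)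
  have hAm : ∫ ω, A (M.projCov η₁ η₂ ω) ∂M.μ = 0 := by
    simp_rw [hAω]
    rw [integral_finsetSum _ fun k _ => (h.integral_form_covPart (L k) _).1]
    exact Finset.sum_eq_zero fun k _ => (h.integral_form_covPart (L k) _).2
  have hcov := (h.linear_concentration (η₁ := η₁) (η₂ := η₂)
    (h.norm_dirRow_le one_pos (by simp)) (h.norm_dirCol_le one_pos (by simp)) A hΛ0 hAb hAm).2.2
    (y / 3) (by positivity)
  set N : M.Ω → ℝ := fun ω => ∑ k ∈ Finset.range M.T, L k (M.E ((M.T : ℤ) - k) ω) with hN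
  have hnoise : HasSubgaussianMGF N (Real.toNNReal (C * σ / (1 - κ)) ^ 2) M.μ := by
    have h1 := HasSubgaussianMGF.finset_sum (μ := M.μ) (Finset.range M.T)
      (X := fun k ω => L k (M.E ((M.T : ℤ) - k) ω)) (s := noiseScale C κ σ)
      (fun k _ => (h.subG_form (hLb k) _).1)
    refine h1.of_le ?_
    gcongr
    rw [← NNReal.coe_le_coe, Real.coe_toNNReal _ (by positivity)]
    push_cast
    exact sum_noiseScale_le hC.le hκ.le h.κ_lt σ M.T
  have hnt := measure_abs_ge_le_of_subG hnoise (y := y / 3) (by positivity)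
  have hinit := (hLb M.T).integral_sq_le (fun i j => h.sqInt 0 i j)
    (fun i j => h.integral_Y_sq_le 0 i j) (by positivity)
  -- Chebyshev suffices for the initial part, since its variance already carries the factor κ ^
  -- (2T).
  have hmk : M.μ.real {ω | y / 3 ≤ |L M.T (M.Y 0 ω)|} ≤
      9 * C ^ 2 * (varBound R c K κ C σ * M.m) * κ ^ (2 * M.T) / y ^ 2 := by
    have h1 := mul_meas_ge_le_integral_of_nonneg (μ := M.μ) (f := fun ω => L M.T (M.Y 0 ω) ^ 2)
      (ae_of_all _ fun _ => sq_nonneg _) hinit.1.integrable_sq ((y / 3) ^ 2)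
    have h2 : {ω | y / 3 ≤ |L M.T (M.Y 0 ω)|} ⊆ {ω | (y / 3) ^ 2 ≤ L M.T (M.Y 0 ω) ^ 2} := by
      intro ω hω
      simp only [Set.mem_ofPred_eq] at hω ⊢
      rw [← sq_abs (L M.T (M.Y 0 ω))]
      gcongr
    have h3 : (y / 3) ^ 2 * M.μ.real {ω | y / 3 ≤ |L M.T (M.Y 0 ω)|} ≤
        (C * κ ^ M.T) ^ 2 * (varBound R c K κ C σ * M.m) := by
      refine le_trans ?_ (h1.trans hinit.2)
      exact mul_le_mul_of_nonneg_left (measureReal_mono h2 (measure_ne_top _ _)) (by positivity)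
    rw [le_div_iff₀ (by positivity)]
    have e1 : (C * κ ^ M.T) ^ 2 = C ^ 2 * κ ^ (2 * M.T) := by rw [mul_pow, ← pow_mul, mul_comm 2]
    rw [e1] at h3
    linarith
  have e1 : Real.exp (-((y / 3) ^ 2 / (K * Λ) ^ 2)) ≤
      Real.exp (-(y ^ 2 / (2 * varBound R c K κ C σ * M.m))) := by
    apply Real.exp_le_exp.2
    rw [neg_le_neg_iff, div_pow, div_div]
    apply div_le_div_of_nonneg_left (by positivity) (by positivity)
    have e : (K * Λ) ^ 2 = 2 * K ^ 2 * R ^ 2 * M.m * C ^ 2 / (c ^ 2 * (1 - κ) ^ 2) := by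
      rw [hΛ, hq]
      have := Real.sq_sqrt (show (0 : ℝ) ≤ M.m by positivity)
      have h2 := Real.sq_sqrt (show (0 : ℝ) ≤ 2 by norm_num)
      field_simp
      rw [this, h2]; ring
    have e' : 2 * varBound R c K κ C σ * M.m = 32 * K ^ 2 * R ^ 2 * M.m * C ^ 2 / (c ^ 2 * (1 - κ) ^ 2)
        + 64 * C ^ 2 * σ ^ 2 * M.m / (1 - κ) ^ 2 := by
      unfold varBound; field_simp; ring
    rw [e, e']
    have p1 : 0 ≤ 64 * C ^ 2 * (σ : ℝ) ^ 2 * M.m / (1 - κ) ^ 2 := by positivity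
    have p2 : 0 ≤ K ^ 2 * R ^ 2 * M.m * C ^ 2 / (c ^ 2 * (1 - κ) ^ 2) := by positivity
    have q1 : 3 ^ 2 * (2 * K ^ 2 * R ^ 2 * M.m * C ^ 2 / (c ^ 2 * (1 - κ) ^ 2)) =
      18 * (K ^ 2 * R ^ 2 * M.m * C ^ 2 / (c ^ 2 * (1 - κ) ^ 2)) := by ring
    have q2 : 32 * K ^ 2 * R ^ 2 * M.m * C ^ 2 / (c ^ 2 * (1 - κ) ^ 2) =
      32 * (K ^ 2 * R ^ 2 * M.m * C ^ 2 / (c ^ 2 * (1 - κ) ^ 2)) := by ring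
    rw [q1, q2]; linarith
  have e2 : Real.exp (-((y / 3) ^ 2 / (2 * ((Real.toNNReal (C * σ / (1 - κ)) ^ 2 : ℝ≥0) : ℝ)))) ≤
      Real.exp (-(y ^ 2 / (2 * varBound R c K κ C σ * M.m))) := by
    apply Real.exp_le_exp.2
    push_cast
    rw [Real.coe_toNNReal _ (by positivity), neg_le_neg_iff, div_pow, div_div]
    apply div_le_div_of_nonneg_left (by positivity) (by positivity)
    have e' : 2 * varBound R c K κ C σ * M.m = 32 * K ^ 2 * R ^ 2 * M.m * C ^ 2 / (c ^ 2 * (1 - κ) ^ 2)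
        + 64 * M.m * (C * σ / (1 - κ)) ^ 2 := by
      unfold varBound; field_simp; ring
    rw [e']
    have p1 : 0 ≤ (C * (σ : ℝ) / (1 - κ)) ^ 2 := by positivity
    have p2 : 0 ≤ 32 * K ^ 2 * R ^ 2 * M.m * C ^ 2 / (c ^ 2 * (1 - κ) ^ 2) := by positivity
    nlinarith
  have hsub : M.μ.real {ω | y ≤ |M.Y M.T ω i j|} ≤
      M.μ.real (({ω | y / 3 ≤ |A (M.projCov η₁ η₂ ω)|} ∪ {ω | y / 3 ≤ |N ω|}) ∪
        {ω | y / 3 ≤ |L M.T (M.Y 0 ω)|}) := by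
    unfold Measure.real
    refine ENNReal.toReal_mono (by finiteness) (measure_mono_ae ?_)
    filter_upwards [h.ae_expand] with ω hω hmem
    have hmem' : y ≤ |M.Y M.T ω i j| := hmem
    have e3 : M.Y M.T ω i j = L M.T (M.Y 0 ω) + (A (M.projCov η₁ η₂ ω) + N ω) := by
      rw [hω M.T, hAω, hN, ← Finset.sum_add_distrib]
      simp only [Pi.add_apply, Finset.sum_apply, hL, LinearMap.comp_apply, ← map_add]; rfl
    by_contra hcon
    have hc1 := not_or.1 hcon
    have hc2 := not_or.1 hc1.1
    have hc3 : |A (M.projCov η₁ η₂ ω)| < y / 3 := not_le.1 hc2.1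
    have hc4 : |N ω| < y / 3 := not_le.1 hc2.2
    have hc5 : |L M.T (M.Y 0 ω)| < y / 3 := not_le.1 hc1.2
    rw [e3] at hmem'
    have := (abs_add_le (L M.T (M.Y 0 ω)) (A (M.projCov η₁ η₂ ω) + N ω)).trans
      (add_le_add_right (abs_add_le _ _) _)
    linarith
  refine hsub.trans ((measureReal_union_le _ _).trans ?_)
  have := measureReal_union_le (μ := M.μ) {ω | y / 3 ≤ |A (M.projCov η₁ η₂ ω)|} {ω | y / 3 ≤ |N ω|}
  linarith

theorem Regular.measurable_covPart_form (L : (Fin M.N₁ → Fin M.N₂ → ℝ) →ₗ[ℝ] ℝ) (t : ℤ) :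
    Measurable[M.covSigma] fun ω => L (M.covPart t ω) := by
  have h1 : Measurable fun p : ℤ → (Fin M.N₁ → Fin M.p₁ → ℝ) × (Fin M.N₂ → Fin M.p₂ → ℝ) =>
      ∑ q : Fin M.N₁ × Fin M.N₂, formCoef L q.1 q.2 *
        ((∑ k, (p t).1 q.1 k * M.θ₀.zeta (M.g₀ q.1) k) +
          ∑ k, (p t).2 q.2 k * M.θ₀.delta (M.h₀ q.2) k) := by fun_prop
  have h2 := h1.comp (comap_measurable (fun ω (t : ℤ) => (M.X t ω, M.Z t ω)))
  have e : (fun ω => L (M.covPart t ω)) = (fun p : ℤ → (Fin M.N₁ → Fin M.p₁ → ℝ) × (Fin M.N₂ → Fin M.p₂ → ℝ) =>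
      ∑ q : Fin M.N₁ × Fin M.N₂, formCoef L q.1 q.2 *
        ((∑ k, (p t).1 q.1 k * M.θ₀.zeta (M.g₀ q.1) k) +
          ∑ k, (p t).2 q.2 k * M.θ₀.delta (M.h₀ q.2) k)) ∘ fun ω (t : ℤ) => (M.X t ω, M.Z t ω) := by
    ext ω; rw [form_eq_sum L]; rfl
  rw [e]; exact h2

theorem Regular.measurable_cov_head (i : Fin M.N₁) (j : Fin M.N₂) (a : Fin M.p₁ → ℝ)
    (b : Fin M.p₂ → ℝ) (t : ℤ) :
    Measurable[M.covSigma] fun ω => ∑ k, M.X t ω i k * a k + ∑ k, M.Z t ω j k * b k := by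
  have h1 : Measurable fun p : ℤ → (Fin M.N₁ → Fin M.p₁ → ℝ) × (Fin M.N₂ → Fin M.p₂ → ℝ) =>
      ∑ k, (p t).1 i k * a k + ∑ k, (p t).2 j k * b k := by fun_prop
  exact h1.comp (comap_measurable (fun ω (t : ℤ) => (M.X t ω, M.Z t ω)))

end GMNAR

theorem FormBound.mono {m n : ℕ} {L : (Fin m → Fin n → ℝ) →ₗ[ℝ] ℝ} {B B' : ℝ} (h : FormBound L B)
    (hB : B ≤ B') : FormBound L B' := fun y hy => (h y hy).trans hB

theorem sum_geom_sq_le {κ : ℝ} (h0 : 0 ≤ κ) (h1 : κ < 1) (T : ℕ) :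
    ∑ t ∈ Finset.range T, (κ ^ t) ^ 2 ≤ (1 - κ)⁻¹ := by
  refine (Finset.sum_le_sum fun t _ => ?_).trans (GMNAR.sum_pow_le_inv h0 h1 T)
  have p : 0 ≤ κ ^ t := pow_nonneg h0 t
  have q : κ ^ t ≤ 1 := pow_le_one₀ h0 h1.le
  nlinarith

namespace GMNAR

variable {M : GMNAR} {R τ c K κ C : ℝ} {σ : ℝ≥0}

theorem Regular.sum_sq_le_inv (h : M.Regular R τ c K κ C σ) {v : M.RegIdx → ℝ} {i : Fin M.N₁}
    {j : Fin M.N₂} {t : ℤ} (hv : ∫ ω, M.proj v i j t ω ^ 2 ∂M.μ = 1) : ∑ a, v a ^ 2 ≤ 1 / τ := by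
  rw [le_div_iff₀ h.τ_pos, mul_comm, ← hv]
  exact h.le_integral_proj_sq v i j t

theorem Regular.lagForm_pow_bound (h : M.Regular R τ c K κ C σ) {v : M.RegIdx → ℝ} (i : Fin M.N₁)
    (j : Fin M.N₂) (hv : ∑ a, v a ^ 2 ≤ 1 / τ) (k : ℕ) :
    FormBound (M.lagForm v i j ∘ₗ (M.stepLin ^ k)) (2 * C / Real.sqrt τ * κ ^ k) := by
  have hκ : 0 < κ := by linarith [h.κ_ge]
  have hC : 0 < C := by linarith [h.C_ge]
  have hτ := h.τ_pos
  have hs := Real.sqrt_pos.2 hτ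
  refine (h.comp_pow_bound (h.lagForm_bound v i j) k).mono ?_
  -- Cauchy–Schwarz gives √3 / √τ; the 2 rounds it up.
  have h1 : |v M.ixRow| + |v M.ixCol| + |v M.ixLag| ≤ 2 / Real.sqrt τ := by
    apply abs_le_of_sq_le_sq' _ (by positivity) |>.2
    rw [div_pow, Real.sq_sqrt hτ.le]
    rw [sum_regIdx] at hv
    have p1 : 0 ≤ ∑ k, v (M.ixX k) ^ 2 := Finset.sum_nonneg fun _ _ => sq_nonneg _
    have p2 : 0 ≤ ∑ k, v (M.ixZ k) ^ 2 := Finset.sum_nonneg fun _ _ => sq_nonneg _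
    have e : (2 : ℝ) ^ 2 / τ = 4 * (1 / τ) := by ring
    rw [e]
    have q1 := sq_abs (v M.ixRow); have q2 := sq_abs (v M.ixCol); have q3 := sq_abs (v M.ixLag)
    nlinarith [sq_nonneg (|v M.ixRow| - |v M.ixCol|), sq_nonneg (|v M.ixRow| - |v M.ixLag|),
      sq_nonneg (|v M.ixCol| - |v M.ixLag|), sq_nonneg (v M.ixRow), sq_nonneg (v M.ixCol), sq_nonneg (v M.ixLag)]
  calc _ ≤ 2 / Real.sqrt τ * C * κ ^ k := by gcongr
    _ = _ := by ring

/-- The empirical second moment of a projection of the regressors, in a direction of unit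
population second moment, is of order `T` unless the initial response is large. -/
theorem Regular.gram_tail (h : M.Regular R τ c K κ C σ) {v : M.RegIdx → ℝ} {i : Fin M.N₁}
    {j : Fin M.N₂} (hv : ∫ ω, M.proj v i j 1 ω ^ 2 ∂M.μ = 1) {β S θ Λ : ℝ}
    (hβ : β = 2 * C / Real.sqrt τ) (hS : S = β * σ / (1 - κ)) (hθ0 : 0 < θ) (hθ1 : θ ≤ 1)
    (hθS : θ * (5 + S ^ 2 + S * (20 + 16 * S ^ 2)) ≤ 3 / 16)
    (hΛ : Λ = Real.sqrt 2 * (1 / (c * Real.sqrt τ) + R * β / (c * (1 - κ))))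
    (hT0 : 0 < M.T)
    (hT1 : 16 * β ^ 2 * varBound R c K κ C σ / (1 - κ) * M.m ≤ M.T)
    (hT2 : 2 * (K * Λ) ^ 2 * M.m ≤ θ * M.T) :
    M.μ {ω | (∀ i j, M.Y 0 ω i j ^ 2 ≤ (1 - κ) / (16 * β ^ 2) * M.T) ∧
      ¬ (M.T / 16 ≤ ∑ t ∈ Finset.range M.T, M.proj v i j (t + 1) ω ^ 2 ∧
        ∑ t ∈ Finset.range M.T, M.proj v i j (t + 1) ω ^ 2 ≤ (37 + 32 * S ^ 2) * M.T)} ≤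
      ENNReal.ofReal (2 * Real.exp (-(θ ^ 2 * M.T / ((K * Λ) ^ 2 * M.m)))) +
        ENNReal.ofReal (3 * M.T * Real.exp (-(θ ^ 2 / 128 * M.T))) := by
  have := h.prob
  have hκ : 0 < κ := by linarith [h.κ_ge]
  have hκ1 : 0 < 1 - κ := by linarith [h.κ_lt]
  have hC : 0 < C := by linarith [h.C_ge]
  have hR := h.R_pos; have hc := h.c_pos; have hK := h.K_pos
  have hτ := h.τ_pos
  have hsτ := Real.sqrt_pos.2 hτ
  have hm := m_ge (M := M)
  have hsm := sqrt_m_pos (M := M)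
  have hVB := h.varBound_pos
  have hβ0 : 0 < β := by rw [hβ]; positivity
  have hTr : (0 : ℝ) < M.T := by exact_mod_cast hT0
  have hvs := h.sum_sq_le_inv hv
  set L : ℕ → (Fin M.N₁ → Fin M.N₂ → ℝ) →ₗ[ℝ] ℝ :=
    fun k => M.lagForm v i j ∘ₗ (M.stepLin ^ k) with hL
  have hLb : ∀ k, FormBound (L k) (β * κ ^ k) := fun k => by
    rw [hβ]; exact h.lagForm_pow_bound i j hvs k
  set a : Fin M.p₁ → ℝ := fun k => v (M.ixX k)
  set b : Fin M.p₂ → ℝ := fun k => v (M.ixZ k)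
  set ρ : ℝ := 1 / Real.sqrt τ with hρ
  have hρ0 : 0 < ρ := by positivity
  have hρ2 : ρ ^ 2 = 1 / τ := by rw [hρ, div_pow, Real.sq_sqrt hτ.le, one_pow]
  have hvs' := hvs
  rw [sum_regIdx] at hvs'
  have p1 : 0 ≤ ∑ k, v (M.ixX k) ^ 2 := Finset.sum_nonneg fun _ _ => sq_nonneg _
  have p2 : 0 ≤ ∑ k, v (M.ixZ k) ^ 2 := Finset.sum_nonneg fun _ _ => sq_nonneg _
  have p3 := sq_nonneg (v M.ixRow); have p4 := sq_nonneg (v M.ixCol); have p5 := sq_nonneg (v M.ixLag)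
  have ha : ∑ k, a k ^ 2 ≤ ρ ^ 2 := by rw [hρ2]; linarith
  have hb : ∑ k, b k ^ 2 ≤ ρ ^ 2 := by rw [hρ2]; linarith
  set η₁ := M.dirRow R c ρ a
  set η₂ := M.dirCol R c ρ b
  set q := R * Real.sqrt M.m / c with hq
  have hq0 : 0 < q := by positivity
  -- Projection 0 carries the covariate coefficients of v, read at the current time t + 1;
  -- projection 1 carries the true coefficients, read at the lagged times. This is why two
  -- projections are assumed to concentrate jointly.
  set A : M.CovSpace →ₗ[ℝ] EuclideanSpace ℝ (Fin M.T) :=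
    (ρ / c) • M.seqMap 0 (fun _ => entryForm i j) (fun t => (t : ℕ) + 1) + q • M.lagMap M.T L
    with hA
  have hAe : ∀ V t, A V t = ρ / c * M.covMat 0 ((t : ℕ) + 1) V i j + q * M.lagMap M.T L V t :=
    fun V t => rfl
  set f : ℕ → M.Ω → ℝ := fun t ω =>
    (∑ k, M.X ((t : ℤ) + 1) ω i k * a k + ∑ k, M.Z ((t : ℤ) + 1) ω j k * b k) +
      ∑ k ∈ Finset.range t, L k (M.covPart ((t : ℤ) - k) ω) with hf
  have hAf : ∀ ω (t : Fin M.T), A (M.projCov η₁ η₂ ω) t = f t ω := fun ω t => by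
    have e := h.covMat_dir_zero hρ0 a b (s := (t : ℕ) + 1) (by omega) ω i j
    rw [hAe, e, h.lagMap_dir (ρ := ρ) a b L (by omega)]
    simp [hf]
  set Λ' := Λ * Real.sqrt M.m with hΛ'
  have hΛ0 : 0 < Λ := by rw [hΛ]; positivity
  have hΛ'0 : 0 < Λ' := by positivity
  have hsm1 : 1 ≤ Real.sqrt M.m := Real.one_le_sqrt.2 (by linarith)
  have hAb : ∀ V, ‖A V‖ ≤ Λ' * ‖V‖ := by
    intro V
    have h1 := norm_seqMap_le (M := M) (n := M.T) 0 (l := fun _ => entryForm i j)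
      (s := fun t => (t : ℕ) + 1) zero_le_one (fun _ => entryForm_bound i j)
      (fun x _ y _ hxy => Fin.ext (by simpa using hxy)) V
    have h2 := norm_lagMap_le M.T hβ0.le hκ.le h.κ_lt hLb V
    have h3 : ‖A V‖ ≤ ρ / c * (Real.sqrt 2 * 1 * ‖V‖) + q * (Real.sqrt 2 * (β / (1 - κ)) * ‖V‖) := by
      rw [hA, LinearMap.add_apply, LinearMap.smul_apply, LinearMap.smul_apply]
      refine (norm_add_le _ _).trans ?_
      rw [norm_smul, norm_smul, Real.norm_of_nonneg hq0.le, Real.norm_of_nonneg (by positivity)]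
      gcongr
    refine h3.trans ?_
    have e : Λ' * ‖V‖ = Real.sqrt M.m * (ρ / c * (Real.sqrt 2 * 1 * ‖V‖)) +
        q * (Real.sqrt 2 * (β / (1 - κ)) * ‖V‖) := by
      rw [hΛ', hΛ, hq, hρ]; field_simp
    rw [e]
    exact add_le_add (le_mul_of_one_le_left (by positivity) hsm1) le_rfl
  obtain ⟨c1, c2, c3⟩ := h.norm_concentration (η₁ := η₁) (η₂ := η₂)
    (h.norm_dirRow_le hρ0 ha) (h.norm_dirCol_le hρ0 hb) A hΛ'0 hAb
  have hΛsq : (K * Λ') ^ 2 = (K * Λ) ^ 2 * M.m := by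
    rw [hΛ', ← mul_assoc, mul_pow, Real.sq_sqrt (by positivity)]
  rw [hΛsq] at c2 c3
  set ψ : M.Ω → ℝ := fun ω => ‖A (M.projCov η₁ η₂ ω)‖ with hψ
  set φ : M.Ω → ℝ := fun ω => (Real.sqrt M.T)⁻¹ * ψ ω with hφ
  have hsT : 0 < Real.sqrt M.T := Real.sqrt_pos.2 hTr
  have hsT2 := Real.sq_sqrt hTr.le
  have hφm : ∫ ω, φ ω ∂M.μ = (Real.sqrt M.T)⁻¹ * ∫ ω, ψ ω ∂M.μ := integral_const_mul _ _
  have hφd : ∀ ω, φ ω - ∫ ω', φ ω' ∂M.μ = (Real.sqrt M.T)⁻¹ * (ψ ω - ∫ ω', ψ ω' ∂M.μ) :=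
    fun ω => by rw [hφm, hφ]; ring
  have hLN := h.lagNoise hβ0 hLb (f := f) fun t => by
    refine (measurable_cov_head i j a b ((t : ℤ) + 1)).add ?_
    exact Finset.measurable_fun_sum _ fun k _ => measurable_covPart_form (L k) _
  have hini : ∀ t, MemLp (fun ω => L t (M.Y 0 ω)) 2 M.μ ∧
      ∫ ω, L t (M.Y 0 ω) ^ 2 ∂M.μ ≤ (β * κ ^ t) ^ 2 * (varBound R c K κ C σ * M.m) := fun t =>
    (hLb t).integral_sq_le (fun i j => h.sqInt 0 i j)
      (fun i j => h.integral_Y_sq_le 0 i j) (by positivity)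
  have hgeo := sum_geom_sq_le hκ.le h.κ_lt M.T
  have key := hLN.energy_bounds hT0 (a := fun t => M.proj v i j ((t : ℤ) + 1))
    (ini := fun t ω => L t (M.Y 0 ω)) (S := S) (θ := θ)
    (δ := ENNReal.ofReal (2 * Real.exp (-(θ ^ 2 * M.T / ((K * Λ) ^ 2 * M.m))))) hθ0 hθ1
    (fun t ht => by
      filter_upwards [h.ae_expand] with ω hω
      rw [proj_eq, show ((t : ℤ) + 1 - 1) = t by ring, hω t, map_add, map_sum]
      simp only [lagSum, map_add, Finset.sum_add_distrib]
      have e : ∑ k ∈ Finset.Ico 0 M.T, M.noiseTerm L k t ω =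
          ∑ k ∈ Finset.range t, L k (M.E ((t : ℤ) - k) ω) := by
        rw [← Finset.range_eq_Ico]
        simp only [noiseTerm]
        rw [← Finset.sum_filter]
        congr 1
        ext k; simp only [Finset.mem_filter, Finset.mem_range]; omega
      rw [e, hf]
      simp only [hL, LinearMap.comp_apply]
      ring)
    (fun t _ => by rw [h.integral_proj_sq_shift]; exact hv)
    (fun t _ => h.memLp_proj v i j _) (fun t _ => (hini t).1)
    (by
      calc ∑ t ∈ Finset.range M.T, ∫ ω, L t (M.Y 0 ω) ^ 2 ∂M.μ
          ≤ ∑ t ∈ Finset.range M.T, (β * κ ^ t) ^ 2 * (varBound R c K κ C σ * M.m) :=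
            Finset.sum_le_sum fun t _ => (hini t).2
        _ = β ^ 2 * (varBound R c K κ C σ * M.m) * ∑ t ∈ Finset.range M.T, (κ ^ t) ^ 2 := by
            rw [Finset.mul_sum]; exact Finset.sum_congr rfl fun t _ => by ring
        _ ≤ β ^ 2 * (varBound R c K κ C σ * M.m) * (1 - κ)⁻¹ := by gcongr
        _ = 16 * β ^ 2 * varBound R c K κ C σ / (1 - κ) * M.m / 16 := by field_simp
        _ ≤ _ := by gcongr)
    (fun k t => h.integral_noiseTerm hLb k t)
    (by rw [hS]; exact sum_noiseScale_le hβ0.le hκ.le h.κ_lt σ M.T)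
    (φ := φ) (fun ω => by positivity)
    (fun ω => by
      rw [hφ, mul_pow, inv_pow, hsT2, hψ, EuclideanSpace.norm_sq_eq, ← mul_assoc,
        mul_inv_cancel₀ hTr.ne', one_mul, ← Fin.sum_univ_eq_sum_range (fun t => f t ω ^ 2)]
      exact Finset.sum_congr rfl fun t _ => by rw [hAf, Real.norm_eq_abs, sq_abs])
    (c1.const_mul _)
    (by
      have := c3 (θ * Real.sqrt M.T) (by positivity)
      rw [mul_pow, hsT2] at this
      rw [← ofReal_measureReal]
      apply ENNReal.ofReal_le_ofReal
      refine le_trans (le_of_eq ?_) this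
      congr 1
      ext ω
      simp only [Set.mem_ofPred_eq]
      rw [hφd, abs_mul, abs_of_pos (inv_pos.2 hsT), inv_mul_eq_div, le_div_iff₀ hsT])
    (by
      simp_rw [hφd, mul_pow]
      rw [integral_const_mul, inv_pow, hsT2, inv_mul_le_iff₀ hTr, mul_comm (M.T : ℝ)]
      linarith) hθS
  refine (measure_mono ?_).trans key
  rintro ω ⟨h1, h2⟩
  refine ⟨?_, h2⟩
  -- This level for the squared initial response makes the geometric sum of the squared initial
  -- terms at most T/16.
  set ν := (1 - κ) / (16 * β ^ 2) with hν
  have hν0 : 0 < ν := by positivity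
  have hle : ∀ t, L t (M.Y 0 ω) ^ 2 ≤ β ^ 2 * (ν * M.T) * (κ ^ t) ^ 2 := fun t => by
    have h3 := (hLb t).abs_le (b := Real.sqrt (ν * M.T)) (by positivity) (y := M.Y 0 ω)
      (fun i j => Real.abs_le_sqrt (h1 i j))
    rw [← sq_abs]
    calc |L t (M.Y 0 ω)| ^ 2 ≤ (β * κ ^ t * Real.sqrt (ν * M.T)) ^ 2 := by gcongr
      _ = _ := by rw [mul_pow, Real.sq_sqrt (by positivity)]; ring
  calc ∑ t ∈ Finset.range M.T, L t (M.Y 0 ω) ^ 2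
      ≤ ∑ t ∈ Finset.range M.T, β ^ 2 * (ν * M.T) * (κ ^ t) ^ 2 := Finset.sum_le_sum fun t _ => hle t
    _ = β ^ 2 * (ν * M.T) * ∑ t ∈ Finset.range M.T, (κ ^ t) ^ 2 := by rw [Finset.mul_sum]
    _ ≤ β ^ 2 * (ν * M.T) * (1 - κ)⁻¹ := by gcongr
    _ = M.T / 16 := by rw [hν]; field_simp

end GMNAR

/-! ### Covariance of the regressors with the noise. -/

theorem comap_history_le {Ω α β γ : Type*} [MeasurableSpace α] [MeasurableSpace β]
    [MeasurableSpace γ] {mΩ : MeasurableSpace Ω} {Y : ℤ → Ω → α} {X : ℤ → Ω → β} {Z : ℤ → Ω → γ}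
    (r : ℤ) (hY : ∀ s < r, Measurable (Y s)) (hX : ∀ s ≤ r, Measurable (X s))
    (hZ : ∀ s ≤ r, Measurable (Z s)) :
    MeasurableSpace.comap (fun ω => ((fun s : Set.Iio r => Y s ω), (fun s : Set.Iic r => X s ω),
      (fun s : Set.Iic r => Z s ω))) inferInstance ≤ mΩ :=
  Measurable.comap_le <|
    (measurable_pi_iff.2 fun s : Set.Iio r => hY s s.2).prodMk
      ((measurable_pi_iff.2 fun s : Set.Iic r => hX s s.2).prodMk (measurable_pi_iff.2 fun s : Set.Iic r => hZ s s.2))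

namespace GMNAR

variable {M : GMNAR} {R τ c K κ C : ℝ} {σ : ℝ≥0}

/-- Responses before time `r` and covariates up to time `r`. -/
@[reducible]
def histSigma (M : GMNAR) (r : ℤ) : MeasurableSpace M.Ω :=
  MeasurableSpace.comap (fun ω => ((fun s : Set.Iio r => M.Y s ω), (fun s : Set.Iic r => M.X s ω),
    (fun s : Set.Iic r => M.Z s ω))) inferInstance

/-- Deviation of the response from its true conditional mean. -/
noncomputable def resid (M : GMNAR) (i : Fin M.N₁) (j : Fin M.N₂) (t : ℤ) (ω : M.Ω) : ℝ :=
  M.Y t ω i j - M.fitted M.θ₀ (M.g₀ i) (M.h₀ j) i j t ω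

theorem measurable_hist_Y {s r : ℤ} (hs : s < r) : Measurable[M.histSigma r] (M.Y s) :=
  ((measurable_pi_apply (⟨s, hs⟩ : Set.Iio r)).comp measurable_fst).comp
    (comap_measurable (fun ω => ((fun s : Set.Iio r => M.Y s ω), (fun s : Set.Iic r => M.X s ω),
      (fun s : Set.Iic r => M.Z s ω))))

theorem measurable_hist_X {s r : ℤ} (hs : s ≤ r) : Measurable[M.histSigma r] (M.X s) :=
  ((measurable_pi_apply (⟨s, hs⟩ : Set.Iic r)).comp (measurable_fst.comp measurable_snd)).comp
    (comap_measurable (fun ω => ((fun s : Set.Iio r => M.Y s ω), (fun s : Set.Iic r => M.X s ω),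
      (fun s : Set.Iic r => M.Z s ω))))

theorem measurable_hist_Z {s r : ℤ} (hs : s ≤ r) : Measurable[M.histSigma r] (M.Z s) :=
  ((measurable_pi_apply (⟨s, hs⟩ : Set.Iic r)).comp (measurable_snd.comp measurable_snd)).comp
    (comap_measurable (fun ω => ((fun s : Set.Iio r => M.Y s ω), (fun s : Set.Iic r => M.X s ω),
      (fun s : Set.Iic r => M.Z s ω))))

theorem histSigma_mono : Monotone M.histSigma := fun r r' hr =>
  comap_history_le (mΩ := M.histSigma r') r (fun _ hs => measurable_hist_Y (hs.trans_le hr))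
    (fun _ hs => measurable_hist_X (hs.trans hr)) (fun _ hs => measurable_hist_Z (hs.trans hr))

theorem Regular.histSigma_le (h : M.Regular R τ c K κ C σ) (r : ℤ) : M.histSigma r ≤ M.mΩ :=
  comap_history_le r (fun _ _ => h.measurable_Y _) (fun _ _ => h.measurable_X _)
    (fun _ _ => h.measurable_Z _)

theorem measurable_hist_proj (v : M.RegIdx → ℝ) (i : Fin M.N₁) (j : Fin M.N₂) {t r : ℤ}
    (ht : t ≤ r) : Measurable[M.histSigma r] (M.proj v i j t) := by
  have e : M.proj v i j t = fun ω => M.lagForm v i j (M.Y (t - 1) ω) +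
      (∑ k, M.X t ω i k * v (M.ixX k) + ∑ k, M.Z t ω j k * v (M.ixZ k)) :=
    funext fun ω => proj_eq M v i j t ω
  rw [e]
  have hX := measurable_hist_X (M := M) ht
  have hZ := measurable_hist_Z (M := M) ht
  refine ((measurable_form _).comp (measurable_hist_Y (by omega))).add
    ((Finset.measurable_fun_sum _ fun k _ => ?_).add (Finset.measurable_fun_sum _ fun k _ => ?_))
  · exact ((measurable_pi_apply k).comp ((measurable_pi_apply i).comp hX)).mul_const _
  · exact ((measurable_pi_apply k).comp ((measurable_pi_apply j).comp hZ)).mul_const _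

/-- The residual takes the place of the noise because it is exactly a function of the observed
history; the noise equals it only almost everywhere. -/
theorem measurable_hist_resid (i : Fin M.N₁) (j : Fin M.N₂) {t r : ℤ} (ht : t < r) :
    Measurable[M.histSigma r] (M.resid i j t) := by
  have e : M.resid i j t = fun ω => M.Y t ω i j -
      M.proj (coefVec M.θ₀ (M.g₀ i) (M.h₀ j)) i j t ω :=
    funext fun ω => by rw [resid, fitted_eq_proj]
  rw [e]
  exact ((measurable_pi_apply j).comp ((measurable_pi_apply i).comp (measurable_hist_Y ht))).sub
    (measurable_hist_proj _ i j ht.le)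

theorem Regular.resid_ae_eq (h : M.Regular R τ c K κ C σ) (i : Fin M.N₁) (j : Fin M.N₂) (t : ℤ) :
    M.resid i j t =ᵐ[M.μ] fun ω => M.E t ω i j := by
  filter_upwards [h.model.2.2.2.2.2.2.2.2.2.1 t i j] with ω hω
  rw [resid, hω]; ring

theorem Regular.indep_resid (h : M.Regular R τ c K κ C σ) (i : Fin M.N₁) (j : Fin M.N₂) (t : ℤ) :
    Indep (MeasurableSpace.comap (M.resid i j t) inferInstance) (M.histSigma t) M.μ :=
  (h.noise.2.2.2.2 i j t).congr (h.resid_ae_eq i j t).symm (ae_eq_refl _)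

/-- Self-normalized bound at l = ±2x/D, where D is the threshold: on the event, the variance term is
at most x, while l times a sum of size D is at least 2x. -/
theorem Regular.noise_tail (h : M.Regular R τ c K κ C σ) (v : M.RegIdx → ℝ) (i : Fin M.N₁)
    (j : Fin M.N₂) (n : ℕ) {B x : ℝ} (hB : 0 < B) (hx : 0 < x) :
    M.μ {ω | ∑ t ∈ Finset.range n, M.proj v i j (t + 1) ω ^ 2 ≤ B ∧
      Real.sqrt (2 * x * σ ^ 2 * B) ≤
        |∑ t ∈ Finset.range n, M.proj v i j (t + 1) ω * M.resid i j (t + 1) ω|} ≤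
      ENNReal.ofReal (2 * Real.exp (-x)) := by
  have := h.prob
  have hσ : (0 : ℝ) < σ := by exact_mod_cast h.σ_pos
  set D := Real.sqrt (2 * x * σ ^ 2 * B) with hD
  have hD0 : 0 < D := Real.sqrt_pos.2 (by positivity)
  have hD2 : D ^ 2 = 2 * x * σ ^ 2 * B := Real.sq_sqrt (by positivity)
  have key : ∀ l : ℝ, _ := fun l => measure_sum_mul_ge_le (μ := M.μ)
    (m := fun t : ℕ => M.histSigma ((t : ℤ) + 1))
    (fun s t hst => histSigma_mono (by simpa using hst)) (fun t => h.histSigma_le _)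
    (ξ := fun t => M.resid i j ((t : ℤ) + 1)) (a := fun t => M.proj v i j ((t : ℤ) + 1))
    (fun t => measurable_hist_resid i j (by push_cast; omega))
    (fun t => measurable_hist_proj v i j le_rfl) (fun t => h.indep_resid i j _) (s := σ ^ 2)
    (fun t => (h.noise.2.2.2.1 i j _).congr (h.resid_ae_eq i j _).symm) n (l := l) x
  have hl : (2 * x / D) ^ 2 * ((σ ^ 2 : ℝ≥0) : ℝ) / 2 * B = x := by
    rw [div_pow, hD2]; push_cast; field_simp
  calc _ ≤ M.μ (_ ∪ _) := measure_mono ?_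
    _ ≤ _ := measure_union_le _ _
    _ ≤ _ := add_le_add (key (2 * x / D)) (key (-(2 * x / D)))
    _ = _ := by rw [← ENNReal.ofReal_add (by positivity) (by positivity)]; congr 1; ring
  rintro ω ⟨h1, h2⟩
  have h3 : (2 * x / D) ^ 2 * ((σ ^ 2 : ℝ≥0) : ℝ) / 2 *
      ∑ t ∈ Finset.range n, M.proj v i j (t + 1) ω ^ 2 ≤ x := by
    calc _ ≤ (2 * x / D) ^ 2 * ((σ ^ 2 : ℝ≥0) : ℝ) / 2 * B := by gcongr
      _ = x := hl
  have h4 : 2 * x / D * D = 2 * x := by field_simp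
  have h5 : 0 < 2 * x / D := by positivity
  rcases le_abs.1 h2 with h6 | h6
  · left
    have := mul_le_mul_of_nonneg_left h6 h5.le
    simp only [Set.mem_ofPred_eq]
    linarith
  · right
    have := mul_le_mul_of_nonneg_left h6 h5.le
    simp only [Set.mem_ofPred_eq, neg_sq]
    linarith

end GMNAR

/-! ### Whitening and uniformity over directions. -/

open scoped MatrixOrder in
/-- A positive semidefinite quadratic form is the squared norm of a linear map. -/
theorem Matrix.PosSemidef.exists_norm_sq_eq {n : Type*} [Fintype n] {A : Matrix n n ℝ}
    (hA : A.PosSemidef) :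
    ∃ B : (n → ℝ) →ₗ[ℝ] EuclideanSpace ℝ n, ∀ v, ‖B v‖ ^ 2 = v ⬝ᵥ A.mulVec v := by
  classical
  obtain ⟨X, hX, -, hXA⟩ := CFC.exists_sqrt_of_isSelfAdjoint_of_quasispectrumRestricts
    hA.isHermitian (QuasispectrumRestricts.nnreal_of_nonneg hA.nonneg)
  refine ⟨(WithLp.linearEquiv 2 ℝ (n → ℝ)).symm.toLinearMap ∘ₗ X.mulVecLin, fun v => ?_⟩
  have hXt : X.transpose = X := by
    have := hX.star_eq
    rwa [Matrix.star_eq_conjTranspose, Matrix.conjTranspose_eq_transpose_of_trivial] at this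
  rw [EuclideanSpace.norm_sq_eq]
  have e : ∀ a, ‖((WithLp.linearEquiv 2 ℝ (n → ℝ)).symm.toLinearMap ∘ₗ X.mulVecLin) v a‖ ^ 2 =
      X.mulVec v a * X.mulVec v a := fun a => by
    rw [Real.norm_eq_abs, sq_abs, ← sq]; rfl
  simp_rw [e]
  change X.mulVec v ⬝ᵥ X.mulVec v = _
  rw [← hXA, ← Matrix.mulVec_mulVec, Matrix.dotProduct_mulVec v X, ← Matrix.mulVec_transpose, hXt]

namespace GMNAR

variable {M : GMNAR} {R τ c K κ C : ℝ} {σ : ℝ≥0}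

/-- In these coordinates the population energy is the Euclidean norm, so the mesh of the net need
not depend on the conditioning of the second moment matrix, which may deteriorate with m. -/
theorem Regular.exists_whitening (h : M.Regular R τ c K κ C σ) (i : Fin M.N₁) (j : Fin M.N₂) :
    ∃ e : (M.RegIdx → ℝ) ≃ₗ[ℝ] EuclideanSpace ℝ M.RegIdx,
      ∀ v, ‖e v‖ ^ 2 = ∫ ω, M.proj v i j 1 ω ^ 2 ∂M.μ := by
  have hp : (M.Sig i j 1).PosSemidef := by
    have h1 := (h.convex i j 1).add
      ((Matrix.PosSemidef.one (n := M.RegIdx) (R := ℝ)).smul h.τ_pos.le)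
    simpa using h1
  obtain ⟨B, hB⟩ := hp.exists_norm_sq_eq
  have hinj : Function.Injective B := by
    rw [← LinearMap.ker_eq_bot, LinearMap.ker_eq_bot']
    intro v hv
    have h1 := h.le_integral_proj_sq v i j 1
    rw [h.integral_proj_sq, ← hB, hv, norm_zero] at h1
    have h2 : ∑ a, v a ^ 2 ≤ 0 := by
      have := h.τ_pos
      by_contra hcon
      nlinarith
    have h3 := (Finset.sum_eq_zero_iff_of_nonneg fun a _ => sq_nonneg (v a)).1
      (le_antisymm h2 (Finset.sum_nonneg fun a _ => sq_nonneg (v a)))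
    ext a
    simpa using h3 a (Finset.mem_univ a)
  refine ⟨LinearMap.linearEquivOfInjective B hinj (by simp), fun v => ?_⟩
  rw [LinearMap.linearEquivOfInjective_apply, hB, h.integral_proj_sq]

/-- Empirical second moment, times `T`, of a projection of the regressors. -/
noncomputable def quad (M : GMNAR) (v : M.RegIdx → ℝ) (i : Fin M.N₁) (j : Fin M.N₂) (ω : M.Ω) : ℝ :=
  ∑ t ∈ Finset.range M.T, M.proj v i j (t + 1) ω ^ 2

/-- Empirical covariance, times `T`, of a projection of the regressors with the noise. -/
noncomputable def cross (M : GMNAR) (v : M.RegIdx → ℝ) (i : Fin M.N₁) (j : Fin M.N₂) (ω : M.Ω) : ℝ :=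
  ∑ t ∈ Finset.range M.T, M.proj v i j (t + 1) ω * M.resid i j (t + 1) ω

theorem proj_add (v w : M.RegIdx → ℝ) (i : Fin M.N₁) (j : Fin M.N₂) (t : ℤ) (ω : M.Ω) :
    M.proj (v + w) i j t ω = M.proj v i j t ω + M.proj w i j t ω := by
  simp [proj, add_mul, Finset.sum_add_distrib]

theorem proj_smul (a : ℝ) (v : M.RegIdx → ℝ) (i : Fin M.N₁) (j : Fin M.N₂) (t : ℤ) (ω : M.Ω) :
    M.proj (a • v) i j t ω = a * M.proj v i j t ω := by
  simp only [proj, Finset.mul_sum, Pi.smul_apply, smul_eq_mul, mul_assoc]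

/-- The projections at the sample times, as a linear function of the direction. -/
noncomputable def projMap (M : GMNAR) (i : Fin M.N₁) (j : Fin M.N₂) (ω : M.Ω) :
    (M.RegIdx → ℝ) →ₗ[ℝ] EuclideanSpace ℝ (Fin M.T) where
  toFun v := WithLp.toLp 2 fun t => M.proj v i j ((t : ℕ) + 1) ω
  map_add' v w := by ext t; simp [proj_add]
  map_smul' a v := by ext t; simp [proj_smul]

theorem norm_projMap_sq (v : M.RegIdx → ℝ) (i : Fin M.N₁) (j : Fin M.N₂) (ω : M.Ω) :
    ‖M.projMap i j ω v‖ ^ 2 = M.quad v i j ω := by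
  rw [EuclideanSpace.norm_sq_eq, quad,
    ← Fin.sum_univ_eq_sum_range (fun t : ℕ => M.proj v i j ((t : ℤ) + 1) ω ^ 2)]
  exact Finset.sum_congr rfl fun t _ => by rw [Real.norm_eq_abs, sq_abs]; rfl

/-- `cross` as a linear function of the direction. -/
noncomputable def crossMap (M : GMNAR) (i : Fin M.N₁) (j : Fin M.N₂) (ω : M.Ω) :
    (M.RegIdx → ℝ) →ₗ[ℝ] ℝ where
  toFun v := M.cross v i j ω
  map_add' v w := by simp [cross, proj_add, add_mul, Finset.sum_add_distrib]
  map_smul' a v := by simp [cross, proj_smul, mul_assoc, Finset.mul_sum]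

/-- The mesh 1/(16 C0) is such that moving to a net point changes the norm of the projections by at
most √T/8, half of the lower bound √T/4 on the net. It leads to nets of size (48 C0) ^ m. -/
theorem quad_cross_of_net (i : Fin M.N₁) (j : Fin M.N₂) (ω : M.Ω)
    (e : (M.RegIdx → ℝ) ≃ₗ[ℝ] EuclideanSpace ℝ M.RegIdx) {C0 b : ℝ} (hC0 : 1 ≤ C0)
    {N : Finset (EuclideanSpace ℝ M.RegIdx)}
    (hN : ∀ x, ‖x‖ = 1 → ∃ c ∈ N, ‖x - c‖ ≤ 1 / (16 * C0))
    (hg : ∀ w ∈ N, (M.T / 16 ≤ M.quad (e.symm w) i j ω ∧ M.quad (e.symm w) i j ω ≤ C0 * M.T) ∧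
      |M.cross (e.symm w) i j ω| ≤ b) (v : M.RegIdx → ℝ) :
    M.T / 64 * ‖e v‖ ^ 2 ≤ M.quad v i j ω ∧ M.quad v i j ω ≤ 4 * C0 * M.T * ‖e v‖ ^ 2 ∧
      |M.cross v i j ω| ≤ 2 * b * ‖e v‖ := by
  have hε : 1 / (16 * C0) ≤ 1 / 2 := by
    apply one_div_le_one_div_of_le <;> linarith
  set A := M.projMap i j ω ∘ₗ e.symm.toLinearMap with hA
  have hT : (0 : ℝ) ≤ M.T := by positivity
  have hAw : ∀ w, ‖A w‖ ^ 2 = M.quad (e.symm w) i j ω := fun w => norm_projMap_sq _ i j ω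
  have hAv : ‖A (e v)‖ ^ 2 = M.quad v i j ω := by rw [hAw, e.symm_apply_apply]
  have hb1 : ∀ w ∈ N, ‖A w‖ ≤ Real.sqrt (C0 * M.T) := fun w hw =>
    Real.le_sqrt_of_sq_le (by rw [hAw]; exact (hg w hw).1.2)
  have hs : Real.sqrt (C0 * M.T) ≤ C0 * Real.sqrt M.T := by
    rw [Real.sqrt_mul (by linarith)]
    gcongr
    rw [Real.sqrt_le_left (by linarith)]
    nlinarith
  have hc1 : ∀ w ∈ N, Real.sqrt M.T / 4 ≤ ‖A w‖ := fun w hw => by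
    refine le_of_sq_le_sq ?_ (norm_nonneg _)
    rw [hAw, div_pow, Real.sq_sqrt hT]
    linarith [(hg w hw).1.1]
  have h1 := norm_le_of_net hε hN A hb1 (e v)
  have h2 := le_norm_of_net hε (c := Real.sqrt M.T / 4) (b := Real.sqrt (C0 * M.T)) (by
    calc 1 / (16 * C0) * (2 * Real.sqrt (C0 * M.T)) ≤ 1 / (16 * C0) * (2 * (C0 * Real.sqrt M.T)) := by
          gcongr
      _ = Real.sqrt M.T / 4 / 2 := by field_simp; ring) (Real.sqrt_nonneg _) hN A hb1 hc1 (e v)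
  have h3 := norm_le_of_net hε hN (M.crossMap i j ω ∘ₗ e.symm.toLinearMap) (b := b)
    (fun w hw => (hg w hw).2) (e v)
  refine ⟨?_, ?_, ?_⟩
  · rw [← hAv]
    calc M.T / 64 * ‖e v‖ ^ 2 = (Real.sqrt M.T / 4 / 2 * ‖e v‖) ^ 2 := by
          rw [mul_pow, div_pow, div_pow, Real.sq_sqrt hT]; ring
      _ ≤ _ := by gcongr
  · rw [← hAv]
    calc ‖A (e v)‖ ^ 2 ≤ (2 * Real.sqrt (C0 * M.T) * ‖e v‖) ^ 2 := by gcongr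
      _ = _ := by rw [mul_pow, mul_pow, Real.sq_sqrt (by positivity)]; ring
  · have e3 : (M.crossMap i j ω ∘ₗ e.symm.toLinearMap) (e v) = M.cross v i j ω := by
      rw [LinearMap.comp_apply, LinearEquiv.coe_coe, e.symm_apply_apply]; rfl
    rwa [e3] at h3

/-- Bounds, uniform over all directions, of the empirical second moments and of the empirical
covariances with the noise. -/
theorem Regular.pair_tail (h : M.Regular R τ c K κ C σ) (i : Fin M.N₁)
    (j : Fin M.N₂) {β S θ Λ : ℝ}
    (hβ : β = 2 * C / Real.sqrt τ) (hS : S = β * σ / (1 - κ)) (hθ0 : 0 < θ) (hθ1 : θ ≤ 1)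
    (hθS : θ * (5 + S ^ 2 + S * (20 + 16 * S ^ 2)) ≤ 3 / 16)
    (hΛ : Λ = Real.sqrt 2 * (1 / (c * Real.sqrt τ) + R * β / (c * (1 - κ))))
    (hT0 : 0 < M.T)
    (hT1 : 16 * β ^ 2 * varBound R c K κ C σ / (1 - κ) * M.m ≤ M.T)
    (hT2 : 2 * (K * Λ) ^ 2 * M.m ≤ θ * M.T) {C0 : ℝ} (hC0 : C0 = 37 + 32 * S ^ 2) {x : ℝ}
    (hx : 0 < x) :
    M.μ {ω | (∀ i j, M.Y 0 ω i j ^ 2 ≤ (1 - κ) / (16 * β ^ 2) * M.T) ∧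
      ¬ ∀ v, M.T / 64 * ∫ ω, M.proj v i j 1 ω ^ 2 ∂M.μ ≤ M.quad v i j ω ∧
        M.quad v i j ω ≤ 4 * C0 * M.T * ∫ ω, M.proj v i j 1 ω ^ 2 ∂M.μ ∧
        |M.cross v i j ω| ≤ 2 * Real.sqrt (2 * x * σ ^ 2 * (C0 * M.T)) *
          Real.sqrt (∫ ω, M.proj v i j 1 ω ^ 2 ∂M.μ)} ≤
      ENNReal.ofReal ((48 * C0) ^ M.m *
        (2 * Real.exp (-(θ ^ 2 * M.T / ((K * Λ) ^ 2 * M.m))) +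
          3 * M.T * Real.exp (-(θ ^ 2 / 128 * M.T)) + 2 * Real.exp (-x))) := by
  have := h.prob
  have hC01 : 1 ≤ C0 := by rw [hC0]; nlinarith [sq_nonneg S]
  have hTr : (0 : ℝ) < M.T := by exact_mod_cast hT0
  obtain ⟨e, he⟩ := h.exists_whitening i j
  obtain ⟨N, hNc, hN1, hN⟩ := exists_net_sphere (EuclideanSpace ℝ M.RegIdx)
    (ε := 1 / (16 * C0)) (by positivity)
    ((one_div_le_one_div_of_le one_pos (by linarith)).trans (by norm_num))
  have hunit : ∀ w ∈ N, ∫ ω, M.proj (e.symm w) i j 1 ω ^ 2 ∂M.μ = 1 := fun w hw => by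
    rw [← he, e.apply_symm_apply, hN1 w hw, one_pow]
  set b := Real.sqrt (2 * x * σ ^ 2 * (C0 * M.T)) with hb
  have hsub : {ω | (∀ i j, M.Y 0 ω i j ^ 2 ≤ (1 - κ) / (16 * β ^ 2) * M.T) ∧
      ¬ ∀ v, M.T / 64 * ∫ ω, M.proj v i j 1 ω ^ 2 ∂M.μ ≤ M.quad v i j ω ∧
        M.quad v i j ω ≤ 4 * C0 * M.T * ∫ ω, M.proj v i j 1 ω ^ 2 ∂M.μ ∧
        |M.cross v i j ω| ≤ 2 * b * Real.sqrt (∫ ω, M.proj v i j 1 ω ^ 2 ∂M.μ)} ⊆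
      ⋃ w ∈ N, ({ω | (∀ i j, M.Y 0 ω i j ^ 2 ≤ (1 - κ) / (16 * β ^ 2) * M.T) ∧
        ¬ (M.T / 16 ≤ M.quad (e.symm w) i j ω ∧ M.quad (e.symm w) i j ω ≤
          (37 + 32 * S ^ 2) * M.T)} ∪
        {ω | M.quad (e.symm w) i j ω ≤ C0 * M.T ∧ b ≤ |M.cross (e.symm w) i j ω|}) := by
    rintro ω ⟨h1, h2⟩
    by_contra hcon
    simp only [Set.mem_iUnion, not_exists, Set.mem_union, not_or] at hcon
    refine h2 fun v => ?_
    have h3 : ∀ w ∈ N, (M.T / 16 ≤ M.quad (e.symm w) i j ω ∧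
        M.quad (e.symm w) i j ω ≤ C0 * M.T) ∧ |M.cross (e.symm w) i j ω| ≤ b := fun w hw => by
      obtain ⟨h4, h5⟩ := hcon w hw
      have h6 : M.T / 16 ≤ M.quad (e.symm w) i j ω ∧ M.quad (e.symm w) i j ω ≤ C0 * M.T := by
        by_contra h7
        exact h4 ⟨h1, by rwa [hC0] at h7⟩
      refine ⟨h6, ?_⟩
      by_contra h7
      exact h5 ⟨h6.2, (not_le.1 h7).le⟩
    have h4 := quad_cross_of_net i j ω e hC01 hN h3 v
    have h5 : Real.sqrt (∫ ω, M.proj v i j 1 ω ^ 2 ∂M.μ) = ‖e v‖ := by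
      rw [← he, Real.sqrt_sq (norm_nonneg _)]
    rw [h5, ← he]
    exact h4
  refine (measure_mono hsub).trans ((measure_biUnion_finset_le _ _).trans ?_)
  set p := 2 * Real.exp (-(θ ^ 2 * M.T / ((K * Λ) ^ 2 * M.m))) +
          3 * M.T * Real.exp (-(θ ^ 2 / 128 * M.T)) + 2 * Real.exp (-x) with hp
  have hp0 : 0 ≤ p := by positivity
  have hone : ∀ w ∈ N, M.μ ({ω | (∀ i j, M.Y 0 ω i j ^ 2 ≤ (1 - κ) / (16 * β ^ 2) * M.T) ∧
        ¬ (M.T / 16 ≤ M.quad (e.symm w) i j ω ∧ M.quad (e.symm w) i j ω ≤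
          (37 + 32 * S ^ 2) * M.T)} ∪
        {ω | M.quad (e.symm w) i j ω ≤ C0 * M.T ∧ b ≤ |M.cross (e.symm w) i j ω|}) ≤
      ENNReal.ofReal p := fun w hw => by
    refine (measure_union_le _ _).trans ?_
    rw [hp, ENNReal.ofReal_add (by positivity) (by positivity),
      ENNReal.ofReal_add (by positivity) (by positivity)]
    exact add_le_add (h.gram_tail (hunit w hw) hβ hS hθ0 hθ1 hθS hΛ hT0 hT1 hT2)
      (h.noise_tail (e.symm w) i j M.T (by positivity) hx)
  refine (Finset.sum_le_sum hone).trans ?_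
  rw [Finset.sum_const, nsmul_eq_mul, ← ENNReal.ofReal_natCast,
    ← ENNReal.ofReal_mul (by positivity)]
  apply ENNReal.ofReal_le_ofReal
  gcongr
  refine hNc.trans (le_of_eq ?_)
  rw [finrank_euclideanSpace, card_regIdx]
  congr 1
  field_simp
  norm_num

end GMNAR

/-! ### Two-sided quadratic bounds for the losses. -/

namespace GMNAR

variable {M : GMNAR} {R τ c K κ C : ℝ} {σ : ℝ≥0}

/-- Excess squared error when the coefficient vector of entry `(i, j)` is off by `v`. -/
noncomputable def loss (M : GMNAR) (v : M.RegIdx → ℝ) (i : Fin M.N₁) (j : Fin M.N₂) (ω : M.Ω) : ℝ :=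
  M.quad v i j ω - 2 * M.cross v i j ω

/-- The loss is comparable to the squared length of `v`, up to the noise level `b`. -/
def LossBounds (M : GMNAR) (α β b : ℝ) (ω : M.Ω) : Prop :=
  ∀ (i : Fin M.N₁) (j : Fin M.N₂) (v : M.RegIdx → ℝ), α * ∑ a, v a ^ 2 ≤ M.quad v i j ω ∧
    α * ∑ a, v a ^ 2 - b ≤ M.loss v i j ω ∧ M.loss v i j ω ≤ β * ∑ a, v a ^ 2 + b

/-- Arithmetic–geometric mean: 2|n| is at most TI/128 plus a noise level proportional to x. The
first summand absorbs half of the lower bound TI/64 for the energy. -/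
theorem loss_bounds_of_quad_cross {q n I V T τ x s C0 Λ : ℝ} (hT : 0 ≤ T) (hx : 0 ≤ x)
    (hC0 : 1 ≤ C0) (hτ : τ * V ≤ I) (hΛ : I ≤ Λ * V) (hI : 0 ≤ I) (h1 : T / 64 * I ≤ q)
    (h2 : q ≤ 4 * C0 * T * I)
    (h3 : |n| ≤ 2 * Real.sqrt (2 * x * s ^ 2 * (C0 * T)) * Real.sqrt I) :
    τ / 128 * T * V ≤ q ∧ τ / 128 * T * V - 1024 * s ^ 2 * C0 * x ≤ q - 2 * n ∧
      q - 2 * n ≤ (4 * C0 + 1) * Λ * T * V + 1024 * s ^ 2 * C0 * x := by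
  have hTI : 0 ≤ T * I := by positivity
  have h4 : |2 * n| ≤ T * I / 128 + 1024 * s ^ 2 * C0 * x := by
    rw [abs_mul, abs_two]
    refine (mul_le_mul_of_nonneg_left h3 two_pos.le).trans ?_
    apply abs_le_of_sq_le_sq' _ (by positivity) |>.2
    have e : (2 * (2 * Real.sqrt (2 * x * s ^ 2 * (C0 * T)) * Real.sqrt I)) ^ 2 =
        4 * (T * I / 128) * (1024 * s ^ 2 * C0 * x) := by
      rw [mul_pow, mul_pow, mul_pow, Real.sq_sqrt (by positivity), Real.sq_sqrt hI]; ring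
    rw [e]
    nlinarith [sq_nonneg (T * I / 128 - 1024 * s ^ 2 * C0 * x)]
  obtain ⟨h5, h6⟩ := abs_le.1 h4
  have h7 : T * (τ * V) ≤ T * I := by gcongr
  have h8 : (4 * C0 + 1) * (T * I) ≤ (4 * C0 + 1) * (T * (Λ * V)) := by gcongr
  refine ⟨?_, ?_, ?_⟩ <;> nlinarith

/-- Union bound over entries. Each entry may fail by a bad energy or covariance in some direction,
or by a large initial response; a lies below the decay rates of all exponential terms in T, so a
single exponential covers them. -/
theorem Regular.loss_tail_of_rate (h : M.Regular R τ c K κ C σ) {β S θ Λ V ν C₀ t₀ a : ℝ}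
    (hβ : β = 2 * C / Real.sqrt τ) (hS : S = β * σ / (1 - κ)) (hθ0 : 0 < θ) (hθ1 : θ ≤ 1)
    (hθS : θ * (5 + S ^ 2 + S * (20 + 16 * S ^ 2)) ≤ 3 / 16)
    (hΛ : Λ = Real.sqrt 2 * (1 / (c * Real.sqrt τ) + R * β / (c * (1 - κ))))
    (hV : V = varBound R c K κ C σ) (hν : ν = (1 - κ) / (16 * β ^ 2)) (hC₀ : C₀ = 37 + 32 * S ^ 2)
    (ht1 : 1 ≤ t₀) (ht2 : 16 * β ^ 2 * V / (1 - κ) ≤ t₀) (ht3 : 2 * (K * Λ) ^ 2 / θ ≤ t₀)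
    (ha1 : a ≤ θ ^ 2 / (K * Λ) ^ 2) (ha2 : a ≤ θ ^ 2 / 128) (ha3 : a ≤ ν / (2 * V))
    (ha4 : a ≤ 1 - κ) (hT : t₀ * M.m ≤ M.T) {x : ℝ} (hx : 0 < x) :
    M.μ {ω | ¬ M.LossBounds (τ / 128 * M.T)
        ((4 * C₀ + 1) * (6 * V + 8 * K ^ 2 / c ^ 2) * M.m * M.T) (1024 * σ ^ 2 * C₀ * x) ω} ≤
      ENNReal.ofReal (M.N₁ * M.N₂ * ((48 * C₀) ^ M.m *
        ((9 + 9 * C ^ 2 * V / ν) * M.T * Real.exp (-(a * M.T / M.m)) + 2 * Real.exp (-x)))) := by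
  have hκ0 : 0 < κ := by linarith [h.κ_ge]
  have h1κ : 0 < 1 - κ := by linarith [h.κ_lt]
  have hC0 : 0 < C := by linarith [h.C_ge]
  have hR := h.R_pos; have hc := h.c_pos; have hK := h.K_pos; have hτ := h.τ_pos
  have hσ' : (0 : ℝ) < σ := by exact_mod_cast h.σ_pos
  have hsτ := Real.sqrt_pos.2 hτ
  have hβ0 : 0 < β := by rw [hβ]; positivity
  have hS0 : 0 < S := by rw [hS]; positivity
  have hΛ0 : 0 < Λ := by rw [hΛ]; positivity
  have hV0 : 0 < V := by rw [hV]; exact h.varBound_pos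
  have hν0 : 0 < ν := by rw [hν]; positivity
  have hC₀1 : 1 ≤ C₀ := by nlinarith [sq_nonneg S]
  have := h.prob
  have hm := m_ge (M := M)
  have hm0 : (0 : ℝ) < M.m := by linarith
  have hTm : (M.m : ℝ) ≤ M.T := by
    refine le_trans ?_ hT
    exact le_mul_of_one_le_left hm0.le ht1
  have hT3 : (3 : ℝ) ≤ M.T := hm.trans hTm
  have hT0r : (0 : ℝ) < M.T := by linarith
  have hT0 : 0 < M.T := by exact_mod_cast hT0r
  have hT1 : 16 * β ^ 2 * V / (1 - κ) * M.m ≤ M.T := by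
    refine le_trans ?_ hT
    gcongr
  have hT2 : 2 * (K * Λ) ^ 2 * M.m ≤ θ * M.T := by
    have h1 : 2 * (K * Λ) ^ 2 / θ * M.m ≤ M.T := by
      refine le_trans ?_ hT
      gcongr
    rw [div_mul_eq_mul_div, div_le_iff₀ hθ0] at h1
    linarith
  set E := Real.exp (-(a * M.T / M.m)) with hE
  have hE1 : Real.exp (-(θ ^ 2 * M.T / ((K * Λ) ^ 2 * M.m))) ≤ E := by
    apply Real.exp_le_exp.2
    rw [neg_le_neg_iff, mul_div_mul_comm, mul_div_assoc]
    gcongr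
  have hE2 : Real.exp (-(θ ^ 2 / 128 * M.T)) ≤ E := by
    apply Real.exp_le_exp.2
    rw [neg_le_neg_iff, mul_div_assoc]
    gcongr
    exact div_le_self hT0r.le (by linarith)
  have hE3 : Real.exp (-(ν * M.T / (2 * V * M.m))) ≤ E := by
    apply Real.exp_le_exp.2
    rw [neg_le_neg_iff, mul_div_mul_comm, mul_div_assoc]
    gcongr
  have hE4 : κ ^ (2 * M.T) ≤ E := by
    have h1 : κ ≤ Real.exp (-(1 - κ)) := by linarith [Real.add_one_le_exp (-(1 - κ))]
    calc κ ^ (2 * M.T) ≤ Real.exp (-(1 - κ)) ^ (2 * M.T) := by gcongr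
      _ = Real.exp (-((1 - κ) * (2 * M.T))) := by rw [← Real.exp_nat_mul]; push_cast; congr 1; ring
      _ ≤ E := by
        apply Real.exp_le_exp.2
        rw [neg_le_neg_iff, mul_div_assoc]
        gcongr
        exact (div_le_self hT0r.le (by linarith)).trans (by linarith)
  have hresp : ∀ i j, M.μ {ω | Real.sqrt (ν * M.T) ≤ |M.Y 0 ω i j|} ≤
      ENNReal.ofReal ((4 + 9 * C ^ 2 * V / ν) * E) := by
    intro i j
    rw [← ofReal_measureReal]
    apply ENNReal.ofReal_le_ofReal
    refine (h.response_tail i j (y := Real.sqrt (ν * M.T)) (by positivity)).trans ?_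
    rw [← hV]
    rw [Real.sq_sqrt (by positivity), add_mul]
    have h1 : 9 * C ^ 2 * (V * M.m) * κ ^ (2 * M.T) / (ν * M.T) ≤ 9 * C ^ 2 * V / ν * E := by
      calc _ = 9 * C ^ 2 * V / ν * (κ ^ (2 * M.T) * (M.m / M.T)) := by field_simp
        _ ≤ 9 * C ^ 2 * V / ν * (E * 1) := by
          gcongr
          exact div_le_one_of_le₀ hTm hT0r.le
        _ = _ := by ring
    exact add_le_add (by gcongr) h1
  set p := (48 * C₀) ^ M.m *
        (2 * Real.exp (-(θ ^ 2 * M.T / ((K * Λ) ^ 2 * M.m))) +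
          3 * M.T * Real.exp (-(θ ^ 2 / 128 * M.T)) + 2 * Real.exp (-x)) with hp
  have hp0 : 0 ≤ p := by positivity
  have hE0 : 0 < E := Real.exp_pos _
  set Bad : Fin M.N₁ × Fin M.N₂ → Set M.Ω := fun q =>
    {ω | (∀ i j, M.Y 0 ω i j ^ 2 ≤ ν * M.T) ∧
      ¬ ∀ v, M.T / 64 * ∫ ω, M.proj v q.1 q.2 1 ω ^ 2 ∂M.μ ≤ M.quad v q.1 q.2 ω ∧
        M.quad v q.1 q.2 ω ≤ 4 * C₀ * M.T * ∫ ω, M.proj v q.1 q.2 1 ω ^ 2 ∂M.μ ∧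
        |M.cross v q.1 q.2 ω| ≤ 2 * Real.sqrt (2 * x * σ ^ 2 * (C₀ * M.T)) *
          Real.sqrt (∫ ω, M.proj v q.1 q.2 1 ω ^ 2 ∂M.μ)} with hBad
  have hsub : {ω | ¬ M.LossBounds (τ / 128 * M.T)
      ((4 * C₀ + 1) * (6 * V + 8 * K ^ 2 / c ^ 2) * M.m * M.T) (1024 * σ ^ 2 * C₀ * x) ω} ⊆
      ⋃ q ∈ (Finset.univ : Finset (Fin M.N₁ × Fin M.N₂)),
        (Bad q ∪ {ω | Real.sqrt (ν * M.T) ≤ |M.Y 0 ω q.1 q.2|}) := by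
    intro ω hω
    by_contra hcon
    simp only [Set.mem_iUnion, not_exists, Set.mem_union, not_or] at hcon
    refine hω fun i j v => ?_
    have hY : ∀ i j, M.Y 0 ω i j ^ 2 ≤ ν * M.T := fun i j => by
      have h1 : |M.Y 0 ω i j| < Real.sqrt (ν * M.T) :=
        not_le.1 (hcon (i, j) (Finset.mem_univ _)).2
      rw [← sq_abs]
      exact ((Real.lt_sqrt (abs_nonneg _)).1 h1).le
    have h2 : ∀ v, M.T / 64 * ∫ ω, M.proj v i j 1 ω ^ 2 ∂M.μ ≤ M.quad v i j ω ∧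
        M.quad v i j ω ≤ 4 * C₀ * M.T * ∫ ω, M.proj v i j 1 ω ^ 2 ∂M.μ ∧
        |M.cross v i j ω| ≤ 2 * Real.sqrt (2 * x * σ ^ 2 * (C₀ * M.T)) *
          Real.sqrt (∫ ω, M.proj v i j 1 ω ^ 2 ∂M.μ) := by
      by_contra h3
      exact (hcon (i, j) (Finset.mem_univ _)).1 ⟨hY, h3⟩
    obtain ⟨h3, h4, h5⟩ := h2 v
    have h6 := loss_bounds_of_quad_cross (Λ := (6 * V + 8 * K ^ 2 / c ^ 2) * M.m) hT0r.le hx.le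
      hC₀1 (h.le_integral_proj_sq v i j 1) (by rw [hV]; exact h.integral_proj_sq_le v i j 1)
      (integral_nonneg fun _ => sq_nonneg _) h3 h4 h5
    refine ⟨h6.1, h6.2.1, h6.2.2.trans (le_of_eq ?_)⟩
    ring
  refine (measure_mono hsub).trans ((measure_biUnion_finset_le _ _).trans ?_)
  have hone : ∀ q ∈ (Finset.univ : Finset (Fin M.N₁ × Fin M.N₂)),
      M.μ (Bad q ∪ {ω | Real.sqrt (ν * M.T) ≤ |M.Y 0 ω q.1 q.2|}) ≤
        ENNReal.ofReal (p + (4 + 9 * C ^ 2 * V / ν) * E) := fun q _ => by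
    refine (measure_union_le _ _).trans ?_
    rw [ENNReal.ofReal_add hp0 (by positivity)]
    refine add_le_add ?_ (hresp q.1 q.2)
    have := h.pair_tail q.1 q.2 hβ hS hθ0 hθ1 hθS hΛ hT0 (by rw [← hV]; exact hT1) hT2 hC₀ hx
    rw [← hν] at this
    exact this
  refine (Finset.sum_le_sum hone).trans ?_
  rw [Finset.sum_const, nsmul_eq_mul, ← ENNReal.ofReal_natCast,
    ← ENNReal.ofReal_mul (by positivity)]
  apply ENNReal.ofReal_le_ofReal
  rw [Finset.card_univ, Fintype.card_prod, Fintype.card_fin, Fintype.card_fin, Nat.cast_mul]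
  gcongr
  have hΓ1 : 1 ≤ (48 * C₀) ^ M.m := one_le_pow₀ (by linarith)
  set Γ := (48 * C₀) ^ M.m
  set W := 9 * C ^ 2 * V / ν
  have hW : 0 ≤ W := by positivity
  set X := Real.exp (-x)
  have h2 : (4 + W) * E ≤ Γ * ((4 + W) * M.T * E) := by
    calc (4 + W) * E = 1 * ((4 + W) * 1 * E) := by ring
      _ ≤ Γ * ((4 + W) * M.T * E) := by gcongr; linarith
  have h3 : p ≤ Γ * (2 * E + 3 * M.T * E + 2 * X) := by rw [hp]; gcongr
  calc p + (4 + W) * E ≤ Γ * (2 * E + 3 * M.T * E + 2 * X) + Γ * ((4 + W) * M.T * E) :=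
        add_le_add h3 h2
    _ = Γ * ((2 + 3 * M.T + (4 + W) * M.T) * E + 2 * X) := by ring
    _ ≤ Γ * ((9 + W) * M.T * E + 2 * X) := by
        have : 2 + 3 * M.T + (4 + W) * M.T ≤ (9 + W) * M.T := by linarith
        gcongr

/-- With high probability all losses are quadratic up to a noise level. -/
theorem loss_tail (hR : 0 < R) (hτ : 0 < τ) (hc : 0 < c) (hK : 0 < K) (hκ : 1 / 2 ≤ κ)
    (hκ1 : κ < 1) (hC : 1 ≤ C) (hσ : 0 < σ) :
    ∃ α β b t₀ Γ a D : ℝ, 0 < α ∧ 0 < β ∧ 0 < b ∧ 1 ≤ t₀ ∧ 1 ≤ Γ ∧ 0 < a ∧ 0 < D ∧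
      ∀ M : GMNAR, M.Regular R τ c K κ C σ → t₀ * M.m ≤ M.T → ∀ x : ℝ, 0 < x →
        M.μ {ω | ¬ M.LossBounds (α * M.T) (β * M.m * M.T) (b * x) ω} ≤
          ENNReal.ofReal (M.N₁ * M.N₂ * (Γ ^ M.m *
            (D * M.T * Real.exp (-(a * M.T / M.m)) + 2 * Real.exp (-x)))) := by
  have hκ0 : 0 < κ := by linarith
  have h1κ : 0 < 1 - κ := by linarith
  have hC0 : 0 < C := by linarith
  have hσ' : (0 : ℝ) < σ := by exact_mod_cast hσ
  have hsτ := Real.sqrt_pos.2 hτ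
  obtain ⟨β, hβ⟩ : ∃ z, z = 2 * C / Real.sqrt τ := ⟨_, rfl⟩
  have hβ0 : 0 < β := by rw [hβ]; positivity
  obtain ⟨S, hS⟩ : ∃ z, z = β * σ / (1 - κ) := ⟨_, rfl⟩
  have hS0 : 0 < S := by rw [hS]; positivity
  obtain ⟨θ, hθ⟩ : ∃ z, z = min 1 (3 / 16 / (5 + S ^ 2 + S * (20 + 16 * S ^ 2))) := ⟨_, rfl⟩
  have hθ0 : 0 < θ := hθ ▸ lt_min one_pos (by positivity)
  have hθ1 : θ ≤ 1 := hθ ▸ min_le_left _ _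
  have hθS : θ * (5 + S ^ 2 + S * (20 + 16 * S ^ 2)) ≤ 3 / 16 := by
    rw [← le_div_iff₀ (by positivity), hθ]; exact min_le_right _ _
  obtain ⟨Λ, hΛ⟩ : ∃ z, z = Real.sqrt 2 * (1 / (c * Real.sqrt τ) + R * β / (c * (1 - κ))) := ⟨_, rfl⟩
  have hΛ0 : 0 < Λ := by rw [hΛ]; positivity
  obtain ⟨V, hV⟩ : ∃ z, z = varBound R c K κ C σ := ⟨_, rfl⟩
  have hV0 : 0 < V := by rw [hV]; unfold varBound; positivity
  obtain ⟨ν, hν⟩ : ∃ z, z = (1 - κ) / (16 * β ^ 2) := ⟨_, rfl⟩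
  have hν0 : 0 < ν := by rw [hν]; positivity
  obtain ⟨C₀, hC₀⟩ : ∃ z, z = 37 + 32 * S ^ 2 := ⟨_, rfl⟩
  have hC₀1 : 1 ≤ C₀ := by nlinarith [sq_nonneg S]
  have ha0 : 0 < min (min (θ ^ 2 / (K * Λ) ^ 2) (θ ^ 2 / 128)) (min (ν / (2 * V)) (1 - κ)) :=
    lt_min (lt_min (by positivity) (by positivity)) (lt_min (by positivity) h1κ)
  refine ⟨τ / 128, (4 * C₀ + 1) * (6 * V + 8 * K ^ 2 / c ^ 2), 1024 * σ ^ 2 * C₀,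
    max 1 (max (16 * β ^ 2 * V / (1 - κ)) (2 * (K * Λ) ^ 2 / θ)), 48 * C₀,
    min (min (θ ^ 2 / (K * Λ) ^ 2) (θ ^ 2 / 128)) (min (ν / (2 * V)) (1 - κ)),
    9 + 9 * C ^ 2 * V / ν, by positivity, by positivity, by positivity, le_max_left _ _,
    by linarith, ha0, by positivity, fun M h hT x hx => ?_⟩
  exact h.loss_tail_of_rate hβ hS hθ0 hθ1 hθS hΛ hV hν hC₀ (le_max_left _ _)
    ((le_max_left _ _).trans (le_max_right _ _)) ((le_max_right _ _).trans (le_max_right _ _))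
    ((min_le_left _ _).trans (min_le_left _ _)) ((min_le_left _ _).trans (min_le_right _ _))
    ((min_le_right _ _).trans (min_le_left _ _)) ((min_le_right _ _).trans (min_le_right _ _)) hT hx

end GMNAR

/-! ### Deterministic recovery of the memberships and of the oracle. -/

theorem sum_Icc_one_int (T : ℕ) (f : ℤ → ℝ) :
    ∑ t ∈ Finset.Icc (1 : ℤ) T, f t = ∑ t ∈ Finset.range T, f (t + 1) := by
  symm
  refine Finset.sum_bij (fun t _ => (t : ℤ) + 1) (fun t ht => ?_) (fun a _ b _ hab => by omega)
    (fun t ht => ?_) fun t _ => rfl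
  · have := Finset.mem_range.1 ht
    rw [Finset.mem_Icc]; omega
  · have := Finset.mem_Icc.1 ht
    exact ⟨(t - 1).toNat, Finset.mem_range.2 (by omega), by omega⟩

/-- Separation in the maximum over groups gives separation on average over members. -/
theorem card_mul_gap_le {J H : Type*} [Fintype J] [Fintype H] [DecidableEq H] [Nonempty J]
    {h₀ : J → H} {cpi x : ℝ} (hcpi : cpi ≤ 1) (hx : 0 ≤ x) (f : H → ℝ)
    (hprop : ∀ b, cpi * Fintype.card J ≤ ((Finset.univ.filter fun j => h₀ j = b).card : ℝ)) :
    Fintype.card J * (cpi * (x + ⨆ b, |f b| ^ 2)) ≤ ∑ j, (x + f (h₀ j) ^ 2) := by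
  have : Nonempty H := ⟨h₀ (Classical.arbitrary J)⟩
  obtain ⟨b, hb⟩ := exists_eq_ciSup_of_finite (f := fun b => |f b| ^ 2)
  rw [← hb, sq_abs, Finset.sum_add_distrib, Finset.sum_const, Finset.card_univ, nsmul_eq_mul]
  have h1 : ((Finset.univ.filter fun j => h₀ j = b).card : ℝ) * f b ^ 2 ≤ ∑ j, f (h₀ j) ^ 2 := by
    rw [← nsmul_eq_mul, ← Finset.sum_const]
    calc ∑ _j ∈ Finset.univ.filter fun j => h₀ j = b, f b ^ 2
        = ∑ j ∈ Finset.univ.filter fun j => h₀ j = b, f (h₀ j) ^ 2 :=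
          Finset.sum_congr rfl fun j hj => by rw [(Finset.mem_filter.1 hj).2]
      _ ≤ _ := Finset.sum_le_univ_sum_of_nonneg fun j => sq_nonneg _
  have h2 := mul_le_mul_of_nonneg_right (hprop b) (sq_nonneg (f b))
  have h3 : (Fintype.card J : ℝ) * (cpi * x) ≤ Fintype.card J * x := by
    gcongr
    exact mul_le_of_le_one_left hx hcpi
  linarith

namespace GMNAR

variable {M : GMNAR}

theorem loss_eq_sum (v : M.RegIdx → ℝ) (i : Fin M.N₁) (j : Fin M.N₂) (ω : M.Ω) :
    M.loss v i j ω = ∑ t ∈ Finset.range M.T,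
      (M.proj v i j (t + 1) ω ^ 2 - 2 * (M.proj v i j (t + 1) ω * M.resid i j (t + 1) ω)) := by
  rw [loss, quad, cross, Finset.mul_sum, Finset.sum_sub_distrib]

theorem proj_sub (v w : M.RegIdx → ℝ) (i : Fin M.N₁) (j : Fin M.N₂) (t : ℤ) (ω : M.Ω) :
    M.proj (v - w) i j t ω = M.proj v i j t ω - M.proj w i j t ω := by
  simp only [proj, Pi.sub_apply, sub_mul, Finset.sum_sub_distrib]

/-- The objective, relative to its value at the truth, is a sum of losses. -/
theorem Q_eq_add_loss (ω : M.Ω) (θ : M.Params) (g : Fin M.N₁ → Fin M.G) (h : Fin M.N₂ → Fin M.H) :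
    M.Q ω θ g h = M.Q ω M.θ₀ M.g₀ M.h₀ + ∑ i, ∑ j,
      M.loss (coefVec θ (g i) (h j) - coefVec M.θ₀ (M.g₀ i) (M.h₀ j)) i j ω := by
  simp only [Q, ← Finset.sum_add_distrib]
  refine Finset.sum_congr rfl fun i _ => Finset.sum_congr rfl fun j _ => ?_
  rw [sum_Icc_one_int, sum_Icc_one_int, loss_eq_sum, ← Finset.sum_add_distrib]
  refine Finset.sum_congr rfl fun t _ => ?_
  rw [proj_sub, resid]
  simp only [fitted_eq_proj]
  ring

/-- Parallelogram identity: the covariance part is linear, so only the energy contributes to the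
convexity gap. -/
theorem loss_midpoint (u w : M.RegIdx → ℝ) (i : Fin M.N₁) (j : Fin M.N₂) (ω : M.Ω) :
    M.loss ((1 / 2 : ℝ) • (u + w)) i j ω =
      (M.loss u i j ω + M.loss w i j ω) / 2 - M.quad (u - w) i j ω / 4 := by
  rw [loss_eq_sum, loss_eq_sum, loss_eq_sum, quad, ← Finset.sum_add_distrib, Finset.sum_div,
    Finset.sum_div, ← Finset.sum_sub_distrib]
  refine Finset.sum_congr rfl fun t _ => ?_
  rw [proj_smul, proj_add, proj_sub]
  ring

section Classification

variable {ω : M.Ω} {α β b cpi cgap : ℝ} {D : Set ℝ} {θ : M.Params} {g : Fin M.N₁ → Fin M.G}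
  {h : Fin M.N₂ → Fin M.H}

theorem GroupProportion.le_one (hp : M.GroupProportion cpi) (hN : 0 < M.N₁) : cpi ≤ 1 := by
  refine (hp.1 (M.g₀ ⟨0, hN⟩)).trans (div_le_one_of_le₀ ?_ (by positivity))
  exact_mod_cast (Finset.card_le_univ _).trans (by simp)

theorem GroupProportion.row (hp : M.GroupProportion cpi) (hN : 0 < M.N₁) (a : Fin M.G) :
    cpi * Fintype.card (Fin M.N₁) ≤ ((Finset.univ.filter fun i => M.g₀ i = a).card : ℝ) := by
  rw [Fintype.card_fin, ← le_div_iff₀ (by exact_mod_cast hN)]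
  exact hp.1 a

theorem GroupProportion.col (hp : M.GroupProportion cpi) (hN : 0 < M.N₂) (a : Fin M.H) :
    cpi * Fintype.card (Fin M.N₂) ≤ ((Finset.univ.filter fun i => M.h₀ i = a).card : ℝ) := by
  rw [Fintype.card_fin, ← le_div_iff₀ (by exact_mod_cast hN)]
  exact hp.2 a

theorem IsEstimate.sum_loss_le (he : M.IsEstimate D ω θ g h) {θ' : M.Params}
    {g' : Fin M.N₁ → Fin M.G} {h' : Fin M.N₂ → Fin M.H} (hθ' : θ'.CoordsIn D) :
    ∑ i, ∑ j, M.loss (coefVec θ (g i) (h j) - coefVec M.θ₀ (M.g₀ i) (M.h₀ j)) i j ω ≤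
      ∑ i, ∑ j, M.loss (coefVec θ' (g' i) (h' j) - coefVec M.θ₀ (M.g₀ i) (M.h₀ j)) i j ω := by
  have h1 := he.2 θ' g' h' hθ'
  rw [Q_eq_add_loss ω θ, Q_eq_add_loss ω θ'] at h1
  linarith

theorem loss_zero (i : Fin M.N₁) (j : Fin M.N₂) : M.loss 0 i j ω = 0 := by
  simp [loss, quad, cross, proj]

theorem IsEstimate.sum_loss_nonpos (he : M.IsEstimate D ω θ g h) (hθ₀ : M.θ₀.CoordsIn D) :
    ∑ i, ∑ j, M.loss (coefVec θ (g i) (h j) - coefVec M.θ₀ (M.g₀ i) (M.h₀ j)) i j ω ≤ 0 := by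
  refine (he.sum_loss_le (g' := M.g₀) (h' := M.h₀) hθ₀).trans (le_of_eq ?_)
  simp [loss_zero]

/-- Changing one label affects only its own summand, so joint minimality implies optimality row by
row. -/
theorem sum_le_of_sum_update_le {I A : Type*} [Fintype I] [DecidableEq I] {r : I → A → ℝ}
    {g : I → A} {i : I} {a : A} (h : ∑ k, r k (g k) ≤ ∑ k, r k (Function.update g i a k)) :
    r i (g i) ≤ r i a := by
  have h1 : ∑ k, (r k (Function.update g i a k) - r k (g k)) = r i a - r i (g i) := by
    rw [Finset.sum_eq_single i _ (fun h => absurd (Finset.mem_univ i) h), Function.update_self]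
    intro k _ hk
    rw [Function.update_of_ne hk, sub_self]
  rw [Finset.sum_sub_distrib] at h1
  linarith

theorem norm_toLp_sub_sq {n : Type*} [Fintype n] (v w : n → ℝ) :
    ‖(WithLp.toLp 2 v : EuclideanSpace ℝ n) - WithLp.toLp 2 w‖ ^ 2 = ∑ a, (v a - w a) ^ 2 := by
  rw [EuclideanSpace.norm_sq_eq]
  simp [sq_abs]

theorem IsEstimate.exists_perm_row (he : M.IsEstimate D ω θ g h) (hθ₀ : M.θ₀.CoordsIn D)
    (hL : M.LossBounds α β b ω) (hN₁ : 0 < M.N₁) (hN₂ : 0 < M.N₂) (hα : 0 < α) (hβ : 0 ≤ β)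
    (hb : 0 ≤ b) (hcpi : 0 < cpi) (hp : M.GroupProportion cpi) (hgap : M.GroupDifference cgap)
    (hd : 2 * b * (β + 3 * α) < cpi * cgap * α ^ 2 * cpi) :
    ∃ s : Equiv.Perm (Fin M.G), ∀ i, g i = s (M.g₀ i) := by
  have : Nonempty (Fin M.N₁) := ⟨⟨0, hN₁⟩⟩
  have : Nonempty (Fin M.N₂) := ⟨⟨0, hN₂⟩⟩
  refine exists_perm_of_loss (V := EuclideanSpace ℝ M.RegIdx)
    (P := fun a j => WithLp.toLp 2 (coefVec M.θ₀ a (M.h₀ j)))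
    (Phat := fun a j => WithLp.toLp 2 (coefVec θ a (h j)))
    (F := fun i j v => M.loss v.ofLp i j ω) hα hβ hb hcpi (hp.le_one hN₁) (fun i j v => ?_)
    (fun i j v => ?_) ?_ (fun i a => ?_) (hp.row hN₁) (fun a a' haa' => ?_) hd
  · rw [EuclideanSpace.norm_sq_eq]
    simpa only [Real.norm_eq_abs, sq_abs] using (hL i j v.ofLp).2.1
  · rw [EuclideanSpace.norm_sq_eq]
    simpa only [Real.norm_eq_abs, sq_abs] using (hL i j v.ofLp).2.2
  · exact he.sum_loss_nonpos hθ₀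
  · have h1 := he.sum_loss_le (g' := Function.update g i a) (h' := h) he.1
    exact sum_le_of_sum_update_le (r := fun k a => ∑ j,
      M.loss (coefVec θ a (h j) - coefVec M.θ₀ (M.g₀ k) (M.h₀ j)) k j ω) h1
  · have h1 := card_mul_gap_le (J := Fin M.N₂) (h₀ := M.h₀) (cpi := cpi)
      (x := (M.θ₀.lam a - M.θ₀.lam a') ^ 2 + ∑ k, (M.θ₀.zeta a k - M.θ₀.zeta a' k) ^ 2)
      (hp.le_one hN₁) (by positivity) (fun b => M.θ₀.alpha a b - M.θ₀.alpha a' b)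
      (hp.col hN₂)
    calc _ ≤ _ := by
          refine mul_le_mul_of_nonneg_left (mul_le_mul_of_nonneg_left ?_ hcpi.le) (by positivity)
          exact hgap.1 a a' haa'
      _ ≤ _ := h1
      _ = _ := by
        refine Finset.sum_congr rfl fun j _ => ?_
        rw [norm_toLp_sub_sq, sum_regIdx]
        simp [coefVec]

theorem IsEstimate.exists_perm_col (he : M.IsEstimate D ω θ g h) (hθ₀ : M.θ₀.CoordsIn D)
    (hL : M.LossBounds α β b ω) (hN₁ : 0 < M.N₁) (hN₂ : 0 < M.N₂) (hα : 0 < α) (hβ : 0 ≤ β)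
    (hb : 0 ≤ b) (hcpi : 0 < cpi) (hp : M.GroupProportion cpi) (hgap : M.GroupDifference cgap)
    (hd : 2 * b * (β + 3 * α) < cpi * cgap * α ^ 2 * cpi) :
    ∃ r : Equiv.Perm (Fin M.H), ∀ j, h j = r (M.h₀ j) := by
  have : Nonempty (Fin M.N₁) := ⟨⟨0, hN₁⟩⟩
  have : Nonempty (Fin M.N₂) := ⟨⟨0, hN₂⟩⟩
  refine exists_perm_of_loss (V := EuclideanSpace ℝ M.RegIdx)
    (P := fun b i => WithLp.toLp 2 (coefVec M.θ₀ (M.g₀ i) b))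
    (Phat := fun b i => WithLp.toLp 2 (coefVec θ (g i) b))
    (F := fun j i v => M.loss v.ofLp i j ω) hα hβ hb hcpi (hp.le_one hN₁) (fun j i v => ?_)
    (fun j i v => ?_) ?_ (fun j a => ?_) (hp.col hN₂) (fun a a' haa' => ?_) hd
  · rw [EuclideanSpace.norm_sq_eq]
    simpa only [Real.norm_eq_abs, sq_abs] using (hL i j v.ofLp).2.1
  · rw [EuclideanSpace.norm_sq_eq]
    simpa only [Real.norm_eq_abs, sq_abs] using (hL i j v.ofLp).2.2
  · rw [Finset.sum_comm]
    exact he.sum_loss_nonpos hθ₀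
  · have h1 := he.sum_loss_le (g' := g) (h' := Function.update h j a) he.1
    rw [Finset.sum_comm] at h1
    rw [Finset.sum_comm (f := fun i j => M.loss (coefVec θ (g i) (Function.update h _ a j) -
      coefVec M.θ₀ (M.g₀ i) (M.h₀ j)) i j ω)] at h1
    exact sum_le_of_sum_update_le (r := fun k a => ∑ i,
      M.loss (coefVec θ (g i) a - coefVec M.θ₀ (M.g₀ i) (M.h₀ k)) i k ω) h1
  · have h1 := card_mul_gap_le (J := Fin M.N₁) (h₀ := M.g₀) (cpi := cpi)
      (x := (M.θ₀.gam a - M.θ₀.gam a') ^ 2 + ∑ k, (M.θ₀.delta a k - M.θ₀.delta a' k) ^ 2)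
      (hp.le_one hN₁) (by positivity) (fun b => M.θ₀.alpha b a - M.θ₀.alpha b a')
      (hp.row hN₁)
    calc _ ≤ _ := by
          refine mul_le_mul_of_nonneg_left (mul_le_mul_of_nonneg_left ?_ hcpi.le) (by positivity)
          exact hgap.2 a a' haa'
      _ ≤ _ := h1
      _ = _ := by
        refine Finset.sum_congr rfl fun j _ => ?_
        rw [norm_toLp_sub_sq, sum_regIdx]
        simp [coefVec]

/-- The midpoint of two parameters. -/
noncomputable def midParam (θ θ' : M.Params) : M.Params where
  lam g := (θ.lam g + θ'.lam g) / 2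
  zeta g k := (θ.zeta g k + θ'.zeta g k) / 2
  gam h := (θ.gam h + θ'.gam h) / 2
  delta h k := (θ.delta h k + θ'.delta h k) / 2
  alpha g h := (θ.alpha g h + θ'.alpha g h) / 2

theorem coordsIn_midParam (hD : ∀ x ∈ D, ∀ y ∈ D, (x + y) / 2 ∈ D) {θ θ' : M.Params}
    (h1 : θ.CoordsIn D) (h2 : θ'.CoordsIn D) : (midParam θ θ').CoordsIn D :=
  ⟨fun g => hD _ (h1.1 g) _ (h2.1 g), fun g k => hD _ (h1.2.1 g k) _ (h2.2.1 g k),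
    fun g => hD _ (h1.2.2.1 g) _ (h2.2.2.1 g), fun g k => hD _ (h1.2.2.2.1 g k) _ (h2.2.2.2.1 g k),
    fun g k => hD _ (h1.2.2.2.2 g k) _ (h2.2.2.2.2 g k)⟩

theorem coefVec_midParam (θ θ' : M.Params) (a : Fin M.G) (b : Fin M.H) :
    coefVec (midParam θ θ') a b = (1 / 2 : ℝ) • (coefVec θ a b + coefVec θ' a b) := by
  ext x
  rcases x with x | x | x | x | x <;> simp [coefVec, midParam] <;> ring

/-- The oracle estimator is unique when the empirical second moments are positive definite. -/
theorem IsOracle.eq (hL : M.LossBounds α β b ω) (hα : 0 < α) (hN₁ : 0 < M.N₁) (hN₂ : 0 < M.N₂)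
    (hcpi : 0 < cpi) (hp : M.GroupProportion cpi) (hD : ∀ x ∈ D, ∀ y ∈ D, (x + y) / 2 ∈ D)
    {θ θ' : M.Params} (h1 : M.IsOracle D ω θ) (h2 : M.IsOracle D ω θ') : θ = θ' := by
  have q1 := h1.2 _ (coordsIn_midParam hD h1.1 h2.1)
  have q2 := h2.2 _ (coordsIn_midParam hD h1.1 h2.1)
  rw [Q_eq_add_loss ω θ, Q_eq_add_loss ω (midParam θ θ')] at q1
  rw [Q_eq_add_loss ω θ', Q_eq_add_loss ω (midParam θ θ')] at q2
  set u : Fin M.N₁ → Fin M.N₂ → M.RegIdx → ℝ := fun i j =>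
    coefVec θ (M.g₀ i) (M.h₀ j) - coefVec M.θ₀ (M.g₀ i) (M.h₀ j)
  set w : Fin M.N₁ → Fin M.N₂ → M.RegIdx → ℝ := fun i j =>
    coefVec θ' (M.g₀ i) (M.h₀ j) - coefVec M.θ₀ (M.g₀ i) (M.h₀ j)
  have e : ∀ i j, M.loss (coefVec (midParam θ θ') (M.g₀ i) (M.h₀ j) -
      coefVec M.θ₀ (M.g₀ i) (M.h₀ j)) i j ω =
      (M.loss (u i j) i j ω + M.loss (w i j) i j ω) / 2 - M.quad (u i j - w i j) i j ω / 4 := by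
    intro i j
    rw [← loss_midpoint, coefVec_midParam]
    congr 1
    simp only [u, w]
    module
  -- Both minimizers are compared with their midpoint; adding the two inequalities shows that the
  -- energy of their difference is at most zero.
  simp only [e, Finset.sum_sub_distrib, ← Finset.sum_div, Finset.sum_add_distrib] at q1 q2
  have hq0 : ∀ i j, 0 ≤ M.quad (u i j - w i j) i j ω := fun i j =>
    Finset.sum_nonneg fun _ _ => sq_nonneg _
  have hsum : ∑ i, ∑ j, M.quad (u i j - w i j) i j ω ≤ 0 := by linarith
  have hz : ∀ i j, coefVec θ (M.g₀ i) (M.h₀ j) = coefVec θ' (M.g₀ i) (M.h₀ j) := by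
    intro i j
    have h3 : M.quad (u i j - w i j) i j ω ≤ 0 := by
      refine le_trans ?_ hsum
      refine le_trans ?_ (Finset.single_le_sum (f := fun i => ∑ j, M.quad (u i j - w i j) i j ω)
        (fun i _ => Finset.sum_nonneg fun j _ => hq0 i j) (Finset.mem_univ i))
      exact Finset.single_le_sum (f := fun j => M.quad (u i j - w i j) i j ω)
        (fun j _ => hq0 i j) (Finset.mem_univ j)
    have h4 := (hL i j (u i j - w i j)).1
    have h5 : ∑ a, (u i j - w i j) a ^ 2 ≤ 0 := by
      by_contra hcon
      have := mul_pos hα (not_le.1 hcon)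
      linarith
    have h6 := (Finset.sum_eq_zero_iff_of_nonneg fun a _ => sq_nonneg ((u i j - w i j) a)).1
      (le_antisymm h5 (Finset.sum_nonneg fun a _ => sq_nonneg _))
    ext a
    have h7 := h6 a (Finset.mem_univ a)
    simp only [u, w, Pi.sub_apply] at h7
    have h8 := pow_eq_zero_iff two_ne_zero |>.1 h7
    linarith
  -- Every true group is inhabited, so agreement of the coefficient vectors at all entries
  -- determines every coordinate of the parameter.
  have hrow : ∀ a, ∃ i, M.g₀ i = a := fun a => by
    have h3 := hp.row hN₁ a
    have h4 : (0 : ℝ) < cpi * Fintype.card (Fin M.N₁) := by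
      rw [Fintype.card_fin]; have : (0 : ℝ) < M.N₁ := by exact_mod_cast hN₁
      positivity
    have h5 : 0 < (Finset.univ.filter fun i => M.g₀ i = a).card := by exact_mod_cast h4.trans_le h3
    obtain ⟨i, hi⟩ := Finset.card_pos.1 h5
    exact ⟨i, (Finset.mem_filter.1 hi).2⟩
  have hcol : ∀ a, ∃ i, M.h₀ i = a := fun a => by
    have h3 := hp.col hN₂ a
    have h4 : (0 : ℝ) < cpi * Fintype.card (Fin M.N₂) := by
      rw [Fintype.card_fin]; have : (0 : ℝ) < M.N₂ := by exact_mod_cast hN₂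
      positivity
    have h5 : 0 < (Finset.univ.filter fun i => M.h₀ i = a).card := by exact_mod_cast h4.trans_le h3
    obtain ⟨i, hi⟩ := Finset.card_pos.1 h5
    exact ⟨i, (Finset.mem_filter.1 hi).2⟩
  ext a
  · obtain ⟨i, rfl⟩ := hrow a
    exact congrFun (hz i ⟨0, hN₂⟩) M.ixRow
  · rename_i k
    obtain ⟨i, rfl⟩ := hrow a
    exact congrFun (hz i ⟨0, hN₂⟩) (M.ixX k)
  · obtain ⟨j, rfl⟩ := hcol a
    exact congrFun (hz ⟨0, hN₁⟩ j) M.ixCol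
  · rename_i k
    obtain ⟨j, rfl⟩ := hcol a
    exact congrFun (hz ⟨0, hN₁⟩ j) (M.ixZ k)
  · rename_i b
    obtain ⟨i, rfl⟩ := hrow a
    obtain ⟨j, rfl⟩ := hcol b
    exact congrFun (hz i j) M.ixLag

/-- The relabelled parameter at the true memberships has the same objective as the estimate, which
is minimal over all memberships, in particular over the true ones. -/
theorem IsEstimate.isOracle_relabel (he : M.IsEstimate D ω θ g h) {s : Equiv.Perm (Fin M.G)}
    {r : Equiv.Perm (Fin M.H)} (hs : ∀ i, g i = s (M.g₀ i)) (hr : ∀ j, h j = r (M.h₀ j)) :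
    M.IsOracle D ω (θ.relabel s r) := by
  refine ⟨⟨fun a => he.1.1 _, fun a => he.1.2.1 _, fun a => he.1.2.2.1 _, fun a => he.1.2.2.2.1 _,
    fun a b => he.1.2.2.2.2 _ _⟩, fun θ' hθ' => ?_⟩
  have h1 := he.2 θ' M.g₀ M.h₀ hθ'
  have e : M.Q ω θ g h = M.Q ω (θ.relabel s r) M.g₀ M.h₀ := by
    rw [funext hs, funext hr]; rfl
  rwa [e] at h1

/-- Exact recovery of the memberships, and of the oracle estimator, on the event where the losses
are quadratic up to noise. -/
theorem IsEstimate.exists_relabel_eq_oracle (he : M.IsEstimate D ω θ g h) {θor : M.Params}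
    (ho : M.IsOracle D ω θor) (hD : ∀ x ∈ D, ∀ y ∈ D, (x + y) / 2 ∈ D) (hθ₀ : M.θ₀.CoordsIn D)
    (hL : M.LossBounds α β b ω) (hN₁ : 0 < M.N₁) (hN₂ : 0 < M.N₂) (hα : 0 < α) (hβ : 0 ≤ β)
    (hb : 0 ≤ b) (hcpi : 0 < cpi) (hp : M.GroupProportion cpi) (hgap : M.GroupDifference cgap)
    (hd : 2 * b * (β + 3 * α) < cpi * cgap * α ^ 2 * cpi) :
    ∃ (s : Equiv.Perm (Fin M.G)) (r : Equiv.Perm (Fin M.H)),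
      (∀ i, g i = s (M.g₀ i)) ∧ (∀ j, h j = r (M.h₀ j)) ∧ θ.relabel s r = θor := by
  obtain ⟨s, hs⟩ := he.exists_perm_row hθ₀ hL hN₁ hN₂ hα hβ hb hcpi hp hgap hd
  obtain ⟨r, hr⟩ := he.exists_perm_col hθ₀ hL hN₁ hN₂ hα hβ hb hcpi hp hgap hd
  exact ⟨s, r, hs, hr,
    IsOracle.eq hL hα hN₁ hN₂ hcpi hp hD (he.isOracle_relabel hs hr) ho⟩

end Classification

end GMNAR

/-! ### Asymptotics under the rate condition. -/

theorem WithProbToOne.mono {M : ℕ → GMNAR} {S S' : ∀ n, Set (M n).Ω} (h : WithProbToOne M S)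
    (hS : ∀ n, S n ⊆ S' n) : WithProbToOne M S' := by
  obtain ⟨A, h1, h2, h3⟩ := h
  exact ⟨A, h1, fun n => (h2 n).trans (hS n), h3⟩

/-- The estimators need not be measurable, so the measurable sets are complements of measurable
hulls of the exceptional sets, which have the same outer measure. -/
theorem withProbToOne_of_tail {M : ℕ → GMNAR} {S : ∀ n, Set (M n).Ω}
    (hprob : ∀ n, IsProbabilityMeasure (M n).μ) {p : ℕ → ℝ} (hp : Tendsto p atTop (𝓝 0))
    (h : ∀ᶠ n in atTop, ∃ B : Set (M n).Ω, (M n).μ B ≤ ENNReal.ofReal (p n) ∧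
      ∀ᵐ ω ∂(M n).μ, ω ∉ B → ω ∈ S n) : WithProbToOne M S := by
  have h0 : Tendsto (fun n => (M n).μ (S n)ᶜ) atTop (𝓝 0) := by
    have h1 : Tendsto (fun n => ENNReal.ofReal (p n)) atTop (𝓝 0) := by
      simpa using ENNReal.tendsto_ofReal hp
    refine tendsto_of_tendsto_of_tendsto_of_le_of_le' tendsto_const_nhds h1
      (Eventually.of_forall fun _ => zero_le) ?_
    filter_upwards [h] with n hn
    obtain ⟨B, hB, hS⟩ := hn
    refine le_trans (measure_mono_ae ?_) hB
    filter_upwards [hS] with ω hω hmem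
    by_contra hcon
    exact hmem (hω hcon)
  refine ⟨fun n => (toMeasurable (M n).μ (S n)ᶜ)ᶜ, fun n => (measurableSet_toMeasurable _ _).compl,
    fun n => Set.compl_subset_comm.1 (subset_toMeasurable _ _), ?_⟩
  have e : ∀ n, (M n).μ (toMeasurable (M n).μ (S n)ᶜ)ᶜ = 1 - (M n).μ (S n)ᶜ := fun n => by
    have := hprob n
    rw [prob_compl_eq_one_sub (measurableSet_toMeasurable _ _), measure_toMeasurable]
  simp_rw [e]
  simpa using ENNReal.Tendsto.sub (tendsto_const_nhds (x := (1 : ENNReal))) h0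
    (Or.inl ENNReal.one_ne_top)

namespace GMNAR

variable {M : GMNAR} {κ C : ℝ}

theorem Stationarity.one_le (h : M.Stationarity κ C) (h1 : 0 < M.N₁) (h2 : 0 < M.N₂) : 1 ≤ C := by
  simpa using h.2.1 0 (fun _ _ => 1) (by simp) ⟨0, h1⟩ ⟨0, h2⟩

theorem Stationarity.nonneg (h : M.Stationarity κ C) (h1 : 0 < M.N₁) (h2 : 0 < M.N₂) : 0 ≤ κ := by
  have h3 := (abs_nonneg _).trans (h.2.1 1 (fun _ _ => 1) (by simp) ⟨0, h1⟩ ⟨0, h2⟩)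
  have h4 := h.one_le h1 h2
  rw [pow_one] at h3
  exact nonneg_of_mul_nonneg_right h3 (by linarith)

theorem tendsto_mul_exp_neg_sqrt : Tendsto (fun T : ℕ => (T : ℝ) * Real.exp (-Real.sqrt T)) atTop
    (𝓝 0) := by
  have h1 := (Real.tendsto_pow_mul_exp_neg_atTop_nhds_zero 2).comp
    (Real.tendsto_sqrt_atTop.comp tendsto_natCast_atTop_atTop)
  refine h1.congr fun T => ?_
  simp only [Function.comp_apply]
  rw [Real.sq_sqrt (by positivity)]

/-- The failure probability, in terms of the complexity `L` and `√T / L`. -/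
theorem failure_bound {n T m Γ D a γ L : ℝ} {k : ℕ} (hk : (k : ℝ) = m) (hT : 1 ≤ T) (hΓ : 1 ≤ Γ)
    (hD : 0 < D) (hγ : γ = 1 + Real.log Γ) (hm : 0 < m)
    (hnL : n ≤ Real.exp (L - m)) (hmL : m ≤ L) (h1 : γ * L ≤ Real.sqrt T)
    (h2 : 2 * L ≤ a * Real.sqrt T) :
    n * (Γ ^ k * (D * T * Real.exp (-(a * T / m)) + 2 * Real.exp (-((γ + 1) * L)))) ≤
      D * (T * Real.exp (-Real.sqrt T)) + 2 * Real.exp (-L) := by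
  have hlog : 0 ≤ Real.log Γ := Real.log_nonneg hΓ
  have hΓk : Γ ^ k = Real.exp (m * Real.log Γ) := by
    rw [← hk, Real.exp_nat_mul, Real.exp_log (by linarith)]
  have hL : 0 < L := by linarith
  -- Entries contribute exp(L - m) and the net exp(m log Γ); with γ = 1 + log Γ both fit into
  -- exp(γL).
  have h3 : n * Γ ^ k ≤ Real.exp (γ * L) := by
    calc n * Γ ^ k ≤ Real.exp (L - m) * Real.exp (m * Real.log Γ) := by
          rw [hΓk]; gcongr
      _ = Real.exp (L - m + m * Real.log Γ) := (Real.exp_add _ _).symm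
      _ ≤ _ := by
        apply Real.exp_le_exp.2
        rw [hγ]
        nlinarith
  have hsT := Real.sq_sqrt (show (0 : ℝ) ≤ T by linarith)
  have hsT0 := Real.sqrt_nonneg T
  -- One √T pays for the union bound exp(γL), the other remains as decay.
  have h4 : 2 * Real.sqrt T ≤ a * T / m := by
    rw [le_div_iff₀ hm]
    calc 2 * Real.sqrt T * m ≤ 2 * Real.sqrt T * L := by gcongr
      _ = 2 * L * Real.sqrt T := by ring
      _ ≤ a * Real.sqrt T * Real.sqrt T := by gcongr
      _ = a * T := by rw [mul_assoc, ← sq, hsT]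
  have h5 : Real.exp (γ * L) * Real.exp (-(a * T / m)) ≤ Real.exp (-Real.sqrt T) := by
    rw [← Real.exp_add]
    apply Real.exp_le_exp.2
    linarith
  have h6 : Real.exp (γ * L) * Real.exp (-((γ + 1) * L)) = Real.exp (-L) := by
    rw [← Real.exp_add]; congr 1; ring
  calc n * (Γ ^ k * (D * T * Real.exp (-(a * T / m)) + 2 * Real.exp (-((γ + 1) * L))))
      = n * Γ ^ k * (D * T * Real.exp (-(a * T / m)) + 2 * Real.exp (-((γ + 1) * L))) := by ring
    _ ≤ Real.exp (γ * L) * (D * T * Real.exp (-(a * T / m)) + 2 * Real.exp (-((γ + 1) * L))) := by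
        gcongr
    _ = D * (T * (Real.exp (γ * L) * Real.exp (-(a * T / m)))) +
        2 * (Real.exp (γ * L) * Real.exp (-((γ + 1) * L))) := by ring
    _ ≤ _ := by rw [h6]; gcongr

/-- The separation needed for exact recovery, in terms of `ρ = √T cgap cpi² / L`. -/
theorem separation_of_rate {α β b γ L m T cgap cpi ρ : ℝ} (hα : 0 < α) (hβ : 0 < β) (hb : 0 < b)
    (hγ : 0 < γ) (hL : 1 ≤ L) (hmL : m ≤ L) (hT : 1 ≤ T) (hLT : L ≤ Real.sqrt T)
    (hρ : ρ = Real.sqrt T * cgap * cpi ^ 2 / L) (h : 2 * (b * γ) * (β + 3 * α) / α ^ 2 < ρ) :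
    2 * (b * (γ * L)) * (β * m * T + 3 * (α * T)) < cpi * cgap * (α * T) ^ 2 * cpi := by
  have hsT := Real.sq_sqrt (show (0 : ℝ) ≤ T by linarith)
  have hsT0 : 0 < Real.sqrt T := Real.sqrt_pos.2 (by linarith)
  have hL0 : 0 < L := by linarith
  rw [div_lt_iff₀ (by positivity)] at h
  have e1 : cpi * cgap * (α * T) ^ 2 * cpi = ρ * α ^ 2 * (L * Real.sqrt T * T) := by
    rw [hρ]
    field_simp
    rw [hsT]
  rw [e1]
  have h1 : β * m * T + 3 * (α * T) ≤ (β + 3 * α) * (L * T) := by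
    have p1 : β * m * T ≤ β * L * T := by gcongr
    have p2 : 3 * (α * T) ≤ 3 * (α * (L * T)) := by
      gcongr; exact le_mul_of_one_le_left (by linarith) hL
    linarith
  calc 2 * (b * (γ * L)) * (β * m * T + 3 * (α * T))
      ≤ 2 * (b * (γ * L)) * ((β + 3 * α) * (L * T)) := by gcongr
    -- One L is the noise level and the other bounds the dimension m from the upper loss constant;
    -- replacing the second by √T matches the rate hypothesis.
    _ = 2 * (b * γ) * (β + 3 * α) * (L * L * T) := by ring
    _ ≤ 2 * (b * γ) * (β + 3 * α) * (L * Real.sqrt T * T) := by gcongr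
    _ < _ := by gcongr

end GMNAR

theorem corollary1 (M : ℕ → GMNAR)
    (R τ c K κ C cbar : ℝ) (σ : ℝ≥0) (cgap cpi : ℕ → ℝ)
    (hR : 0 < R) (hτ : 0 < τ) (hσ : 0 < σ) (hc : 0 < c) (hK : 0 < K) (hκ : κ < 1)
    (hmodel : ∀ n, (M n).IsModel)
    (hparam : ∀ n, (M n).ParamSpace R)
    (hconvex : ∀ n, (M n).Convexity τ)
    (hnoise : ∀ n, (M n).NoiseAssumption σ)
    (hcov : ∀ n, (M n).CovariateAssumption c K)
    (hstat : ∀ n, (M n).Stationarity κ C)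
    (hgap_pos : ∀ n, 0 < cgap n) (hgap_le : ∀ n, cgap n ≤ cbar)
    (hgap : ∀ n, (M n).GroupDifference (cgap n))
    (hpi_pos : ∀ n, 0 < cpi n) (hpi : ∀ n, (M n).GroupProportion (cpi n))
    (hN₁ : Tendsto (fun n => (M n).N₁) atTop atTop)
    (hN₂ : Tendsto (fun n => (M n).N₂) atTop atTop)
    (hT : Tendsto (fun n => (M n).T) atTop atTop)
    (hrate : Tendsto (fun n => Real.sqrt (M n).T * cgap n * cpi n ^ 2 /
      (Real.log ((M n).N₁ * (M n).N₂ * (M n).H) + (M n).m)) atTop atTop)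
    (D : Set ℝ) (hD : D = Set.Icc (-R) R ∨ D = Set.univ)
    (θhat θor : ∀ n, (M n).Ω → (M n).Params)
    (ghat : ∀ n, (M n).Ω → Fin (M n).N₁ → Fin (M n).G)
    (hhat : ∀ n, (M n).Ω → Fin (M n).N₂ → Fin (M n).H)
    (hest : ∀ n, ∀ᵐ ω ∂(M n).μ, (M n).IsEstimate D ω (θhat n ω) (ghat n ω) (hhat n ω))
    (hor : ∀ n, ∀ᵐ ω ∂(M n).μ, (M n).IsOracle D ω (θor n ω)) :
    WithProbToOne M (fun n => {ω |
      ∃ (s : Equiv.Perm (Fin (M n).G)) (r : Equiv.Perm (Fin (M n).H)),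
        (∀ i, ghat n ω i = s ((M n).g₀ i)) ∧ (∀ j, hhat n ω j = r ((M n).h₀ j))}) ∧
    WithProbToOne M (fun n => {ω |
      ∃ (s : Equiv.Perm (Fin (M n).G)) (r : Equiv.Perm (Fin (M n).H)),
        (∀ i, ghat n ω i = s ((M n).g₀ i)) ∧ (∀ j, hhat n ω j = r ((M n).h₀ j)) ∧
        (θhat n ω).relabel s r = θor n ω}) := by
  suffices hmain : WithProbToOne M (fun n => {ω |
      ∃ (s : Equiv.Perm (Fin (M n).G)) (r : Equiv.Perm (Fin (M n).H)),
        (∀ i, ghat n ω i = s ((M n).g₀ i)) ∧ (∀ j, hhat n ω j = r ((M n).h₀ j)) ∧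
        (θhat n ω).relabel s r = θor n ω}) from
    ⟨hmain.mono fun n ω ⟨s, r, h1, h2, _⟩ => ⟨s, r, h1, h2⟩, hmain⟩
  have hmid : ∀ x ∈ D, ∀ y ∈ D, (x + y) / 2 ∈ D := by
    rcases hD with rfl | rfl
    · rintro x ⟨h1, h2⟩ y ⟨h3, h4⟩
      constructor <;> linarith
    · simp
  have hIoo : Set.Ioo (-R) R ⊆ D := by
    rcases hD with rfl | rfl
    · exact Set.Ioo_subset_Icc_self
    · exact Set.subset_univ _
  have hθ₀ : ∀ n, (M n).θ₀.CoordsIn D := fun n =>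
    ⟨fun g => hIoo ((hparam n).1 g), fun g k => hIoo ((hparam n).2.1 g k),
      fun g => hIoo ((hparam n).2.2.1 g), fun g k => hIoo ((hparam n).2.2.2.1 g k),
      fun g k => hIoo ((hparam n).2.2.2.2 g k)⟩
  have hcbar : 0 < cbar := (hgap_pos 0).trans_le (hgap_le 0)
  -- Enlarging κ preserves the stability bound and makes it positive, so that its powers can serve
  -- as weights in denominators.
  set κ' := max κ (1 / 2) with hκ'
  have hκ'1 : κ' < 1 := max_lt hκ (by norm_num)
  obtain ⟨n₀, hn₀⟩ := ((hN₁.eventually_gt_atTop 0).and (hN₂.eventually_gt_atTop 0)).exists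
  have hC : 1 ≤ C := (hstat n₀).one_le hn₀.1 hn₀.2
  have hκ0 : 0 ≤ κ := (hstat n₀).nonneg hn₀.1 hn₀.2
  have hreg : ∀ n, 0 < (M n).N₁ → 0 < (M n).N₂ → (M n).Regular R τ c K κ' C σ := fun n h1 h2 =>
    { model := hmodel n
      param := hparam n
      convex := hconvex n
      noise := hnoise n
      cov := hcov n
      stable := fun k y hy i j => ((hstat n).2.1 k y hy i j).trans (by
        gcongr
        exact le_max_left _ _)
      sqInt := (hstat n).2.2.1
      stat := (hstat n).2.2.2
      R_pos := hR
      τ_pos := hτ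
      c_pos := hc
      K_pos := hK
      κ_ge := le_max_right _ _
      κ_lt := hκ'1
      C_ge := hC
      σ_pos := hσ
      N₁_pos := h1
      N₂_pos := h2 }
  obtain ⟨α, β, b, t₀, Γ, a, D', hα, hβ, hb, ht₀, hΓ, ha, hD', htail⟩ :=
    GMNAR.loss_tail hR hτ hc hK (le_max_right κ (1 / 2)) hκ'1 hC hσ
  set γ := 1 + Real.log Γ with hγ
  have hγ1 : 1 ≤ γ := by linarith [Real.log_nonneg hΓ]
  set L : ℕ → ℝ := fun n => Real.log ((M n).N₁ * (M n).N₂ * (M n).H) + (M n).m with hL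
  set ρ : ℕ → ℝ := fun n => Real.sqrt (M n).T * cgap n * cpi n ^ 2 / L n with hρ
  have hbasic : ∀ n, 0 < (M n).N₁ → 0 < (M n).N₂ →
      ((M n).N₁ * (M n).N₂ : ℝ) ≤ Real.exp (L n - (M n).m) ∧ ((M n).m : ℝ) ≤ L n ∧
        Real.log (M n).N₁ ≤ L n := fun n h1 h2 => by
    have h3 : 0 < (M n).H := Fin.pos ((M n).h₀ ⟨0, h2⟩)
    have q1 : (1 : ℝ) ≤ (M n).N₁ := by exact_mod_cast h1
    have q2 : (1 : ℝ) ≤ (M n).N₂ := by exact_mod_cast h2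
    have q3 : (1 : ℝ) ≤ (M n).H := by exact_mod_cast h3
    have q4 : (1 : ℝ) ≤ (M n).N₁ * (M n).N₂ := one_le_mul_of_one_le_of_one_le q1 q2
    have q5 : ((M n).N₁ : ℝ) ≤ (M n).N₁ * (M n).N₂ := le_mul_of_one_le_right (by linarith) q2
    have q6 : ((M n).N₁ * (M n).N₂ : ℝ) ≤ (M n).N₁ * (M n).N₂ * (M n).H :=
      le_mul_of_one_le_right (by linarith) q3
    have hm := GMNAR.Regular.m_ge (M := M n)
    refine ⟨?_, ?_, ?_⟩
    · simp only [hL, add_sub_cancel_right]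
      rwa [Real.exp_log (by linarith)]
    · have := Real.log_nonneg (q4.trans q6)
      simp only [hL]; linarith
    · have := Real.log_le_log (by linarith) (q5.trans q6)
      simp only [hL]; linarith
  -- The gap is at most `cbar` and the proportions are at most one, so the rate hypothesis already
  -- contains √T / L → ∞.
  have hrT : Tendsto (fun n => Real.sqrt (M n).T / L n) atTop atTop := by
    refine tendsto_atTop_mono' atTop ?_ (hrate.atTop_div_const hcbar)
    filter_upwards [hN₁.eventually_gt_atTop 0, hN₂.eventually_gt_atTop 0] with n h1 h2
    obtain ⟨-, h4, -⟩ := hbasic n h1 h2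
    have hm := GMNAR.Regular.m_ge (M := M n)
    have hLp : 0 < L n := by linarith
    have hc1 := (hpi n).le_one h1
    have hc0 := hpi_pos n
    rw [div_le_iff₀ hcbar, div_mul_eq_mul_div]
    change Real.sqrt (M n).T * cgap n * cpi n ^ 2 / L n ≤ _
    refine div_le_div_of_nonneg_right ?_ hLp.le
    calc Real.sqrt (M n).T * cgap n * cpi n ^ 2 ≤ Real.sqrt (M n).T * cbar * 1 := by
          gcongr
          · exact hgap_le n
          · exact pow_le_one₀ hc0.le hc1
      _ = _ := mul_one _
  have hLtop : Tendsto L atTop atTop := by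
    refine tendsto_atTop_mono' atTop ?_
      (Real.tendsto_log_atTop.comp (tendsto_natCast_atTop_atTop.comp hN₁))
    filter_upwards [hN₁.eventually_gt_atTop 0, hN₂.eventually_gt_atTop 0] with n h1 h2
    exact (hbasic n h1 h2).2.2
  have hp : Tendsto (fun n => D' * ((M n).T * Real.exp (-Real.sqrt (M n).T)) +
      2 * Real.exp (-L n)) atTop (𝓝 0) := by
    have h1 := (GMNAR.tendsto_mul_exp_neg_sqrt.comp hT).const_mul D'
    have h2 := (Real.tendsto_exp_neg_atTop_nhds_zero.comp hLtop).const_mul 2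
    simpa using h1.add h2
  refine withProbToOne_of_tail (fun n => (hmodel n).1) hp ?_
  -- The thresholds for √T / L serve, in order, L ≤ √T, the union bound, the exponent aT/m, and T ≥
  -- t₀ m; the last condition is the separation.
  filter_upwards [hN₁.eventually_gt_atTop 0, hN₂.eventually_gt_atTop 0, hT.eventually_gt_atTop 0,
    hrT.eventually_ge_atTop 1, hrT.eventually_ge_atTop γ, hrT.eventually_ge_atTop (2 / a),
    hrT.eventually_ge_atTop t₀,
    hrate.eventually_gt_atTop (2 * (b * (γ + 1)) * (β + 3 * α) / α ^ 2)] with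
    n h1 h2 hT0 hr1 hrγ hra hrt hρn
  obtain ⟨hnL, hmL, -⟩ := hbasic n h1 h2
  have hm := GMNAR.Regular.m_ge (M := M n)
  have hLp : 0 < L n := by linarith
  have hT1 : (1 : ℝ) ≤ (M n).T := by exact_mod_cast hT0
  rw [le_div_iff₀ hLp] at hr1 hrγ hra hrt
  have hsT : Real.sqrt (M n).T ≤ (M n).T := by
    rw [Real.sqrt_le_left (by linarith)]
    nlinarith
  have h := hreg n h1 h2
  -- Of the exponent x = (γ + 1)L, the part γL offsets the union bound and L is left to tend to
  -- infinity.
  have hx : 0 < (γ + 1) * L n := by positivity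
  have hbad := htail (M n) h (((mul_le_mul_of_nonneg_left hmL (by linarith)).trans hrt).trans hsT)
    _ hx
  refine ⟨_, hbad.trans (ENNReal.ofReal_le_ofReal ?_), ?_⟩
  · refine GMNAR.failure_bound rfl hT1 hΓ hD' hγ (by linarith) hnL hmL hrγ ?_
    rw [div_mul_eq_mul_div, div_le_iff₀ ha] at hra
    linarith
  · filter_upwards [hest n, hor n] with ω he ho hgood
    have hLB : (M n).LossBounds (α * (M n).T) (β * (M n).m * (M n).T) (b * ((γ + 1) * L n)) ω :=
      not_not.1 hgood
    refine he.exists_relabel_eq_oracle ho hmid (hθ₀ n) hLB h1 h2 (by positivity) (by positivity)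
      (by positivity) (hpi_pos n) (hpi n) (hgap n) ?_
    exact GMNAR.separation_of_rate hα hβ hb (by linarith) (by linarith) hmL hT1
      (by linarith) rfl hρn
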